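/- **Conventions.** For $n$ qubits with computational basis $|x\rangle$, $x\in\mathbb F_2^n$, put $Z(z)|y\rangle=(-1)^{z\cdot y}|y\rangle$, $X(x)|y\rangle=|y+x\rangle$. The Pauli operators are $w(z,x)=i^{-z\cdot x}Z(z)X(x)$ (with $z\cdot x$ computed in $\mathbb Z$), and the Pauli group is $\mathcal P_n=\{i^k w(z,x)\}$. A Clifford unitary is a unitary $U$ with $U\mathcal P_nU^\dagger=\mathcal P_n$. A pure stabiliser state is $|\psi\rangle\langle\psi|$ for a unit vector $\psi$ fixed by every element of an Abelian subgroup of $\mathcal P_n$ of order $2^n$ that does not contain $-\mathbb 1$. The stabiliser polytope $\mathrm{SP}_n$ is the convex hull of the pure stabiliser states. A linear map $\mathcal E$ on the operators on two qubits is *completely stabiliser-preserving* if $(\mathcal E\otimes\mathrm{id}_k)(\mathrm{SP}_{2+k})\subset\mathrm{SP}_{2+k}$ for all $k\in\mathbb N$; the set of these maps is $\mathrm{CSP}_2(2)$. The set $\mathrm{SO}_2(2)$ of *stabiliser operations* consists of the maps from two qubits to two qubits composed of finitely many steps of the following kinds: preparation of qubits in stabiliser states, Clifford unitaries, measurements of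 Pauli operators, and discarding of qubits, where the choice of each step may be an arbitrary random function of the previous measurement outcomes. A map $\mathcal E$ has a *Clifford dilation* if $\mathcal E(\rho)=\operatorname{tr}_{3,\dots,2+k}[U(\rho\otimes|s\rangle\langle s|)U^\dagger]$ for some $k$, some $k$-qubit stabiliser state $|s\rangle$ and some Clifford unitary $U$ on $2+k$ qubits. **Theorem.** For two qubits, every stabiliser operation is completely stabiliser-preserving, and $\mathrm{CSP}_2(2)$ is strictly larger than $\mathrm{SO}_2(2)$. More precisely, let $|{+}\rangle=(|0\rangle+|1\rangle)/\sqrt2$, $\rho_{x,y}=\langle x|\rho|y\rangle$, and $$\Lambda(\rho)=\rho_{00,00}\,|{+}{+}\rangle\langle{+}{+}|+\sum_{x\in\{01,10,11\}}\rho_{x,x}\,|x\rangle\langle x|+\frac12\sum_{\substack{x,y\in\{01,10,11\}\\x\neq y}}\rho_{x,y}\,|x\rangle\langle y|.$$ Then: 1. $\Lambda\in\mathrm{CSP}_2(2)$ and $\Lambda\notin\mathrm{SO}_2(2)$; 2. $\Lambda$ is a vertex (extreme point) of $\mathrm{CSP}_2(2)$; 3. $\Lambda$ has no Clifford dilation;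 4. the kernel of $\Lambda$ contains no Pauli operator $w(z,x)$; 5. if $\mathcal O$ is an extreme point of $\mathrm{SO}_2(2)$ that has no Clifford dilation, then the kernel of $\mathcal O$ contains a Pauli operator $w(z,x)$. -/

import Mathlib

namespace QubitStab

open Matrix

/-- Labels of the computational basis of `n` qubits. -/
abbrev Q (n : ℕ) : Type := Fin n → ZMod 2

/-- Operators on `n` qubits, as matrices in the computational basis. -/
abbrev Op (n : ℕ) : Type := Matrix (Q n) (Q n) ℂ

/-- Superoperators from `n` qubits to `m` qubits. -/
abbrev Superop (n m : ℕ) : Type := Op n →ₗ[ℂ] Op m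

/-- The first `n` coordinates of a label of `n + k` qubits. -/
def fstPart {n k : ℕ} (x : Q (n + k)) : Q n := fun i => x (Fin.castAdd k i)

/-- The last `k` coordinates of a label of `n + k` qubits. -/
def sndPart {n k : ℕ} (x : Q (n + k)) : Q k := fun i => x (Fin.natAdd n i)

/-- `Z(z)|y⟩ = (-1)^(z·y) |y⟩`. -/
noncomputable def opZ {n : ℕ} (z : Q n) : Op n :=
  Matrix.diagonal fun y => (-1 : ℂ) ^ (∑ i, (z i).val * (y i).val)

/-- `X(x)|y⟩ = |y + x⟩`. -/
noncomputable def opX {n : ℕ} (x : Q n) : Op n :=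
  Matrix.of fun u y => if u = y + x then 1 else 0

/-- The Pauli operator `w(z, x) = i^(-z·x) Z(z) X(x)`, where `z·x` is computed in the integers. -/
noncomputable def pauli {n : ℕ} (z x : Q n) : Op n :=
  (Complex.I ^ (∑ i, (z i).val * (x i).val))⁻¹ • (opZ z * opX x)

/-- The Pauli group `{i^k w(z, x)}`. -/
def pauliGroup (n : ℕ) : Set (Op n) :=
  {M | ∃ (k : ℕ) (z x : Q n), M = Complex.I ^ k • pauli z x}

/-- `U` is a Clifford unitary: it is unitary and `U P_n U† = P_n`. -/
def IsClifford {n : ℕ} (U : Op n) : Prop :=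
  U ∈ Matrix.unitaryGroup (Q n) ℂ ∧ (fun M : Op n => U * M * Uᴴ) '' pauliGroup n = pauliGroup n

/-- A stabiliser group: an Abelian subgroup of the Pauli group that does not contain `-1`. -/
structure IsStabilizerGroup {n : ℕ} (S : Subgroup (Matrix.unitaryGroup (Q n) ℂ)) : Prop where
  pauli_mem : ∀ s ∈ S, (s : Op n) ∈ pauliGroup n
  comm : ∀ s ∈ S, ∀ t ∈ S, s * t = t * s
  neg_one : ∀ s ∈ S, (s : Op n) ≠ -1

/-- A pure stabiliser state vector: a unit vector fixed by all elements of a stabiliser group of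
order `2^n`. -/
def IsStabilizerVec {n : ℕ} (ψ : Q n → ℂ) : Prop :=
  star ψ ⬝ᵥ ψ = 1 ∧ ∃ S : Subgroup (Matrix.unitaryGroup (Q n) ℂ),
    IsStabilizerGroup S ∧ Nat.card S = 2 ^ n ∧ ∀ s ∈ S, (s : Op n) *ᵥ ψ = ψ

/-- `|ψ⟩⟨ψ|`. -/
def ketbra {n : ℕ} (ψ : Q n → ℂ) : Op n := Matrix.vecMulVec ψ (star ψ)

/-- The pure stabiliser states, as density matrices. -/
def STAB (n : ℕ) : Set (Op n) := {ρ | ∃ ψ : Q n → ℂ, IsStabilizerVec ψ ∧ ρ = ketbra ψ}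

/-- The stabiliser polytope. -/
def SP (n : ℕ) : Set (Op n) := convexHull ℝ (STAB n)

/-- The map `E ⊗ id_k`. -/
def tensorId {n m : ℕ} (k : ℕ) (E : Superop n m) (ρ : Op (n + k)) : Op (m + k) :=
  Matrix.of fun x y =>
    E (Matrix.of fun a b => ρ (Fin.append a (sndPart x)) (Fin.append b (sndPart y)))
      (fstPart x) (fstPart y)

/-- The completely stabiliser-preserving superoperators. -/
def CSP (n m : ℕ) : Set (Superop n m) :=
  {E | ∀ k : ℕ, ∀ ρ ∈ SP (n + k), tensorId k E ρ ∈ SP (m + k)}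

/-- `ρ ↦ A ρ A†`. -/
def conj {n : ℕ} (A : Op n) : Superop n n where
  toFun ρ := A * ρ * Aᴴ
  map_add' ρ σ := by rw [mul_add, add_mul]
  map_smul' c ρ := by simp

/-- `ρ ↦ ρ ⊗ σ`: preparation of `k` further qubits in the state `σ`. -/
def prepare {n k : ℕ} (σ : Op k) : Superop n (n + k) where
  toFun ρ := Matrix.of fun x y => ρ (fstPart x) (fstPart y) * σ (sndPart x) (sndPart y)
  map_add' ρ ρ' := by ext x y; simp [add_mul]
  map_smul' c ρ := by ext x y; simp [mul_assoc]

/-- Partial trace over the last `k` qubits. -/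
def discard {n k : ℕ} : Superop (n + k) n where
  toFun ρ := Matrix.of fun x y => ∑ u : Q k, ρ (Fin.append x u) (Fin.append y u)
  map_add' ρ ρ' := by ext x y; simp [Finset.sum_add_distrib]
  map_smul' c ρ := by ext x y; simp [Finset.mul_sum]

/-- The projection onto the `+1` eigenspace of `w(z, x)`. -/
noncomputable def projPlus {n : ℕ} (z x : Q n) : Op n := (1 / 2 : ℂ) • (1 + pauli z x)

/-- The projection onto the `-1` eigenspace of `w(z, x)`. -/
noncomputable def projMinus {n : ℕ} (z x : Q n) : Op n := (1 / 2 : ℂ) • (1 - pauli z x)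

/-- Stabiliser operations, as finite adaptive protocols read from the first step on. After a Pauli
measurement the rest of the protocol may depend on the outcome; at any time the rest of the
protocol may be chosen at random. New qubits are appended at the end and the last qubits are
discarded; since permutations of qubits are Clifford unitaries, this is no restriction. -/
inductive IsStabilizerOp : {n m : ℕ} → Superop n m → Prop
  | id {n : ℕ} : IsStabilizerOp (LinearMap.id : Superop n n)
  | prepare {n k m : ℕ} (σ : Op k) (hσ : σ ∈ STAB k) (O : Superop (n + k) m)
      (hO : IsStabilizerOp O) : IsStabilizerOp (O ∘ₗ prepare σ)
  | clifford {n m : ℕ} (U : Op n) (hU : IsClifford U) (O : Superop n m)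
      (hO : IsStabilizerOp O) : IsStabilizerOp (O ∘ₗ conj U)
  | measure {n m : ℕ} (z x : Q n) (O₁ O₂ : Superop n m)
      (h₁ : IsStabilizerOp O₁) (h₂ : IsStabilizerOp O₂) :
      IsStabilizerOp (O₁ ∘ₗ conj (projPlus z x) + O₂ ∘ₗ conj (projMinus z x))
  | discard {n k m : ℕ} (O : Superop n m) (hO : IsStabilizerOp O) :
      IsStabilizerOp (O ∘ₗ (discard : Superop (n + k) n))
  | random {n m : ℕ} (p : ℝ) (hp₀ : 0 ≤ p) (hp₁ : p ≤ 1) (O₁ O₂ : Superop n m)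
      (h₁ : IsStabilizerOp O₁) (h₂ : IsStabilizerOp O₂) :
      IsStabilizerOp (p • O₁ + (1 - p) • O₂)

/-- The set of stabiliser operations from `n` to `m` qubits. -/
def SO (n m : ℕ) : Set (Superop n m) := {O | IsStabilizerOp O}

/-- `E` has a Clifford dilation: `E(ρ) = tr_k [U (ρ ⊗ |s⟩⟨s|) U†]` with a `k`-qubit stabiliser
state `s` and a Clifford unitary `U`, where the last `k` qubits are traced out. -/
def HasCliffordDilation {n : ℕ} (E : Superop n n) : Prop :=
  ∃ (k : ℕ) (σ : Op k) (U : Op (n + k)), σ ∈ STAB k ∧ IsClifford U ∧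
    ∀ ρ : Op n, E ρ = discard (conj U (prepare σ ρ))

/-- `|+⟩ = (|0⟩ + |1⟩)/√2`. -/
noncomputable def ketPlus : ZMod 2 → ℂ := fun _ => 1 / (Real.sqrt 2 : ℂ)

/-- `|++⟩`. -/
noncomputable def ketPlusPlus : Q 2 → ℂ := fun x => ketPlus (x 0) * ketPlus (x 1)

/-- The channel `Λ`; the label `0 : Q 2` is `00`. -/
noncomputable def Lam : Superop 2 2 where
  toFun ρ := ρ 0 0 • ketbra ketPlusPlus
    + ∑ x : Q 2 with x ≠ 0, ρ x x • Matrix.single x x (1 : ℂ)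
    + (1 / 2 : ℂ) • ∑ x : Q 2 with x ≠ 0, ∑ y : Q 2 with y ≠ 0 ∧ x ≠ y,
        ρ x y • Matrix.single x y (1 : ℂ)
  map_add' ρ σ := by
    simp only [Matrix.add_apply, add_smul, Finset.sum_add_distrib, smul_add]
    abel
  map_smul' c ρ := by
    simp only [Matrix.smul_apply, smul_eq_mul, mul_smul, ← Finset.smul_sum, smul_add,
      RingHom.id_apply]
    rw [smul_comm c (1 / 2 : ℂ)]

end QubitStab

namespace QubitStab

open Matrix

/-! A vector is a multiple of a stabiliser state exactly when each of its Pauli expectations is `0`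
or `±‖ψ‖²` (`StabLike`). Both directions are counting: the squared expectations of a unit vector sum
to `2^n`, and a stabiliser group of order `2^n` uses up this budget. The criterion needs no
normalisation and survives Pauli projections (`StabLike.one_add_pauli`), Clifford unitaries, tensor
products, relabellings and compression to a basis state of some qubits. So every step of a protocol
maps the cone over the stabiliser polytope to itself, and trace preservation gives `SO_subset_CSP`.

`Λ` is a positive combination of products of Pauli projections (`Lam_eq`), so it preserves the cones
too; it also preserves the trace, hence is CSP. For extremality, consider its Choi state, whose
support is spanned by `|++,00⟩` and the `|x,x⟩` with `x ≠ 0`. Supports of stabiliser vectors are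
affine, so a stabiliser vector in this span is either a multiple of `|++,00⟩` or a combination of at
most two of the `|x,x⟩`. Two linear functionals, the second nonnegative on the zero face of the
first, cut out a face on which a state is determined by its marginal on the second pair. All CSP
maps share that marginal, so `Λ` is the only CSP map on this face (`Lam_mem_extremePoints`).

In the Heisenberg picture a Clifford dilation sends a Pauli observable to a scalar times a Pauli
operator, so its expectations in different basis states agree up to sign; `Λ` violates this.

For stabiliser operations, follow a protocol while it stays measurement-free, in the form
`IsDilated`. At a Pauli measurement, pulled back to input and ancilla, either the outcome is a fair
coin and each branch is again measurement-free, or the input itself is measured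
(`IsDilated.measure`). A nontrivial measurement of the input destroys every anticommuting Pauli
operator, whatever happens later. Hence `SO` is the convex hull of the dilated maps and of the
stabiliser operations with a Pauli operator in the kernel (`IsStabilizerOp.comp_mem_convexHull`),
and its extreme points are among these. If `Λ` were in `SO`, it would be extreme there too, but it
is of neither kind. -/

/-! ### Characters, phases and the algebra of Pauli operators. -/

/-- The character `(-1)^(z·y)`. -/
noncomputable def chi {n : ℕ} (z y : Q n) : ℂ := (-1 : ℂ) ^ (∑ i, (z i).val * (y i).val)

/-- `ZMod.val` is additive only modulo 2, which is all that a sign sees. -/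
theorem neg_one_pow_val_add (a b c : ZMod 2) :
    (-1 : ℂ) ^ (a.val * (b + c).val) = (-1) ^ (a.val * b.val) * (-1) ^ (a.val * c.val) := by
  revert a b c
  have h : ∀ a b c : ZMod 2, (a.val * (b + c).val) % 2 = (a.val * b.val + a.val * c.val) % 2 := by
    decide
  intro a b c
  rw [← pow_add, neg_one_pow_eq_pow_mod_two, h, ← neg_one_pow_eq_pow_mod_two]

theorem chi_eq_prod {n : ℕ} (z y : Q n) : chi z y = ∏ i, (-1 : ℂ) ^ ((z i).val * (y i).val) := by
  rw [chi, Finset.prod_pow_eq_pow_sum]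

theorem chi_comm {n : ℕ} (z y : Q n) : chi z y = chi y z := by
  simp only [chi, mul_comm]

theorem chi_add_right {n : ℕ} (z y y' : Q n) : chi z (y + y') = chi z y * chi z y' := by
  simp only [chi_eq_prod, ← Finset.prod_mul_distrib, Pi.add_apply, neg_one_pow_val_add]

theorem chi_add_left {n : ℕ} (z z' y : Q n) : chi (z + z') y = chi z y * chi z' y := by
  rw [chi_comm, chi_add_right, chi_comm y, chi_comm y]

theorem chi_mul_self {n : ℕ} (z y : Q n) : chi z y * chi z y = 1 := by
  rw [chi, ← mul_pow]; simp

theorem chi_eq_or {n : ℕ} (z y : Q n) : chi z y = 1 ∨ chi z y = -1 :=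
  neg_one_pow_eq_or ℂ _

theorem chi_ne_zero {n : ℕ} (z y : Q n) : chi z y ≠ 0 := by
  rcases chi_eq_or z y with h | h <;> simp [h]

@[simp] theorem chi_zero_right {n : ℕ} (z : Q n) : chi z 0 = 1 := by simp [chi]

@[simp] theorem chi_zero_left {n : ℕ} (z : Q n) : chi 0 z = 1 := by simp [chi]

@[simp] theorem star_chi {n : ℕ} (z y : Q n) : star (chi z y) = chi z y := by simp [chi]

@[simp] theorem conj_chi {n : ℕ} (z y : Q n) : (starRingEnd ℂ) (chi z y) = chi z y := by simp [chi]

theorem label_add_self {n : ℕ} (x : Q n) : x + x = 0 :=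
  funext fun i => CharTwo.add_self_eq_zero (x i)

theorem label_add_add_cancel {n : ℕ} (x y : Q n) : x + y + y = x := by
  rw [add_assoc, label_add_self, add_zero]

theorem label_eq_add_iff {n : ℕ} (u y x : Q n) : u = y + x ↔ y = u + x :=
  ⟨fun h => by rw [h, label_add_add_cancel], fun h => by rw [h, label_add_add_cancel]⟩

/-- The sum factorises over the qubits, and a coordinate with `y i = 1` contributes the factor `1 +
(-1) = 0`. -/
theorem sum_chi {n : ℕ} (y : Q n) : ∑ z : Q n, chi z y = if y = 0 then (2 : ℂ) ^ n else 0 := by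
  have h : ∑ z : Q n, chi z y = ∏ i, ∑ a : ZMod 2, (-1 : ℂ) ^ (a.val * (y i).val) := by
    rw [Finset.prod_univ_sum]
    simp only [chi_eq_prod, Fintype.piFinset_univ]
  have h2 : ∀ b : ZMod 2, ∑ a : ZMod 2, (-1 : ℂ) ^ (a.val * b.val) = if b = 0 then 2 else 0 := by
    intro b
    change ∑ a : Fin 2, (-1 : ℂ) ^ ((ZMod.val (n := 2) a) * b.val) = _
    rw [Fin.sum_univ_two]
    have hb : b = 0 ∨ b = 1 := by revert b; decide
    rcases hb with rfl | rfl
    · rw [if_pos rfl, ZMod.val_zero, mul_zero, mul_zero]; norm_num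
    · change (-1 : ℂ) ^ 0 + (-1) ^ 1 = if (1 : ZMod 2) = 0 then 2 else 0
      simp
  rw [h]
  simp only [h2]
  by_cases hy : y = 0
  · simp [hy]
  · rw [if_neg hy]
    obtain ⟨i, hi⟩ := Function.ne_iff.mp hy
    exact Finset.prod_eq_zero (Finset.mem_univ i) (if_neg hi)

/-- The phase `i^(-z·x)`. -/
noncomputable def phase {n : ℕ} (z x : Q n) : ℂ := (Complex.I ^ (∑ i, (z i).val * (x i).val))⁻¹

theorem phase_mul_self {n : ℕ} (z x : Q n) : phase z x * phase z x = chi z x := by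
  rw [phase, chi, ← mul_inv, ← mul_pow, Complex.I_mul_I, ← inv_pow]; norm_num

theorem phase_ne_zero {n : ℕ} (z x : Q n) : phase z x ≠ 0 := by simp [phase]

theorem phase_mul_star {n : ℕ} (z x : Q n) : phase z x * star (phase z x) = 1 := by
  rw [phase, star_inv₀, star_pow, ← mul_inv, ← mul_pow]; simp

/-- The phase has modulus one and its square is the sign `chi z x`, so its inverse differs from it
by that sign. This is what makes `pauli z x` Hermitian. -/
theorem star_phase {n : ℕ} (z x : Q n) : star (phase z x) = phase z x * chi z x := by
  have h := phase_mul_star z x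
  have h2 := phase_mul_self z x
  have h3 := chi_mul_self z x
  apply mul_left_cancel₀ (phase_ne_zero z x)
  rw [h, ← mul_assoc, h2, h3]

theorem phase_pow_four {n : ℕ} (z x : Q n) : phase z x ^ 4 = 1 := by
  have : phase z x ^ 4 = (phase z x * phase z x) * (phase z x * phase z x) := by ring
  rw [this, phase_mul_self, chi_mul_self]

@[simp] theorem phase_zero_right {n : ℕ} (z : Q n) : phase z 0 = 1 := by simp [phase]

@[simp] theorem phase_zero_left {n : ℕ} (z : Q n) : phase 0 z = 1 := by simp [phase]

theorem pauli_apply {n : ℕ} (z x u y : Q n) :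
    pauli z x u y = if u = y + x then phase z x * chi z u else 0 := by
  simp only [pauli, opZ, opX, Matrix.smul_apply, Matrix.diagonal_mul, Matrix.of_apply, smul_eq_mul,
    mul_ite, mul_one, mul_zero]
  rfl

theorem pauli_mulVec {n : ℕ} (z x : Q n) (ψ : Q n → ℂ) (u : Q n) :
    (pauli z x *ᵥ ψ) u = phase z x * chi z u * ψ (u + x) := by
  rw [Matrix.mulVec, dotProduct, Finset.sum_eq_single (u + x)]
  · rw [pauli_apply, if_pos (label_add_add_cancel u x).symm]
  · intro b _ hb
    rw [pauli_apply, if_neg, zero_mul]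
    rwa [label_eq_add_iff]
  · simp

theorem pauli_mul_apply {n : ℕ} (z x z' x' u y : Q n) :
    (pauli z x * pauli z' x') u y =
      if u = y + (x + x') then phase z x * phase z' x' * chi z' x * chi (z + z') u else 0 := by
  have h : (pauli z x * pauli z' x') u y = (pauli z x *ᵥ fun v => pauli z' x' v y) u := rfl
  rw [h, pauli_mulVec, pauli_apply]
  have : u + x = y + x' ↔ u = y + (x + x') := by
    constructor
    · intro h; rw [← label_add_add_cancel u x, h, add_comm x, add_assoc]
    · intro h; rw [h, add_comm x, ← add_assoc, label_add_add_cancel]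
  simp only [this]
  split_ifs
  · rw [chi_add_right, chi_add_left]; ring
  · simp

theorem pauli_mul {n : ℕ} (z x z' x' : Q n) :
    pauli z x * pauli z' x' =
      (phase z x * phase z' x' * chi z' x * (phase (z + z') (x + x'))⁻¹) •
        pauli (z + z') (x + x') := by
  ext u y
  rw [pauli_mul_apply, Matrix.smul_apply, pauli_apply]
  have := phase_ne_zero (z + z') (x + x')
  split_ifs
  · simp only [smul_eq_mul]; field_simp
  · simp

/-- The commutation sign of two Pauli operators. -/
noncomputable def omega {n : ℕ} (z x z' x' : Q n) : ℂ := chi z' x * chi z x'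

theorem omega_eq_or {n : ℕ} (z x z' x' : Q n) : omega z x z' x' = 1 ∨ omega z x z' x' = -1 := by
  rw [omega]
  rcases chi_eq_or z' x with h | h <;> rcases chi_eq_or z x' with h' | h' <;> simp [h, h']

theorem pauli_mul_comm {n : ℕ} (z x z' x' : Q n) :
    pauli z x * pauli z' x' = omega z x z' x' • (pauli z' x' * pauli z x) := by
  ext u y
  rw [Matrix.smul_apply, pauli_mul_apply, pauli_mul_apply, add_comm x x', add_comm z z']
  have := chi_mul_self z x'
  split_ifs
  · simp only [smul_eq_mul, omega]
    linear_combination (-phase z x * phase z' x' * chi z' x * chi (z' + z) u) * this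
  · simp

@[simp] theorem pauli_zero {n : ℕ} : pauli (0 : Q n) 0 = 1 := by
  ext u y
  simp [pauli_apply, Matrix.one_apply]

theorem pauli_mul_self {n : ℕ} (z x : Q n) : pauli z x * pauli z x = 1 := by
  rw [pauli_mul, label_add_self, label_add_self, pauli_zero, phase_mul_self, chi_mul_self]
  simp

theorem pauli_conjTranspose {n : ℕ} (z x : Q n) : (pauli z x)ᴴ = pauli z x := by
  ext u y
  rw [Matrix.conjTranspose_apply, pauli_apply, pauli_apply]
  by_cases h : u = y + x
  · rw [if_pos h, if_pos ((label_eq_add_iff u y x).1 h), star_mul', star_phase, star_chi]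
    rw [(label_eq_add_iff u y x).1 h, chi_add_right]
    have := chi_mul_self z x
    linear_combination (phase z x * chi z u) * this
  · rw [if_neg h, if_neg fun h' => h ((label_eq_add_iff u y x).2 h'), star_zero]

/-- Completeness of the Pauli basis: the entry `(i, j)` is nonzero only for `x = i + j`, and the
remaining sum over `z` is a character sum that detects `i = k`. -/
theorem sum_pauli_mul_star {n : ℕ} (i j k l : Q n) :
    ∑ z : Q n, ∑ x : Q n, pauli z x i j * star (pauli z x k l) =
      if i = k ∧ j = l then (2 : ℂ) ^ n else 0 := by
  have h : ∀ z : Q n, ∑ x : Q n, pauli z x i j * star (pauli z x k l) =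
      if i + j = k + l then chi z (i + k) else 0 := by
    intro z
    rw [Finset.sum_eq_single (i + j)]
    · rw [pauli_apply, pauli_apply, if_pos (by rw [add_comm i, ← add_assoc, label_add_self, zero_add])]
      have : k = l + (i + j) ↔ i + j = k + l := by
        rw [add_comm l, eq_comm, label_eq_add_iff (i + j) k l, eq_comm]
      simp only [this]
      split_ifs with hh
      · rw [star_mul', star_chi, chi_add_right]
        linear_combination (chi z i * chi z k) * phase_mul_star z (i + j)
      · simp
    · intro x _ hx
      rw [pauli_apply, if_neg, zero_mul]
      intro h
      apply hx
      rw [h, add_comm j, label_add_add_cancel]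
    · simp
  simp only [h]
  by_cases hik : i = k
  · subst hik
    simp only [add_right_inj, label_add_self, chi_zero_right, true_and]
    split_ifs <;> simp [ZMod.card]
  · rw [if_neg fun h => hik h.1]
    split_ifs
    · rw [sum_chi, if_neg]
      intro h
      apply hik
      rw [← add_zero i, ← label_add_self k, ← add_assoc, h, zero_add]
    · simp

/-! ### The Pauli group. -/

theorem exists_I_pow {c : ℂ} (hc : c ^ 4 = 1) : ∃ k : ℕ, c = Complex.I ^ k := by
  have h : (c - 1) * ((c + 1) * ((c - Complex.I) * (c + Complex.I))) = 0 := by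
    have : (c - 1) * ((c + 1) * ((c - Complex.I) * (c + Complex.I))) =
      (c ^ 2 - 1) * (c ^ 2 - Complex.I ^ 2) := by ring
    rw [this, Complex.I_sq]; linear_combination hc
  rcases mul_eq_zero.1 h with h | h
  · exact ⟨0, by linear_combination h⟩
  rcases mul_eq_zero.1 h with h | h
  · exact ⟨2, by rw [Complex.I_sq]; linear_combination h⟩
  rcases mul_eq_zero.1 h with h | h
  · exact ⟨1, by linear_combination h⟩
  · exact ⟨3, by rw [Complex.I_pow_three]; linear_combination h⟩

/-- A scalar with `c ^ 4 = 1` is easier to multiply, conjugate and invert than an explicit power of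
`i`. -/
theorem mem_pauliGroup_iff {n : ℕ} {M : Op n} :
    M ∈ pauliGroup n ↔ ∃ (c : ℂ) (z x : Q n), c ^ 4 = 1 ∧ M = c • pauli z x := by
  constructor
  · rintro ⟨k, z, x, rfl⟩
    exact ⟨_, z, x, by rw [← pow_mul, mul_comm, pow_mul, Complex.I_pow_four, one_pow], rfl⟩
  · rintro ⟨c, z, x, hc, rfl⟩
    obtain ⟨k, rfl⟩ := exists_I_pow hc
    exact ⟨k, z, x, rfl⟩

theorem pauli_mem {n : ℕ} (z x : Q n) : pauli z x ∈ pauliGroup n :=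
  mem_pauliGroup_iff.2 ⟨1, z, x, by simp, by simp⟩

theorem smul_mem_pauliGroup {n : ℕ} {c : ℂ} (hc : c ^ 4 = 1) {M : Op n} (hM : M ∈ pauliGroup n) :
    c • M ∈ pauliGroup n := by
  obtain ⟨d, z, x, hd, rfl⟩ := mem_pauliGroup_iff.1 hM
  exact mem_pauliGroup_iff.2 ⟨c * d, z, x, by rw [mul_pow, hc, hd, one_mul], smul_smul _ _ _⟩

theorem mul_mem_pauliGroup {n : ℕ} {M N : Op n} (hM : M ∈ pauliGroup n) (hN : N ∈ pauliGroup n) :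
    M * N ∈ pauliGroup n := by
  obtain ⟨c, z, x, hc, rfl⟩ := mem_pauliGroup_iff.1 hM
  obtain ⟨d, z', x', hd, rfl⟩ := mem_pauliGroup_iff.1 hN
  rw [smul_mul_smul_comm, pauli_mul]
  apply smul_mem_pauliGroup (by rw [mul_pow, hc, hd, one_mul])
  apply smul_mem_pauliGroup _ (pauli_mem _ _)
  have h : chi z' x ^ 4 = 1 := by rcases chi_eq_or z' x with h | h <;> rw [h] <;> norm_num
  simp only [mul_pow, inv_pow, phase_pow_four, h, inv_one, mul_one]

theorem star_pow_four {c : ℂ} (hc : c ^ 4 = 1) : (star c) ^ 4 = 1 := by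
  rw [← star_pow, hc, star_one]

theorem mul_star_of_pow_four {c : ℂ} (hc : c ^ 4 = 1) : c * star c = 1 := by
  obtain ⟨k, rfl⟩ := exists_I_pow hc
  rw [star_pow, ← mul_pow]; simp

theorem conjTranspose_mem_pauliGroup {n : ℕ} {M : Op n} (hM : M ∈ pauliGroup n) :
    Mᴴ ∈ pauliGroup n := by
  obtain ⟨c, z, x, hc, rfl⟩ := mem_pauliGroup_iff.1 hM
  rw [conjTranspose_smul, pauli_conjTranspose]
  exact smul_mem_pauliGroup (star_pow_four hc) (pauli_mem _ _)

theorem mul_conjTranspose_of_mem_pauliGroup {n : ℕ} {M : Op n} (hM : M ∈ pauliGroup n) :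
    M * Mᴴ = 1 := by
  obtain ⟨c, z, x, hc, rfl⟩ := mem_pauliGroup_iff.1 hM
  rw [conjTranspose_smul, pauli_conjTranspose, smul_mul_smul_comm, pauli_mul_self,
    mul_star_of_pow_four hc, one_smul]

/-- A Hermitian element of the Pauli group is `± w(z, x)`. -/
theorem eq_or_neg_of_hermitian {n : ℕ} {M : Op n} (hM : M ∈ pauliGroup n) (h : Mᴴ = M) :
    ∃ z x : Q n, M = pauli z x ∨ M = -pauli z x := by
  obtain ⟨c, z, x, hc, rfl⟩ := mem_pauliGroup_iff.1 hM
  refine ⟨z, x, ?_⟩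
  have h1 := mul_conjTranspose_of_mem_pauliGroup hM
  rw [h, smul_mul_smul_comm, pauli_mul_self] at h1
  have h2 := congrFun (congrFun h1 0) 0
  simp only [Matrix.smul_apply, Matrix.one_apply_eq, smul_eq_mul, mul_one] at h2
  rcases mul_self_eq_one_iff.1 h2 with rfl | rfl <;> simp

/-! ### Bipartite labels, Kronecker products and relabelling of qubits. -/

@[simp] theorem fstPart_append {n k : ℕ} (a : Q n) (b : Q k) :
    fstPart (Fin.append a b : Q (n + k)) = a := by
  ext i; simp [fstPart]

@[simp] theorem sndPart_append {n k : ℕ} (a : Q n) (b : Q k) :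
    sndPart (Fin.append a b : Q (n + k)) = b := by
  ext i; simp [sndPart]

@[simp] theorem append_fstPart_sndPart {n k : ℕ} (x : Q (n + k)) :
    (Fin.append (fstPart x) (sndPart x) : Q (n + k)) = x :=
  (Fin.appendEquiv n k).apply_symm_apply x

theorem exists_append {n k : ℕ} (x : Q (n + k)) :
    ∃ (a : Q n) (b : Q k), x = Fin.append a b := ⟨_, _, (append_fstPart_sndPart x).symm⟩

theorem append_inj {n k : ℕ} {a a' : Q n} {b b' : Q k} :
    (Fin.append a b : Q (n + k)) = Fin.append a' b' ↔ a = a' ∧ b = b' := by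
  constructor
  · intro h
    exact ⟨by rw [← fstPart_append a b, h, fstPart_append], by
      rw [← sndPart_append a b, h, sndPart_append]⟩
  · rintro ⟨rfl, rfl⟩; rfl

theorem sum_append {n k : ℕ} {α : Type*} [AddCommMonoid α] (f : Q (n + k) → α) :
    ∑ x, f x = ∑ a : Q n, ∑ b : Q k, f (Fin.append a b) := by
  rw [← Fintype.sum_prod_type' (f := fun (a : Q n) (b : Q k) => f (Fin.append a b))]
  exact ((Fin.appendEquiv n k).sum_comp f).symm

theorem append_add {n k : ℕ} (a a' : Q n) (b b' : Q k) :
    (Fin.append a b + Fin.append a' b' : Q (n + k)) = Fin.append (a + a') (b + b') := by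
  ext i
  refine Fin.addCases (fun i => ?_) (fun i => ?_) i <;> simp

/-- The Kronecker product in the computational basis of `n + k` qubits. -/
def kron {n k : ℕ} (A : Op n) (B : Op k) : Op (n + k) :=
  Matrix.of fun x y => A (fstPart x) (fstPart y) * B (sndPart x) (sndPart y)

theorem kron_apply {n k : ℕ} (A : Op n) (B : Op k) (x y : Q (n + k)) :
    kron A B x y = A (fstPart x) (fstPart y) * B (sndPart x) (sndPart y) := rfl

theorem prepare_apply {n k : ℕ} (σ : Op k) (ρ : Op n) : prepare σ ρ = kron ρ σ := rfl

theorem kron_mul {n k : ℕ} (A A' : Op n) (B B' : Op k) :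
    kron A B * kron A' B' = kron (A * A') (B * B') := by
  ext x y
  simp only [Matrix.mul_apply, sum_append, kron_apply, fstPart_append, sndPart_append,
    Finset.sum_mul_sum]
  exact Finset.sum_congr rfl fun _ _ => Finset.sum_congr rfl fun _ _ => by ring

theorem kron_conjTranspose {n k : ℕ} (A : Op n) (B : Op k) : (kron A B)ᴴ = kron Aᴴ Bᴴ := by
  ext x y; simp [kron_apply, Matrix.conjTranspose_apply]

theorem eq_iff_parts {n k : ℕ} (x y : Q (n + k)) :
    x = y ↔ fstPart x = fstPart y ∧ sndPart x = sndPart y := by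
  rw [← append_inj, append_fstPart_sndPart, append_fstPart_sndPart]

@[simp] theorem kron_one_one {n k : ℕ} : kron (1 : Op n) (1 : Op k) = 1 := by
  ext x y
  have e := eq_iff_parts x y
  simp only [kron_apply, Matrix.one_apply, e]
  by_cases h : fstPart x = fstPart y <;> by_cases h' : sndPart x = sndPart y <;> simp [h, h']

theorem kron_smul_left {n k : ℕ} (c : ℂ) (A : Op n) (B : Op k) : kron (c • A) B = c • kron A B := by
  ext x y; simp [kron_apply, mul_assoc]

theorem kron_smul_right {n k : ℕ} (c : ℂ) (A : Op n) (B : Op k) :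
    kron A (c • B) = c • kron A B := by
  ext x y; simp [kron_apply]; ring

theorem kron_add_left {n k : ℕ} (A A' : Op n) (B : Op k) :
    kron (A + A') B = kron A B + kron A' B := by
  ext x y; simp [kron_apply, add_mul]

theorem chi_append {n k : ℕ} (z y : Q n) (z' y' : Q k) :
    chi (Fin.append z z' : Q (n + k)) (Fin.append y y') = chi z y * chi z' y' := by
  simp only [chi, ← pow_add, Fin.sum_univ_add, Fin.append_left, Fin.append_right]

theorem phase_append {n k : ℕ} (z y : Q n) (z' y' : Q k) :
    phase (Fin.append z z' : Q (n + k)) (Fin.append y y') = phase z y * phase z' y' := by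
  simp only [phase, ← mul_inv, ← pow_add, Fin.sum_univ_add, Fin.append_left, Fin.append_right]

theorem pauli_append {n k : ℕ} (z x : Q n) (z' x' : Q k) :
    pauli (Fin.append z z' : Q (n + k)) (Fin.append x x') = kron (pauli z x) (pauli z' x') := by
  ext u y
  obtain ⟨u, u', rfl⟩ := exists_append u
  obtain ⟨y, y', rfl⟩ := exists_append y
  simp only [kron_apply, pauli_apply, fstPart_append, sndPart_append, append_add, append_inj,
    chi_append, phase_append]
  by_cases h : u = y + x <;> by_cases h' : u' = y' + x' <;> simp [h, h']
  ring

theorem pauli_eq_kron {n k : ℕ} (z x : Q (n + k)) :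
    pauli z x = kron (pauli (fstPart z) (fstPart x)) (pauli (sndPart z) (sndPart x)) := by
  rw [← pauli_append, append_fstPart_sndPart, append_fstPart_sndPart]

theorem kron_mem_pauliGroup {n k : ℕ} {A : Op n} {B : Op k} (hA : A ∈ pauliGroup n)
    (hB : B ∈ pauliGroup k) : kron A B ∈ pauliGroup (n + k) := by
  obtain ⟨c, z, x, hc, rfl⟩ := mem_pauliGroup_iff.1 hA
  obtain ⟨d, z', x', hd, rfl⟩ := mem_pauliGroup_iff.1 hB
  rw [kron_smul_left, kron_smul_right, ← pauli_append]
  exact smul_mem_pauliGroup hc (smul_mem_pauliGroup hd (pauli_mem _ _))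

theorem one_mem_pauliGroup {n : ℕ} : (1 : Op n) ∈ pauliGroup n := by
  rw [← pauli_zero]; exact pauli_mem _ _

/-- Relabelling of the qubits. -/
def rx {n m : ℕ} (e : Fin n ≃ Fin m) : Superop n m where
  toFun ρ := Matrix.of fun x y => ρ (x ∘ e) (y ∘ e)
  map_add' ρ σ := by ext x y; rfl
  map_smul' c ρ := by ext x y; rfl

theorem rx_apply {n m : ℕ} (e : Fin n ≃ Fin m) (ρ : Op n) (x y : Q m) :
    rx e ρ x y = ρ (x ∘ e) (y ∘ e) := rfl

theorem rx_refl {n : ℕ} : rx (Equiv.refl (Fin n)) = LinearMap.id := rfl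

theorem rx_symm_apply {n m : ℕ} (e : Fin n ≃ Fin m) (ρ : Op m) : rx e (rx e.symm ρ) = ρ := by
  ext x y
  rw [rx_apply, rx_apply]; congr 1 <;> ext i <;> simp

/-- The bijection of labels induced by a relabelling of the qubits. -/
def labelEquiv {n m : ℕ} (e : Fin n ≃ Fin m) : Q m ≃ Q n := e.symm.arrowCongr (Equiv.refl _)

theorem rx_mul {n m : ℕ} (e : Fin n ≃ Fin m) (A B : Op n) : rx e (A * B) = rx e A * rx e B := by
  ext x y
  simp only [rx_apply, Matrix.mul_apply]
  exact ((labelEquiv e).sum_comp fun v => A (x ∘ e) v * B v (y ∘ e)).symm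

theorem rx_one {n m : ℕ} (e : Fin n ≃ Fin m) : rx e 1 = 1 := by
  ext x y
  simp only [rx_apply, Matrix.one_apply]
  exact if_congr ((labelEquiv e).injective.eq_iff) rfl rfl

theorem rx_conjTranspose {n m : ℕ} (e : Fin n ≃ Fin m) (A : Op n) : (rx e A)ᴴ = rx e Aᴴ := rfl

theorem chi_comp {n m : ℕ} (e : Fin n ≃ Fin m) (z x : Q m) : chi (z ∘ e) (x ∘ e) = chi z x := by
  simp only [chi, Function.comp_apply]
  rw [e.sum_comp fun i => (z i).val * (x i).val]

theorem phase_comp {n m : ℕ} (e : Fin n ≃ Fin m) (z x : Q m) :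
    phase (z ∘ e) (x ∘ e) = phase z x := by
  simp only [phase, Function.comp_apply]
  rw [e.sum_comp fun i => (z i).val * (x i).val]

theorem rx_pauli {n m : ℕ} (e : Fin n ≃ Fin m) (z x : Q m) :
    rx e (pauli (z ∘ e) (x ∘ e)) = pauli z x := by
  ext u y
  rw [rx_apply, pauli_apply, pauli_apply, chi_comp, phase_comp]
  refine if_congr ?_ rfl rfl
  exact (labelEquiv e).injective.eq_iff (a := u) (b := y + x)

theorem rx_mem_pauliGroup {n m : ℕ} (e : Fin n ≃ Fin m) {A : Op n} (hA : A ∈ pauliGroup n) :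
    rx e A ∈ pauliGroup m := by
  obtain ⟨c, z, x, hc, rfl⟩ := mem_pauliGroup_iff.1 hA
  rw [map_smul]
  refine smul_mem_pauliGroup hc ?_
  have h := rx_pauli e (z ∘ e.symm) (x ∘ e.symm)
  rw [Function.comp_assoc, Function.comp_assoc] at h
  simp only [Equiv.symm_comp_self, Function.comp_id] at h
  rw [h]; exact pauli_mem _ _

/-- The two bracketings of the sum give different types. The bijection is known only through its
effect on `Fin.append`, which is all that is needed to compare superoperators entry by entry. -/
theorem exists_assoc_equiv (a k l : ℕ) : ∃ e : Fin (a + (k + l)) ≃ Fin (a + k + l),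
    ∀ (x : Q a) (u : Q k) (v : Q l),
      (Fin.append (Fin.append x u) v : Q (a + k + l)) ∘ e = Fin.append x (Fin.append u v) := by
  refine ⟨finCongr (by omega), fun x u v => ?_⟩
  rw [Fin.append_assoc]; rfl

theorem exists_swap_equiv (b j l : ℕ) : ∃ e : Fin (b + j + l) ≃ Fin (b + l + j),
    ∀ (x : Q b) (u : Q l) (v : Q j),
      (Fin.append (Fin.append x u) v : Q (b + l + j)) ∘ e = Fin.append (Fin.append x v) u := by
  refine ⟨(((finSumFinEquiv.symm.trans (finSumFinEquiv.symm.sumCongr (Equiv.refl _))).trans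
    ((Equiv.sumAssoc _ _ _).trans (((Equiv.refl _).sumCongr (Equiv.sumComm _ _)).trans (Equiv.sumAssoc _ _ _).symm))).trans (finSumFinEquiv.sumCongr (Equiv.refl _))).trans
      finSumFinEquiv, fun x u v => ?_⟩
  ext i
  refine Fin.addCases (fun i => ?_) (fun i => ?_) i
  · refine Fin.addCases (fun i => ?_) (fun i => ?_) i <;> simp
  · simp

/-! ### Commutation rules between conjugation, preparation, discarding and relabelling. -/

theorem conj_apply {n : ℕ} (A ρ : Op n) : conj A ρ = A * ρ * Aᴴ := rfl

theorem conj_one {n : ℕ} : conj (1 : Op n) = LinearMap.id := by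
  ext1 ρ; simp [conj_apply]

theorem conj_comp_conj {n : ℕ} (A B : Op n) : conj A ∘ₗ conj B = conj (A * B) := by
  refine LinearMap.ext fun ρ => ?_
  simp only [LinearMap.comp_apply, conj_apply, Matrix.conjTranspose_mul, Matrix.mul_assoc]

theorem conj_smul {n : ℕ} (c : ℂ) (A : Op n) : conj (c • A) = (c * star c) • conj A := by
  refine LinearMap.ext fun ρ => ?_
  simp only [LinearMap.smul_apply, conj_apply, Matrix.conjTranspose_smul, smul_mul_assoc,
    mul_smul_comm, smul_smul, mul_comm]

theorem discard_apply {n k : ℕ} (ρ : Op (n + k)) (x y : Q n) :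
    (discard ρ : Op n) x y = ∑ u : Q k, ρ (Fin.append x u) (Fin.append y u) := rfl

theorem kron_one_mul_apply {n k : ℕ} (V : Op n) (M : Op (n + k)) (x : Q n) (u : Q k)
    (c : Q (n + k)) :
    (kron V (1 : Op k) * M) (Fin.append x u) c = ∑ a : Q n, V x a * M (Fin.append a u) c := by
  simp only [Matrix.mul_apply, sum_append, kron_apply, fstPart_append, sndPart_append,
    Matrix.one_apply]
  simp

theorem mul_kron_one_apply {n k : ℕ} (V : Op n) (M : Op (n + k)) (x : Q n) (u : Q k)
    (c : Q (n + k)) :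
    (M * kron V (1 : Op k)) c (Fin.append x u) = ∑ a : Q n, M c (Fin.append a u) * V a x := by
  simp only [Matrix.mul_apply, sum_append, kron_apply, fstPart_append, sndPart_append,
    Matrix.one_apply]
  simp

theorem kron_one_conj_apply {n k : ℕ} (V : Op n) (M : Op (n + k)) (x y : Q n) (u v : Q k) :
    conj (kron V 1) M (Fin.append x u) (Fin.append y v) =
      conj V (Matrix.of fun a b => M (Fin.append a u) (Fin.append b v)) x y := by
  rw [conj_apply, conj_apply, kron_conjTranspose, Matrix.conjTranspose_one, mul_kron_one_apply,
    Matrix.mul_apply]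
  refine Finset.sum_congr rfl fun a _ => ?_
  rw [kron_one_mul_apply, Matrix.mul_apply]
  rfl

theorem conj_comp_discard {n k : ℕ} (V : Op n) :
    conj V ∘ₗ (discard : Superop (n + k) n) = discard ∘ₗ conj (kron V 1) := by
  refine LinearMap.ext fun ρ => ?_
  ext x y
  rw [LinearMap.comp_apply, LinearMap.comp_apply, discard_apply]
  simp only [kron_one_conj_apply]
  have : (discard ρ : Op n) =
      ∑ u : Q k, Matrix.of fun a b => ρ (Fin.append a u) (Fin.append b u) := by
    ext a b; simp [Matrix.sum_apply, discard_apply]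
  rw [this, map_sum, Matrix.sum_apply]

theorem conj_comp_rx {n m : ℕ} (e : Fin n ≃ Fin m) (V : Op m) :
    conj V ∘ₗ rx e = rx e ∘ₗ conj (rx e.symm V) := by
  refine LinearMap.ext fun ρ => ?_
  simp only [LinearMap.comp_apply, conj_apply, rx_mul, rx_conjTranspose, rx_symm_apply]

theorem prepare_comp_conj {n k : ℕ} (σ : Op k) (U : Op n) :
    prepare σ ∘ₗ conj U = conj (kron U 1) ∘ₗ prepare σ := by
  refine LinearMap.ext fun ρ => ?_
  simp only [LinearMap.comp_apply, conj_apply, prepare_apply, kron_mul, kron_conjTranspose,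
    Matrix.conjTranspose_one, Matrix.one_mul, Matrix.mul_one]

theorem prepare_comp_rx {n m : ℕ} (e : Fin n ≃ Fin m) {l : ℕ} (τ : Op l) :
    ∃ f : Fin (n + l) ≃ Fin (m + l), prepare τ ∘ₗ rx e = rx f ∘ₗ prepare τ := by
  refine ⟨(finSumFinEquiv.symm.trans (e.sumCongr (Equiv.refl _))).trans finSumFinEquiv, ?_⟩
  refine LinearMap.ext fun ρ => ?_
  ext x y
  rw [LinearMap.comp_apply, LinearMap.comp_apply, prepare_apply, prepare_apply, rx_apply,
    kron_apply, kron_apply, rx_apply]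
  congr 2
  · ext i; simp [fstPart]
  · ext i; simp [fstPart]
  · ext i; simp [sndPart]
  · ext i; simp [sndPart]

theorem prepare_comp_discard (b j l : ℕ) (τ : Op l) :
    ∃ f : Fin (b + j + l) ≃ Fin (b + l + j),
      prepare τ ∘ₗ (discard : Superop (b + j) b) = discard ∘ₗ rx f ∘ₗ prepare τ := by
  obtain ⟨f, hf⟩ := exists_swap_equiv b j l
  refine ⟨f, LinearMap.ext fun ρ => ?_⟩
  ext x y
  obtain ⟨x, u, rfl⟩ := exists_append x
  obtain ⟨y, v, rfl⟩ := exists_append y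
  simp only [LinearMap.comp_apply, prepare_apply, rx_apply, kron_apply, discard_apply, hf,
    fstPart_append, sndPart_append, Finset.sum_mul]

theorem prepare_comp_prepare (a : ℕ) {k l : ℕ} (σ : Op k) (τ : Op l) :
    ∃ f : Fin (a + (k + l)) ≃ Fin (a + k + l),
      prepare τ ∘ₗ (prepare σ : Superop a (a + k)) = rx f ∘ₗ prepare (kron σ τ) := by
  obtain ⟨f, hf⟩ := exists_assoc_equiv a k l
  refine ⟨f, LinearMap.ext fun ρ => ?_⟩
  ext x y
  obtain ⟨x, u, rfl⟩ := exists_append x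
  obtain ⟨y, v, rfl⟩ := exists_append y
  obtain ⟨x, x', rfl⟩ := exists_append x
  obtain ⟨y, y', rfl⟩ := exists_append y
  simp only [LinearMap.comp_apply, prepare_apply, rx_apply, kron_apply, hf,
    fstPart_append, sndPart_append, mul_assoc]

theorem discard_comp_discard (b k j : ℕ) :
    ∃ f : Fin (b + k + j) ≃ Fin (b + (k + j)),
      (discard : Superop (b + k) b) ∘ₗ (discard : Superop (b + k + j) (b + k)) =
        discard ∘ₗ rx f := by
  obtain ⟨f, hf⟩ := exists_assoc_equiv b k j
  refine ⟨f.symm, LinearMap.ext fun ρ => ?_⟩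
  ext x y
  have hf' : ∀ (x : Q b) (u : Q k) (v : Q j),
      (Fin.append x (Fin.append u v) : Q (b + (k + j))) ∘ f.symm =
        Fin.append (Fin.append x u) v := by
    intro x u v
    rw [← hf, Function.comp_assoc, Equiv.self_comp_symm, Function.comp_id]
  simp only [LinearMap.comp_apply, discard_apply, rx_apply, sum_append, hf']

/-! ### Elementary steps in the presence of a reference system, and their traces. -/

theorem tensorId_append {n m : ℕ} (k : ℕ) (E : Superop n m) (ρ : Op (n + k)) (x y : Q m)
    (u v : Q k) : tensorId k E ρ (Fin.append x u) (Fin.append y v) =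
      E (Matrix.of fun a b => ρ (Fin.append a u) (Fin.append b v)) x y := by
  simp [tensorId]

theorem tensorId_comp {n m l : ℕ} (k : ℕ) (E : Superop n m) (F : Superop m l) (ρ : Op (n + k)) :
    tensorId k (F ∘ₗ E) ρ = tensorId k F (tensorId k E ρ) := by
  ext x y
  obtain ⟨x, u, rfl⟩ := exists_append x
  obtain ⟨y, v, rfl⟩ := exists_append y
  simp only [tensorId_append, LinearMap.comp_apply]
  rfl

theorem tensorId_add {n m : ℕ} (k : ℕ) (E F : Superop n m) (ρ : Op (n + k)) :
    tensorId k (E + F) ρ = tensorId k E ρ + tensorId k F ρ := rfl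

theorem tensorId_smul {n m : ℕ} (k : ℕ) (c : ℝ) (E : Superop n m) (ρ : Op (n + k)) :
    tensorId k (c • E) ρ = c • tensorId k E ρ := rfl

theorem tensorId_id {n : ℕ} (k : ℕ) (ρ : Op (n + k)) :
    tensorId k (LinearMap.id : Superop n n) ρ = ρ := by
  ext x y
  obtain ⟨x, u, rfl⟩ := exists_append x
  obtain ⟨y, v, rfl⟩ := exists_append y
  rw [tensorId_append]; rfl

theorem tensorId_conj {n : ℕ} (k : ℕ) (A : Op n) (ρ : Op (n + k)) :
    tensorId k (conj A) ρ = conj (kron A 1) ρ := by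
  ext x y
  obtain ⟨x, u, rfl⟩ := exists_append x
  obtain ⟨y, v, rfl⟩ := exists_append y
  rw [tensorId_append, kron_one_conj_apply]

theorem tensorId_prepare (n k j : ℕ) (τ : Op j) : ∃ f : Fin (n + k + j) ≃ Fin (n + j + k),
    ∀ ρ : Op (n + k), tensorId k (prepare τ : Superop n (n + j)) ρ = rx f (kron ρ τ) := by
  obtain ⟨f, hf⟩ := exists_swap_equiv n k j
  refine ⟨f, fun ρ => ?_⟩
  ext x y
  obtain ⟨x, u, rfl⟩ := exists_append x
  obtain ⟨y, v, rfl⟩ := exists_append y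
  obtain ⟨x, x', rfl⟩ := exists_append x
  obtain ⟨y, y', rfl⟩ := exists_append y
  rw [tensorId_append, rx_apply, hf, hf]
  simp [prepare_apply, kron_apply]

theorem tensorId_discard (n k j : ℕ) : ∃ f : Fin (n + j + k) ≃ Fin (n + k + j),
    ∀ ρ : Op (n + j + k), tensorId k (discard : Superop (n + j) n) ρ = discard (rx f ρ) := by
  obtain ⟨f, hf⟩ := exists_swap_equiv n j k
  refine ⟨f, fun ρ => ?_⟩
  ext x y
  obtain ⟨x, u, rfl⟩ := exists_append x
  obtain ⟨y, v, rfl⟩ := exists_append y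
  rw [tensorId_append, discard_apply, discard_apply]
  simp only [rx_apply, hf, Matrix.of_apply]

theorem trace_discard {n k : ℕ} (ρ : Op (n + k)) : (discard ρ : Op n).trace = ρ.trace := by
  simp only [Matrix.trace, Matrix.diag, discard_apply, sum_append]

theorem trace_kron {n k : ℕ} (ρ : Op n) (σ : Op k) : (kron ρ σ).trace = ρ.trace * σ.trace := by
  simp only [Matrix.trace, Matrix.diag, kron_apply, sum_append, fstPart_append, sndPart_append,
    Finset.sum_mul_sum]

theorem trace_rx {n m : ℕ} (e : Fin n ≃ Fin m) (ρ : Op n) : (rx e ρ).trace = ρ.trace :=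
  (labelEquiv e).sum_comp fun v => ρ v v

theorem trace_conj {n : ℕ} (A ρ : Op n) : (conj A ρ).trace = (Aᴴ * A * ρ).trace := by
  rw [conj_apply, Matrix.trace_mul_comm, Matrix.mul_assoc]

/-! ### Clifford unitaries. -/

/-- The equality of sets amounts to stability of the Pauli group under conjugation by `U` and by
`U†`; the second half is the Heisenberg picture used for expectations. -/
theorem isClifford_iff {n : ℕ} {U : Op n} : IsClifford U ↔ Uᴴ * U = 1 ∧
    (∀ M ∈ pauliGroup n, U * M * Uᴴ ∈ pauliGroup n) ∧
    ∀ M ∈ pauliGroup n, Uᴴ * M * U ∈ pauliGroup n := by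
  have assoc : ∀ M : Op n, Uᴴ * U = 1 → Uᴴ * (U * M * Uᴴ) * U = M := fun M h => by
    rw [show Uᴴ * (U * M * Uᴴ) * U = (Uᴴ * U) * M * (Uᴴ * U) by simp only [Matrix.mul_assoc], h,
      Matrix.one_mul, Matrix.mul_one]
  have assoc' : ∀ M : Op n, U * Uᴴ = 1 → U * (Uᴴ * M * U) * Uᴴ = M := fun M h => by
    rw [show U * (Uᴴ * M * U) * Uᴴ = (U * Uᴴ) * M * (U * Uᴴ) by simp only [Matrix.mul_assoc], h,
      Matrix.one_mul, Matrix.mul_one]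
  constructor
  · rintro ⟨h1, h2⟩
    have h : Uᴴ * U = 1 := Matrix.mem_unitaryGroup_iff'.1 h1
    refine ⟨h, fun M hM => h2 ▸ ⟨M, hM, rfl⟩, fun M hM => ?_⟩
    rw [← h2] at hM
    obtain ⟨N, hN, rfl⟩ := hM
    rwa [assoc N h]
  · rintro ⟨h, h1, h2⟩
    refine ⟨Matrix.mem_unitaryGroup_iff'.2 h, Set.Subset.antisymm ?_ fun M hM => ?_⟩
    · rintro _ ⟨M, hM, rfl⟩; exact h1 M hM
    · exact ⟨_, h2 M hM, assoc' M (mul_eq_one_comm.1 h)⟩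

theorem isClifford_one {n : ℕ} : IsClifford (1 : Op n) :=
  isClifford_iff.2 (by simp)

theorem IsClifford.mul {n : ℕ} {U V : Op n} (hU : IsClifford U) (hV : IsClifford V) :
    IsClifford (U * V) := by
  obtain ⟨h1, h2, h3⟩ := isClifford_iff.1 hU
  obtain ⟨h1', h2', h3'⟩ := isClifford_iff.1 hV
  rw [isClifford_iff, Matrix.conjTranspose_mul]
  refine ⟨?_, fun M hM => ?_, fun M hM => ?_⟩
  · rw [Matrix.mul_assoc, ← Matrix.mul_assoc Uᴴ, h1, Matrix.one_mul, h1']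
  · simpa only [Matrix.mul_assoc] using h2 _ (h2' M hM)
  · simpa only [Matrix.mul_assoc] using h3' _ (h3 M hM)

theorem IsClifford.rx {n m : ℕ} (e : Fin n ≃ Fin m) {U : Op n} (hU : IsClifford U) :
    IsClifford (rx e U) := by
  obtain ⟨h1, h2, h3⟩ := isClifford_iff.1 hU
  refine isClifford_iff.2 ⟨?_, fun M hM => ?_, fun M hM => ?_⟩
  · rw [rx_conjTranspose, ← rx_mul, h1, rx_one]
  · rw [← rx_symm_apply e M, rx_conjTranspose, ← rx_mul, ← rx_mul]
    exact rx_mem_pauliGroup e (h2 _ (rx_mem_pauliGroup e.symm hM))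
  · rw [← rx_symm_apply e M, rx_conjTranspose, ← rx_mul, ← rx_mul]
    exact rx_mem_pauliGroup e (h3 _ (rx_mem_pauliGroup e.symm hM))

theorem IsClifford.kron_one {n : ℕ} (k : ℕ) {U : Op n} (hU : IsClifford U) :
    IsClifford (kron U (1 : Op k)) := by
  obtain ⟨h1, h2, h3⟩ := isClifford_iff.1 hU
  have aux : ∀ V : Op n, (∀ M ∈ pauliGroup n, V * M * Vᴴ ∈ pauliGroup n) →
      ∀ M ∈ pauliGroup (n + k), kron V 1 * M * (kron V 1)ᴴ ∈ pauliGroup (n + k) := by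
    intro V hV M hM
    obtain ⟨c, z, x, hc, rfl⟩ := mem_pauliGroup_iff.1 hM
    rw [mul_smul_comm, smul_mul_assoc, pauli_eq_kron, kron_conjTranspose, kron_mul, kron_mul,
      Matrix.one_mul, Matrix.conjTranspose_one, Matrix.mul_one]
    exact smul_mem_pauliGroup hc (kron_mem_pauliGroup (hV _ (pauli_mem _ _)) (pauli_mem _ _))
  refine isClifford_iff.2 ⟨?_, aux U h2, ?_⟩
  · rw [kron_conjTranspose, kron_mul, h1, Matrix.conjTranspose_one, Matrix.mul_one, kron_one_one]
  · have := aux Uᴴ (by rwa [Matrix.conjTranspose_conjTranspose])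
    rwa [kron_conjTranspose, Matrix.conjTranspose_conjTranspose, Matrix.conjTranspose_one] at *

/-! ### Pauli expectations and the counting characterisation of stabiliser vectors. -/

/-- The expectation `⟨ψ|M|ψ⟩`. -/
def expect {n : ℕ} (ψ : Q n → ℂ) (M : Op n) : ℂ := star ψ ⬝ᵥ (M *ᵥ ψ)

theorem star_mulVec_dotProduct {n : ℕ} (A : Op n) (ψ φ : Q n → ℂ) :
    star (A *ᵥ ψ) ⬝ᵥ φ = star ψ ⬝ᵥ (Aᴴ *ᵥ φ) := by
  rw [Matrix.star_mulVec, Matrix.dotProduct_mulVec]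

theorem expect_mulVec {n : ℕ} (A : Op n) (ψ : Q n → ℂ) (M : Op n) :
    expect (A *ᵥ ψ) M = expect ψ (Aᴴ * M * A) := by
  rw [expect, star_mulVec_dotProduct, expect, Matrix.mulVec_mulVec, Matrix.mulVec_mulVec,
    Matrix.mul_assoc]

theorem expect_one {n : ℕ} (ψ : Q n → ℂ) : expect ψ 1 = star ψ ⬝ᵥ ψ := by
  rw [expect, Matrix.one_mulVec]

theorem expect_add {n : ℕ} (ψ : Q n → ℂ) (A B : Op n) :
    expect ψ (A + B) = expect ψ A + expect ψ B := by
  rw [expect, Matrix.add_mulVec, dotProduct_add]; rfl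

theorem expect_smul {n : ℕ} (ψ : Q n → ℂ) (c : ℂ) (A : Op n) :
    expect ψ (c • A) = c * expect ψ A := by
  rw [expect, Matrix.smul_mulVec, dotProduct_smul]; rfl

theorem expect_neg {n : ℕ} (ψ : Q n → ℂ) (A : Op n) : expect ψ (-A) = -expect ψ A := by
  rw [expect, Matrix.neg_mulVec, dotProduct_neg]; rfl

theorem expect_zero {n : ℕ} (ψ : Q n → ℂ) : expect ψ 0 = 0 := by simp [expect]

theorem expect_smul_vec {n : ℕ} (ψ : Q n → ℂ) (c : ℂ) (A : Op n) :
    expect (c • ψ) A = star c * c * expect ψ A := by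
  rw [expect, star_smul, Matrix.mulVec_smul, smul_dotProduct, dotProduct_smul, expect, mul_assoc]
  rfl

theorem expect_of_eigen {n : ℕ} {ψ : Q n → ℂ} {A : Op n} {c : ℂ} (h : A *ᵥ ψ = c • ψ) :
    expect ψ A = c * (star ψ ⬝ᵥ ψ) := by
  rw [expect, h, dotProduct_smul, smul_eq_mul]

theorem expect_mul_of_eigen {n : ℕ} {ψ : Q n → ℂ} {A : Op n} {c : ℂ} (h : A *ᵥ ψ = c • ψ)
    (B : Op n) : expect ψ (B * A) = c * expect ψ B := by
  rw [expect, ← Matrix.mulVec_mulVec, h, Matrix.mulVec_smul, dotProduct_smul, smul_eq_mul, expect]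

theorem dotProduct_star_self {n : ℕ} (ψ : Q n → ℂ) :
    star ψ ⬝ᵥ ψ = ((∑ i, Complex.normSq (ψ i) : ℝ) : ℂ) := by
  simp only [dotProduct, Pi.star_apply, Complex.ofReal_sum, Complex.normSq_eq_conj_mul_self]
  rfl

/-- Orthogonality and completeness of the Pauli operators, in terms of expectations. -/
theorem sum_expect_pauli {n : ℕ} (ψ φ : Q n → ℂ) :
    ∑ p : Q n × Q n, expect ψ (pauli p.1 p.2) * star (expect φ (pauli p.1 p.2)) =
      2 ^ n * ((star φ ⬝ᵥ ψ) * star (star φ ⬝ᵥ ψ)) := by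
  have h1 : ∀ (χ : Q n → ℂ) (M : Op n), expect χ M = ∑ p : Q n × Q n,
      star (χ p.1) * χ p.2 * M p.1 p.2 := by
    intro χ M
    simp only [expect, dotProduct, Matrix.mulVec, Fintype.sum_prod_type, Finset.mul_sum,
      Pi.star_apply]
    exact Finset.sum_congr rfl fun _ _ => Finset.sum_congr rfl fun _ _ => by ring
  have h2 : ∀ i k : Q n × Q n, ∑ p : Q n × Q n, pauli p.1 p.2 i.1 i.2 * star (pauli p.1 p.2 k.1 k.2)
      = if i = k then (2 : ℂ) ^ n else 0 := by
    intro i k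
    rw [Fintype.sum_prod_type, sum_pauli_mul_star]
    simp only [Prod.ext_iff]
  calc _ = ∑ p : Q n × Q n, ∑ i : Q n × Q n, ∑ k : Q n × Q n,
        (star (ψ i.1) * ψ i.2 * star (star (φ k.1) * φ k.2)) *
          (pauli p.1 p.2 i.1 i.2 * star (pauli p.1 p.2 k.1 k.2)) := by
        refine Finset.sum_congr rfl fun p _ => ?_
        rw [h1, h1, star_sum, Finset.sum_mul_sum]
        refine Finset.sum_congr rfl fun i _ => Finset.sum_congr rfl fun k _ => ?_
        simp only [star_mul']
        ring
    _ = ∑ i : Q n × Q n, ∑ k : Q n × Q n,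
        (star (ψ i.1) * ψ i.2 * star (star (φ k.1) * φ k.2)) *
          (if i = k then (2 : ℂ) ^ n else 0) := by
        rw [Finset.sum_comm]
        refine Finset.sum_congr rfl fun i _ => ?_
        rw [Finset.sum_comm]
        refine Finset.sum_congr rfl fun k _ => ?_
        rw [← Finset.mul_sum, h2]
    _ = ∑ i : Q n × Q n, (star (ψ i.1) * ψ i.2 * star (star (φ i.1) * φ i.2)) * 2 ^ n := by
        simp
    _ = _ := by
        rw [← Finset.sum_mul, mul_comm, Fintype.sum_prod_type]
        congr 1
        simp only [dotProduct, star_sum, Finset.sum_mul_sum, Pi.star_apply, star_mul', star_star]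
        rw [Finset.sum_comm]
        exact Finset.sum_congr rfl fun _ _ => Finset.sum_congr rfl fun _ _ => by ring

/-- A vector all of whose Pauli expectations are `0` or `±‖ψ‖²`: a multiple of a stabiliser
state vector. -/
def StabLike {n : ℕ} (ψ : Q n → ℂ) : Prop := ∀ z x : Q n,
  expect ψ (pauli z x) = 0 ∨ expect ψ (pauli z x) = star ψ ⬝ᵥ ψ ∨
    expect ψ (pauli z x) = -(star ψ ⬝ᵥ ψ)

theorem StabLike.expect_hermitian {n : ℕ} {ψ : Q n → ℂ} (h : StabLike ψ) {M : Op n}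
    (hM : M ∈ pauliGroup n) (hM' : Mᴴ = M) :
    expect ψ M = 0 ∨ expect ψ M = star ψ ⬝ᵥ ψ ∨ expect ψ M = -(star ψ ⬝ᵥ ψ) := by
  obtain ⟨z, x, rfl | rfl⟩ := eq_or_neg_of_hermitian hM hM'
  · exact h z x
  · rw [expect_neg]
    rcases h z x with h | h | h <;> simp [h]

-- Equality case of Cauchy-Schwarz: for `P = pauli z x` one has `‖Pψ - cψ‖² = 2‖ψ‖² - 2c⟨P⟩`, which
-- vanishes here.
open scoped ComplexOrder in
theorem eigen_of_expect {n : ℕ} {ψ : Q n → ℂ} {z x : Q n} {c : ℂ} (hc : c = 1 ∨ c = -1)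
    (h : expect ψ (pauli z x) = c * (star ψ ⬝ᵥ ψ)) : pauli z x *ᵥ ψ = c • ψ := by
  rw [← sub_eq_zero, ← dotProduct_star_self_eq_zero, star_sub, sub_dotProduct, dotProduct_sub,
    dotProduct_sub, star_mulVec_dotProduct, star_mulVec_dotProduct, pauli_conjTranspose,
    Matrix.mulVec_mulVec, pauli_mul_self, Matrix.one_mulVec, Matrix.mulVec_smul, star_smul,
    smul_dotProduct, smul_dotProduct, dotProduct_smul, dotProduct_smul]
  change star ψ ⬝ᵥ ψ - c • expect ψ (pauli z x) - (star c • expect ψ (pauli z x) - _) = 0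
  rw [h]
  rcases hc with rfl | rfl <;> simp

theorem eigenvalue_eq_or {n : ℕ} {ψ : Q n → ℂ} (hψ : ψ ≠ 0) {z x : Q n} {c : ℂ}
    (h : pauli z x *ᵥ ψ = c • ψ) : c = 1 ∨ c = -1 := by
  have h1 : pauli z x *ᵥ (pauli z x *ᵥ ψ) = (c * c) • ψ := by
    rw [h, Matrix.mulVec_smul, h, smul_smul]
  rw [Matrix.mulVec_mulVec, pauli_mul_self, Matrix.one_mulVec] at h1
  have h2 : (c * c - 1) • ψ = 0 := by rw [sub_smul, ← h1, one_smul, sub_self]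
  rcases smul_eq_zero.1 h2 with h2 | h2
  · exact mul_self_eq_one_iff.1 (sub_eq_zero.1 h2)
  · exact absurd h2 hψ

/-- The positions of the nonzero entries give `x`. Comparing entries along them makes the character
of `z + z'` trivial, and `sum_chi` then forces `z + z' = 0`. -/
theorem pauli_label_injective {n : ℕ} {c d : ℂ} (hc : c ≠ 0) {z x z' x' : Q n}
    (h : c • pauli z x = d • pauli z' x') : z = z' ∧ x = x' := by
  have hx : x = x' := by
    by_contra hne
    have h1 := congrFun (congrFun h x) 0
    rw [Matrix.smul_apply, Matrix.smul_apply, pauli_apply, pauli_apply, if_pos (zero_add x).symm,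
      if_neg (by rwa [zero_add]), smul_zero, smul_eq_mul] at h1
    exact mul_ne_zero hc (mul_ne_zero (phase_ne_zero _ _) (chi_ne_zero _ _)) h1
  subst hx
  refine ⟨?_, rfl⟩
  have h1 : ∀ u : Q n, c * (phase z x * chi z u) = d * (phase z' x * chi z' u) := by
    intro u
    have h1 := congrFun (congrFun h u) (u + x)
    simpa [pauli_apply, label_add_add_cancel] using h1
  have h2 := h1 0
  simp only [chi_zero_right, mul_one] at h2
  have h3 : ∀ u : Q n, chi u (z + z') = 1 := by
    intro u
    have h4 := h1 u
    have h5 : (c * phase z x) * (chi z u - chi z' u) = 0 := by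
      linear_combination h4 - chi z' u * h2
    have h6 := (mul_eq_zero.1 h5).resolve_left (mul_ne_zero hc (phase_ne_zero _ _))
    rw [chi_comm, chi_add_left, sub_eq_zero.1 h6, chi_mul_self]
  have h4 := sum_chi (z + z')
  simp only [h3] at h4
  split_ifs at h4 with h5
  · rw [← label_add_add_cancel z z', h5, zero_add]
  · simp [ZMod.card] at h4

theorem ne_zero_of_unit {n : ℕ} {ψ : Q n → ℂ} (h : star ψ ⬝ᵥ ψ = 1) : ψ ≠ 0 := by
  rintro rfl; simp at h

/-- The budget behind both directions of the counting argument. -/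
theorem sum_normSq_expect {n : ℕ} {ψ : Q n → ℂ} (h : star ψ ⬝ᵥ ψ = 1) :
    ∑ p : Q n × Q n, Complex.normSq (expect ψ (pauli p.1 p.2)) = 2 ^ n := by
  have h1 := sum_expect_pauli ψ ψ
  rw [h, star_one, mul_one, mul_one] at h1
  have h2 : ∀ c : ℂ, c * star c = (Complex.normSq c : ℂ) := fun c => (Complex.mul_conj c)
  simp only [h2] at h1
  exact_mod_cast h1

theorem inv_eq_self_of_eq_or {c : ℂ} (h : c⁻¹ = 1 ∨ c⁻¹ = -1) : c⁻¹ = c := by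
  rcases h with h | h
  · rw [h, ← inv_inv c, h, inv_one]
  · rw [h, ← inv_inv c, h]; norm_num

theorem star_expect_pauli {n : ℕ} (ψ : Q n → ℂ) (z x : Q n) :
    star (expect ψ (pauli z x)) = expect ψ (pauli z x) := by
  rw [expect, ← Matrix.star_dotProduct (pauli z x *ᵥ ψ) ψ, star_mulVec_dotProduct,
    pauli_conjTranspose]

/-- The `2^n` elements of the stabiliser group carry distinct Pauli labels, and each has squared
expectation one. They exhaust the total `2^n` of `sum_normSq_expect`, so all other expectations
vanish. -/
theorem IsStabilizerVec.stabLike {n : ℕ} {ψ : Q n → ℂ} (h : IsStabilizerVec ψ) : StabLike ψ := by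
  classical
  obtain ⟨h1, S, hS, hcard, hfix⟩ := h
  have hψ := ne_zero_of_unit h1
  have hlab : ∀ s : S, ∃ (p : Q n × Q n) (c : ℂ), ((s : Matrix.unitaryGroup (Q n) ℂ) : Op n) =
      c • pauli p.1 p.2 ∧ pauli p.1 p.2 *ᵥ ψ = c • ψ := by
    intro s
    obtain ⟨c, z, x, hc, hs⟩ := mem_pauliGroup_iff.1 (hS.pauli_mem s s.2)
    have h2 := hfix s s.2
    rw [hs, Matrix.smul_mulVec] at h2
    have hc0 : c ≠ 0 := by rintro rfl; simp at hc
    have h3 : pauli z x *ᵥ ψ = c⁻¹ • ψ := by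
      rw [← h2, smul_smul, inv_mul_cancel₀ hc0, one_smul, h2]
    refine ⟨(z, x), c, hs, ?_⟩
    rw [h3, inv_eq_self_of_eq_or (eigenvalue_eq_or hψ h3)]
  choose f c hf hfc using hlab
  let T : Finset (Q n × Q n) := Finset.univ.filter fun p =>
    Complex.normSq (expect ψ (pauli p.1 p.2)) = 1
  have hfT : ∀ s, f s ∈ T := by
    intro s
    rw [Finset.mem_filter]
    refine ⟨Finset.mem_univ _, ?_⟩
    rw [expect_of_eigen (hfc s), h1, mul_one]
    rcases eigenvalue_eq_or hψ (hfc s) with h | h <;> simp [h]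
  -- The coefficient of a group element is the eigenvalue of its Pauli operator on `ψ`, so the label
  -- determines the element.
  have hinj : Function.Injective fun s : S => (⟨f s, hfT s⟩ : T) := by
    intro s t hst
    have hst' : f s = f t := congrArg Subtype.val hst
    have h2 := hfc s
    rw [hst', hfc t] at h2
    have h3 : c t = c s := smul_left_injective ℂ hψ h2
    apply Subtype.ext; apply Subtype.ext
    rw [hf s, hf t, hst', h3]
  have hle : 2 ^ n ≤ T.card := by
    rw [← hcard, ← show Nat.card T = T.card by simp]
    exact Nat.card_le_card_of_injective _ hinj
  have hsum := sum_normSq_expect h1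
  rw [← Finset.sum_add_sum_compl T, Finset.sum_congr rfl fun p hp => (Finset.mem_filter.1 hp).2,
    Finset.sum_const, nsmul_eq_mul, mul_one] at hsum
  have hle' : (2 : ℝ) ^ n ≤ T.card := by exact_mod_cast hle
  have hz : ∑ p ∈ Tᶜ, Complex.normSq (expect ψ (pauli p.1 p.2)) = 0 :=
    le_antisymm (by linarith) (Finset.sum_nonneg fun _ _ => Complex.normSq_nonneg _)
  rw [Finset.sum_eq_zero_iff_of_nonneg fun _ _ => Complex.normSq_nonneg _] at hz
  have hcompl : ∀ p ∉ T, expect ψ (pauli p.1 p.2) = 0 := fun p hp =>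
    Complex.normSq_eq_zero.1 (hz p (Finset.mem_compl.2 hp))
  intro z x
  by_cases hp : (z, x) ∈ T
  · right
    have h2 := (Finset.mem_filter.1 hp).2
    have h3 : expect ψ (pauli z x) * star (expect ψ (pauli z x)) = 1 := by
      rw [show expect ψ (pauli z x) * star (expect ψ (pauli z x)) =
        (Complex.normSq (expect ψ (pauli z x)) : ℂ) from Complex.mul_conj _, h2, Complex.ofReal_one]
    rw [star_expect_pauli] at h3
    rw [h1]
    exact mul_self_eq_one_iff.1 h3
  · exact Or.inl (hcompl (z, x) hp)

/-- The subgroup of all Pauli group elements that fix `ψ`. -/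
def fixingSubgroup {n : ℕ} (ψ : Q n → ℂ) : Subgroup (Matrix.unitaryGroup (Q n) ℂ) where
  carrier := {u | (u : Op n) ∈ pauliGroup n ∧ (u : Op n) *ᵥ ψ = ψ}
  mul_mem' := by
    rintro a b ⟨ha, ha'⟩ ⟨hb, hb'⟩
    refine ⟨mul_mem_pauliGroup ha hb, ?_⟩
    change ((a : Op n) * (b : Op n)) *ᵥ ψ = ψ
    rw [← Matrix.mulVec_mulVec, hb', ha']
  one_mem' := ⟨one_mem_pauliGroup, Matrix.one_mulVec ψ⟩
  inv_mem' := by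
    rintro a ⟨ha, ha'⟩
    have h : ((a⁻¹ : Matrix.unitaryGroup (Q n) ℂ) : Op n) = (a : Op n)ᴴ := rfl
    refine ⟨h ▸ conjTranspose_mem_pauliGroup ha, ?_⟩
    rw [h]
    nth_rw 1 [← ha']
    rw [Matrix.mulVec_mulVec, ← Matrix.star_eq_conjTranspose, Matrix.mem_unitaryGroup_iff'.1 a.2,
      Matrix.one_mulVec]

/-- When all squared expectations are 0 or 1, their sum `2^n` counts the nonzero ones. The
corresponding signed Pauli operators are precisely the elements of `fixingSubgroup ψ`; anticommuting
elements, or `-1`, would give `ψ = -ψ`. -/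
theorem StabLike.isStabilizerVec {n : ℕ} {ψ : Q n → ℂ} (h1 : star ψ ⬝ᵥ ψ = 1) (h : StabLike ψ) :
    IsStabilizerVec ψ := by
  classical
  have hψ := ne_zero_of_unit h1
  have hval : ∀ p : Q n × Q n, expect ψ (pauli p.1 p.2) ≠ 0 →
      (expect ψ (pauli p.1 p.2) = 1 ∨ expect ψ (pauli p.1 p.2) = -1) := by
    intro p hp
    have := (h p.1 p.2).resolve_left hp
    rwa [h1] at this
  refine ⟨h1, fixingSubgroup ψ, ⟨fun s hs => hs.1, ?_, ?_⟩, ?_, fun s hs => hs.2⟩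
  · rintro s ⟨hs, hs'⟩ t ⟨ht, ht'⟩
    apply Subtype.ext
    change (s : Op n) * (t : Op n) = (t : Op n) * (s : Op n)
    have h2 : ((s : Op n) * (t : Op n)) *ᵥ ψ = ψ := by rw [← Matrix.mulVec_mulVec, ht', hs']
    have h3 : ((t : Op n) * (s : Op n)) *ᵥ ψ = ψ := by rw [← Matrix.mulVec_mulVec, hs', ht']
    obtain ⟨c, z, x, -, hs⟩ := mem_pauliGroup_iff.1 hs
    obtain ⟨d, z', x', -, ht⟩ := mem_pauliGroup_iff.1 ht
    have h4 : (s : Op n) * (t : Op n) = omega z x z' x' • ((t : Op n) * (s : Op n)) := by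
      rw [hs, ht, smul_mul_smul_comm, smul_mul_smul_comm, pauli_mul_comm, smul_smul, smul_smul,
        mul_comm c d, mul_comm (omega z x z' x')]
    rw [h4, Matrix.smul_mulVec, h3] at h2
    have h5 : omega z x z' x' = 1 := by
      rcases omega_eq_or z x z' x' with h5 | h5
      · exact h5
      · rw [h5, neg_smul, one_smul] at h2
        exact absurd (self_eq_neg.1 h2.symm) hψ
    rw [h4, h5, one_smul]
  · rintro s ⟨-, hs⟩ hneg
    rw [hneg, Matrix.neg_mulVec, Matrix.one_mulVec] at hs
    exact hψ (self_eq_neg.1 hs.symm)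
  · let T : Finset (Q n × Q n) := Finset.univ.filter fun p => expect ψ (pauli p.1 p.2) ≠ 0
    have hT : T.card = 2 ^ n := by
      have hsum := sum_normSq_expect h1
      have h2 : ∀ p : Q n × Q n, Complex.normSq (expect ψ (pauli p.1 p.2)) =
          if expect ψ (pauli p.1 p.2) ≠ 0 then 1 else 0 := by
        intro p
        split_ifs with hp
        · rcases hval p hp with h | h <;> simp [h]
        · rw [not_not.1 hp]; simp
      simp only [h2] at hsum
      rw [Finset.sum_boole] at hsum
      exact_mod_cast hsum
    rw [← hT, ← show Nat.card T = T.card by simp]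
    have hmem : ∀ p : T, (expect ψ (pauli p.1.1 p.1.2) • pauli p.1.1 p.1.2) ∈ pauliGroup n ∧
        (expect ψ (pauli p.1.1 p.1.2) • pauli p.1.1 p.1.2) *ᵥ ψ = ψ := by
      intro p
      have hp := hval p.1 (Finset.mem_filter.1 p.2).2
      refine ⟨smul_mem_pauliGroup ?_ (pauli_mem _ _), ?_⟩
      · rcases hp with h | h <;> rw [h] <;> norm_num
      · rw [Matrix.smul_mulVec, eigen_of_expect hp (by rw [h1, mul_one]), smul_smul]
        rcases hp with h | h <;> rw [h] <;> norm_num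
    let g : T → fixingSubgroup ψ := fun p =>
      ⟨⟨_, Matrix.mem_unitaryGroup_iff.2 (mul_conjTranspose_of_mem_pauliGroup (hmem p).1)⟩, hmem p⟩
    symm
    refine Nat.card_eq_of_bijective g ⟨fun p q hpq => ?_, fun s => ?_⟩
    · have h2 : expect ψ (pauli p.1.1 p.1.2) • pauli p.1.1 p.1.2 =
          expect ψ (pauli q.1.1 q.1.2) • pauli q.1.1 q.1.2 :=
        congrArg (fun s : fixingSubgroup ψ => ((s : Matrix.unitaryGroup (Q n) ℂ) : Op n)) hpq
      have h3 := pauli_label_injective (Finset.mem_filter.1 p.2).2 h2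
      exact Subtype.ext (Prod.ext h3.1 h3.2)
    · obtain ⟨⟨s, hs'⟩, hs, hfix⟩ := s
      obtain ⟨c, z, x, hc, rfl⟩ := mem_pauliGroup_iff.1 hs
      have hc0 : c ≠ 0 := by rintro rfl; simp at hc
      have h3 : pauli z x *ᵥ ψ = c⁻¹ • ψ := by
        have hfix' : (c • pauli z x) *ᵥ ψ = ψ := hfix
        rw [Matrix.smul_mulVec] at hfix'
        rw [eq_inv_smul_iff₀ hc0, hfix']
      have h4 : expect ψ (pauli z x) = c⁻¹ := by rw [expect_of_eigen h3, h1, mul_one]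
      have h5 := inv_eq_self_of_eq_or (eigenvalue_eq_or hψ h3)
      refine ⟨⟨(z, x), Finset.mem_filter.2 ⟨Finset.mem_univ _, ?_⟩⟩, ?_⟩
      · change expect ψ (pauli z x) ≠ 0
        rw [h4]; exact inv_ne_zero hc0
      · apply Subtype.ext; apply Subtype.ext
        change expect ψ (pauli z x) • pauli z x = c • pauli z x
        rw [h4, h5]

/-! ### Operations that preserve stabiliser vectors. -/

theorem StabLike.smul {n : ℕ} {ψ : Q n → ℂ} (h : StabLike ψ) (c : ℂ) : StabLike (c • ψ) := by
  intro z x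
  rw [← expect_one, expect_smul_vec, expect_smul_vec, expect_one]
  rcases h z x with h | h | h <;> simp [h]

theorem stabLike_single {n : ℕ} (y : Q n) : StabLike (Pi.single y (1 : ℂ)) := by
  intro z x
  have h : expect (Pi.single y (1 : ℂ)) (pauli z x) = pauli z x y y := by
    rw [expect, Pi.star_single, star_one, single_one_dotProduct, Matrix.mulVec_single_one]
    rfl
  have h' : star (Pi.single y (1 : ℂ)) ⬝ᵥ (Pi.single y (1 : ℂ)) = 1 := by simp
  rw [h, h', pauli_apply]
  have e : y = y + x ↔ x = 0 := by rw [left_eq_add]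
  simp only [e]
  split_ifs with hx
  · right; rw [hx, phase_zero_right, one_mul]; exact chi_eq_or z y
  · simp

theorem one_add_smul_pauli_conjTranspose {n : ℕ} {ε : ℂ} (hε : ε = 1 ∨ ε = -1) (z x : Q n) :
    (1 + ε • pauli z x)ᴴ = 1 + ε • pauli z x := by
  rw [Matrix.conjTranspose_add, Matrix.conjTranspose_smul, pauli_conjTranspose,
    Matrix.conjTranspose_one]
  rcases hε with rfl | rfl <;> simp

theorem one_add_smul_pauli_mul_self {n : ℕ} {ε : ℂ} (hε : ε = 1 ∨ ε = -1) (z x : Q n) :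
    (1 + ε • pauli z x) * (1 + ε • pauli z x) = (2 : ℂ) • (1 + ε • pauli z x) := by
  have h : ε * ε = 1 := by rcases hε with rfl | rfl <;> simp
  rw [mul_add, mul_one, add_mul, one_mul, smul_mul_smul_comm, pauli_mul_self, h, one_smul, two_smul]
  abel

/-- Write `P` for the measured operator. If `⟨P⟩ ≠ 0`, then `ψ` is an eigenvector and is only
rescaled, possibly to zero. If `⟨P⟩ = 0`, the squared norm doubles; a `Q` anticommuting with `P`
gets expectation zero, and a commuting `Q` gets `2(⟨Q⟩ + ε⟨QP⟩)`. At most one of the two terms is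
nonzero, since `⟨Q⟩ ≠ 0` makes `ψ` an eigenvector of `Q` and hence `⟨QP⟩ = ±⟨P⟩ = 0`. -/
theorem StabLike.one_add_pauli {n : ℕ} {ψ : Q n → ℂ} (h : StabLike ψ) {ε : ℂ}
    (hε : ε = 1 ∨ ε = -1) (z x : Q n) : StabLike ((1 + ε • pauli z x) *ᵥ ψ) := by
  have hε2 : ε * ε = 1 := by rcases hε with rfl | rfl <;> simp
  have key : ∀ δ : ℂ, pauli z x *ᵥ ψ = δ • ψ → StabLike ((1 + ε • pauli z x) *ᵥ ψ) := by
    intro δ hδ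
    rw [Matrix.add_mulVec, Matrix.one_mulVec, Matrix.smul_mulVec, hδ, smul_smul,
      show ψ + (ε * δ) • ψ = (1 + ε * δ) • ψ by rw [add_smul, one_smul]]
    exact h.smul _
  rcases h z x with h0 | h0 | h0
  · intro z' x'
    have hN : star ((1 + ε • pauli z x) *ᵥ ψ) ⬝ᵥ ((1 + ε • pauli z x) *ᵥ ψ) =
        2 * (star ψ ⬝ᵥ ψ) := by
      rw [← expect_one, expect_mulVec, Matrix.mul_one, one_add_smul_pauli_conjTranspose hε,
        one_add_smul_pauli_mul_self hε, expect_smul, expect_add, expect_smul, h0, expect_one]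
      ring
    rw [hN, expect_mulVec, one_add_smul_pauli_conjTranspose hε]
    have hcomm := pauli_mul_comm z x z' x'
    rcases omega_eq_or z x z' x' with ho | ho
    · rw [ho, one_smul] at hcomm
      have h1 : (1 + ε • pauli z x) * pauli z' x' * (1 + ε • pauli z x) =
          (2 : ℂ) • (pauli z' x' + ε • (pauli z' x' * pauli z x)) := by
        have : (1 + ε • pauli z x) * pauli z' x' = pauli z' x' * (1 + ε • pauli z x) := by
          rw [add_mul, mul_add, one_mul, mul_one, smul_mul_assoc, hcomm, mul_smul_comm]
        rw [this, Matrix.mul_assoc, one_add_smul_pauli_mul_self hε, mul_smul_comm, mul_add, mul_one,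
          mul_smul_comm]
      rw [h1, expect_smul, expect_add, expect_smul]
      have h2 := h.expect_hermitian (mul_mem_pauliGroup (pauli_mem z' x') (pauli_mem z x)) (by
        rw [Matrix.conjTranspose_mul, pauli_conjTranspose, pauli_conjTranspose, hcomm])
      have h3 : ∀ δ : ℂ, (δ = 1 ∨ δ = -1) → expect ψ (pauli z' x') = δ * (star ψ ⬝ᵥ ψ) →
          expect ψ (pauli z' x' * pauli z x) = 0 := by
        intro δ hδ h3
        rw [← hcomm, expect_mul_of_eigen (eigen_of_expect hδ h3), h0, mul_zero]
      rcases h z' x' with h4 | h4 | h4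
      · rw [h4]
        rcases h2 with h2 | h2 | h2 <;> rcases hε with rfl | rfl <;> simp [h2]
      · rw [h3 1 (Or.inl rfl) (by rw [h4, one_mul]), h4]; simp
      · rw [h3 (-1) (Or.inr rfl) (by rw [h4, neg_one_mul]), h4]; simp
    · left
      rw [ho, neg_one_smul] at hcomm
      have : (1 + ε • pauli z x) * pauli z' x' * (1 + ε • pauli z x) = 0 := by
        rw [add_mul, one_mul, smul_mul_assoc, hcomm, mul_add, mul_one, add_mul, mul_smul_comm,
          smul_mul_assoc, smul_neg, neg_mul, mul_smul_comm, smul_neg, smul_smul, hε2, one_smul,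
          Matrix.mul_assoc, pauli_mul_self, Matrix.mul_one]
        abel
      rw [this, expect_zero]
  · exact key 1 (eigen_of_expect (Or.inl rfl) (by rw [h0, one_mul]))
  · exact key (-1) (eigen_of_expect (Or.inr rfl) (by rw [h0, neg_one_mul]))

theorem StabLike.clifford {n : ℕ} {ψ : Q n → ℂ} (h : StabLike ψ) {U : Op n} (hU : IsClifford U) :
    StabLike (U *ᵥ ψ) := by
  obtain ⟨h1, -, h3⟩ := isClifford_iff.1 hU
  intro z x
  rw [← expect_one, expect_mulVec, expect_mulVec, Matrix.mul_one, h1, expect_one]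
  refine h.expect_hermitian (h3 _ (pauli_mem z x)) ?_
  simp only [Matrix.conjTranspose_mul, pauli_conjTranspose, Matrix.conjTranspose_conjTranspose,
    Matrix.mul_assoc]

/-- The tensor product of two vectors. -/
def tensVec {n k : ℕ} (ψ : Q n → ℂ) (φ : Q k → ℂ) : Q (n + k) → ℂ :=
  fun x => ψ (fstPart x) * φ (sndPart x)

theorem kron_mulVec_tensVec {n k : ℕ} (A : Op n) (B : Op k) (ψ : Q n → ℂ) (φ : Q k → ℂ) :
    kron A B *ᵥ tensVec ψ φ = tensVec (A *ᵥ ψ) (B *ᵥ φ) := by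
  ext x
  simp only [Matrix.mulVec, dotProduct, sum_append, kron_apply, tensVec, fstPart_append,
    sndPart_append, Finset.sum_mul_sum]
  exact Finset.sum_congr rfl fun _ _ => Finset.sum_congr rfl fun _ _ => by ring

theorem star_tensVec_dotProduct {n k : ℕ} (ψ ψ' : Q n → ℂ) (φ φ' : Q k → ℂ) :
    star (tensVec ψ φ) ⬝ᵥ tensVec ψ' φ' = (star ψ ⬝ᵥ ψ') * (star φ ⬝ᵥ φ') := by
  simp only [dotProduct, sum_append, tensVec, fstPart_append, Pi.star_apply, star_mul',
    sndPart_append, Finset.sum_mul_sum]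
  exact Finset.sum_congr rfl fun _ _ => Finset.sum_congr rfl fun _ _ => by ring

theorem StabLike.tens {n k : ℕ} {ψ : Q n → ℂ} {φ : Q k → ℂ} (h : StabLike ψ)
    (h' : StabLike φ) : StabLike (tensVec ψ φ) := by
  intro z x
  rw [pauli_eq_kron z x, expect, kron_mulVec_tensVec, star_tensVec_dotProduct,
    star_tensVec_dotProduct]
  change expect ψ _ * expect φ _ = 0 ∨ expect ψ _ * expect φ _ = _ ∨ expect ψ _ * expect φ _ = _
  rcases h (fstPart z) (fstPart x) with h | h | h <;>
    rcases h' (sndPart z) (sndPart x) with h' | h' | h' <;> simp [h, h']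

theorem ketbra_tensVec {n k : ℕ} (ψ : Q n → ℂ) (φ : Q k → ℂ) :
    ketbra (tensVec ψ φ) = kron (ketbra ψ) (ketbra φ) := by
  ext x y
  simp only [ketbra, tensVec, kron_apply, Matrix.vecMulVec_apply, Pi.star_apply, star_mul']
  ring

theorem rx_mulVec {n m : ℕ} (e : Fin n ≃ Fin m) (A : Op n) (ψ : Q n → ℂ) :
    (rx e A *ᵥ fun x => ψ (x ∘ e)) = fun x => (A *ᵥ ψ) (x ∘ e) := by
  ext x
  exact (labelEquiv e).sum_comp fun v => A (x ∘ e) v * ψ v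

theorem StabLike.relabel {n m : ℕ} (e : Fin n ≃ Fin m) {ψ : Q n → ℂ} (h : StabLike ψ) :
    StabLike fun x : Q m => ψ (x ∘ e) := by
  have hdot : ∀ φ : Q n → ℂ, (star fun x : Q m => ψ (x ∘ e)) ⬝ᵥ (fun x => φ (x ∘ e)) =
      star ψ ⬝ᵥ φ := fun φ => (labelEquiv e).sum_comp fun v => star (ψ v) * φ v
  intro z x
  rw [← rx_pauli e, expect, rx_mulVec, hdot, hdot]
  exact h _ _

theorem rx_ketbra {n m : ℕ} (e : Fin n ≃ Fin m) (ψ : Q n → ℂ) :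
    rx e (ketbra ψ) = ketbra fun x => ψ (x ∘ e) := rfl

/-- Projecting a stabiliser vector to the labels that agree with `y` on `s` is a sequence of
Pauli projections. -/
theorem StabLike.restrict {n : ℕ} {ψ : Q n → ℂ} (h : StabLike ψ) (y : Q n) (s : Finset (Fin n)) :
    StabLike fun x => if ∀ i ∈ s, x i = y i then ψ x else 0 := by
  induction s using Finset.induction_on with
  | empty => simpa using h
  | insert a s ha ih =>
    have hsingle : ∀ x : Q n, chi (Pi.single a 1) x = (-1) ^ (x a).val := by
      intro x
      rw [chi_eq_prod, Finset.prod_eq_single a]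
      · rw [Pi.single_eq_same]
        congr 1
        exact one_mul _
      · intro b _ hb; simp [hb]
      · simp
    -- Half of `1 + (-1)^(y a) Z_a` is the projection onto the labels with `x a = y a`.
    have h1 := (ih.one_add_pauli (neg_one_pow_eq_or ℂ (y a).val) (Pi.single a 1) 0).smul (1 / 2)
    convert h1 using 1
    ext x
    rw [Pi.smul_apply, Matrix.add_mulVec, Matrix.one_mulVec, Matrix.smul_mulVec, Pi.add_apply,
      Pi.smul_apply, pauli_mulVec, hsingle, add_zero, phase_zero_right, one_mul]
    simp only [Finset.forall_mem_insert, smul_eq_mul]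
    have hval : ∀ b c : ZMod 2, (-1 : ℂ) ^ b.val * (-1) ^ c.val = if c = b then 1 else -1 := by
      intro b c
      have hb : b = 0 ∨ b = 1 := by revert b; decide
      have hc : c = 0 ∨ c = 1 := by revert c; decide
      have h1 : (1 : ZMod 2).val = 1 := rfl
      rcases hb with rfl | rfl <;> rcases hc with rfl | rfl <;> simp [h1]
    rw [← mul_assoc ((-1 : ℂ) ^ (y a).val), hval]
    by_cases hs : ∀ i ∈ s, x i = y i
    · by_cases hxa : x a = y a
      · rw [if_pos ⟨hxa, hs⟩, if_pos hs, if_pos hxa]; ring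
      · rw [if_neg fun h => hxa h.1, if_pos hs, if_neg hxa]; ring
    · rw [if_neg fun h => hs h.2, if_neg hs]; ring

/-- Projecting the last qubits onto `|u⟩` leaves the compressed vector tensored with `|u⟩`. Pauli
operators that act trivially on the second factor then read off the expectations of the first. -/
theorem StabLike.compress {n k : ℕ} {ψ : Q (n + k) → ℂ} (h : StabLike ψ) (u : Q k) :
    StabLike fun x : Q n => ψ (Fin.append x u) := by
  have h1 := h.restrict (Fin.append 0 u) (Finset.univ.map (Fin.natAddEmb n))
  have h2 : (fun x : Q (n + k) => if ∀ i ∈ Finset.univ.map (Fin.natAddEmb n),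
      x i = (Fin.append 0 u : Q (n + k)) i then ψ x else 0) =
      tensVec (fun x : Q n => ψ (Fin.append x u)) (Pi.single u 1) := by
    ext x
    obtain ⟨x, v, rfl⟩ := exists_append x
    have e : (∀ i ∈ Finset.univ.map (Fin.natAddEmb n),
        (Fin.append x v : Q (n + k)) i = (Fin.append 0 u : Q (n + k)) i) ↔ v = u := by
      simp [funext_iff]
    simp only [e, tensVec, fstPart_append, sndPart_append, Pi.single_apply]
    split_ifs with hv
    · rw [hv, mul_one]
    · simp
  rw [h2] at h1
  intro z x
  have h3 := h1 (Fin.append z 0) (Fin.append x 0)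
  rw [pauli_append, pauli_zero, expect, kron_mulVec_tensVec, Matrix.one_mulVec,
    star_tensVec_dotProduct, star_tensVec_dotProduct] at h3
  simpa [expect] using h3

theorem conj_ketbra {n : ℕ} (A : Op n) (ψ : Q n → ℂ) : conj A (ketbra ψ) = ketbra (A *ᵥ ψ) := by
  rw [conj_apply, ketbra, ketbra, Matrix.mul_vecMulVec, Matrix.vecMulVec_mul, Matrix.star_mulVec]

theorem discard_ketbra {n k : ℕ} (ψ : Q (n + k) → ℂ) :
    (discard (ketbra ψ) : Op n) = ∑ u : Q k, ketbra fun x => ψ (Fin.append x u) := by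
  ext x y
  rw [Matrix.sum_apply]; rfl

theorem trace_ketbra {n : ℕ} (ψ : Q n → ℂ) : (ketbra ψ).trace = star ψ ⬝ᵥ ψ := by
  rw [ketbra, Matrix.trace_vecMulVec, dotProduct_comm]

theorem ketbra_smul {n : ℕ} (c : ℂ) (ψ : Q n → ℂ) : ketbra (c • ψ) = (c * star c) • ketbra ψ := by
  rw [ketbra, star_smul, Matrix.smul_vecMulVec, Matrix.vecMulVec_smul, smul_smul]; rfl

/-! ### The cone over the stabiliser polytope, and the inclusion of `SO` in `CSP`. -/

/-- The cone generated by the stabiliser polytope. -/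
def cone (n : ℕ) : Set (Op n) := {ρ | ∃ c : ℝ, 0 ≤ c ∧ ∃ σ ∈ SP n, ρ = c • σ}

theorem stab_nonempty (n : ℕ) : (STAB n).Nonempty :=
  ⟨_, Pi.single 0 1, (stabLike_single 0).isStabilizerVec (by simp), rfl⟩

theorem zero_mem_cone {n : ℕ} : (0 : Op n) ∈ cone n := by
  obtain ⟨σ, hσ⟩ := stab_nonempty n
  exact ⟨0, le_rfl, σ, subset_convexHull ℝ _ hσ, by simp⟩

theorem smul_mem_cone {n : ℕ} {c : ℝ} (hc : 0 ≤ c) {ρ : Op n} (h : ρ ∈ cone n) :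
    c • ρ ∈ cone n := by
  obtain ⟨d, hd, σ, hσ, rfl⟩ := h
  exact ⟨c * d, mul_nonneg hc hd, σ, hσ, smul_smul _ _ _⟩

theorem SP_subset_cone {n : ℕ} : SP n ⊆ cone n := fun σ hσ => ⟨1, zero_le_one, σ, hσ, by simp⟩

theorem add_mem_cone {n : ℕ} {ρ σ : Op n} (hρ : ρ ∈ cone n) (hσ : σ ∈ cone n) :
    ρ + σ ∈ cone n := by
  obtain ⟨c, hc, ρ, hρ, rfl⟩ := hρ
  obtain ⟨d, hd, σ, hσ, rfl⟩ := hσ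
  rcases (add_nonneg hc hd).eq_or_lt with h | h
  · rw [show c = 0 by linarith, show d = 0 by linarith]
    simpa using zero_mem_cone
  · refine ⟨c + d, h.le, (c / (c + d)) • ρ + (d / (c + d)) • σ,
      convex_convexHull ℝ _ hρ hσ (by positivity) (by positivity) (by field_simp), ?_⟩
    rw [smul_add, smul_smul, smul_smul, mul_div_cancel₀ _ h.ne', mul_div_cancel₀ _ h.ne']

theorem sum_mem_cone {n : ℕ} {ι : Type*} (s : Finset ι) {f : ι → Op n}
    (h : ∀ i ∈ s, f i ∈ cone n) : ∑ i ∈ s, f i ∈ cone n :=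
  Finset.sum_induction f (· ∈ cone n) (fun _ _ => add_mem_cone) zero_mem_cone h

/-- Normalising a nonzero vector costs the factor `‖ψ‖²`. The zero vector, which arises from
impossible outcomes, is the reason for working with cones. -/
theorem StabLike.ketbra_mem_cone {n : ℕ} {ψ : Q n → ℂ} (h : StabLike ψ) : ketbra ψ ∈ cone n := by
  by_cases hψ : ψ = 0
  · rw [hψ]; simpa [ketbra] using zero_mem_cone
  · set N : ℝ := ∑ i, Complex.normSq (ψ i) with hN
    have hN0 : 0 < N := by
      obtain ⟨i, hi⟩ := Function.ne_iff.1 hψ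
      exact Finset.sum_pos' (fun _ _ => Complex.normSq_nonneg _)
        ⟨i, Finset.mem_univ _, Complex.normSq_pos.2 hi⟩
    have hs : (Real.sqrt N : ℂ) * Real.sqrt N = N := by
      rw [← Complex.ofReal_mul, Real.mul_self_sqrt hN0.le]
    have hs0 : (Real.sqrt N : ℂ) ≠ 0 := by
      rw [Complex.ofReal_ne_zero]; exact (Real.sqrt_pos.2 hN0).ne'
    refine ⟨N, hN0.le, ketbra (((Real.sqrt N)⁻¹ : ℂ) • ψ),
      subset_convexHull ℝ _ ⟨_, (h.smul _).isStabilizerVec ?_, rfl⟩, ?_⟩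
    · rw [star_smul, smul_dotProduct, dotProduct_smul, dotProduct_star_self, ← hN, ← hs]
      simp only [star_inv₀, smul_eq_mul, RCLike.star_def, Complex.conj_ofReal]
      field_simp
    · rw [ketbra_smul, star_inv₀, RCLike.star_def, Complex.conj_ofReal, ← mul_inv, hs,
        ← Complex.coe_smul, smul_smul, mul_inv_cancel₀ (by exact_mod_cast hN0.ne'), one_smul]

theorem map_mem_cone {n m : ℕ} (F : Superop n m) (h : ∀ ψ, StabLike ψ → F (ketbra ψ) ∈ cone m)
    {ρ : Op n} (hρ : ρ ∈ cone n) : F ρ ∈ cone m := by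
  obtain ⟨c, hc, σ, hσ, rfl⟩ := hρ
  have h1 : F (c • σ) = c • F σ := by
    rw [← Complex.coe_smul, ← Complex.coe_smul, map_smul]
  rw [h1]
  refine smul_mem_cone hc ?_
  refine convexHull_min (t := {σ | F σ ∈ cone m}) ?_ ?_ hσ
  · rintro _ ⟨ψ, hψ, rfl⟩
    exact h ψ hψ.stabLike
  · intro x hx y hy a b ha hb _
    change F (a • x + b • y) ∈ cone m
    rw [map_add, ← Complex.coe_smul, ← Complex.coe_smul b, map_smul, map_smul, Complex.coe_smul,
      Complex.coe_smul]
    exact add_mem_cone (smul_mem_cone ha hx) (smul_mem_cone hb hy)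

theorem trace_of_mem_SP {n : ℕ} {ρ : Op n} (h : ρ ∈ SP n) : ρ.trace = 1 := by
  refine convexHull_min (t := {σ : Op n | σ.trace = 1}) ?_ ?_ h
  · rintro _ ⟨ψ, hψ, rfl⟩
    change (ketbra ψ).trace = 1
    rw [trace_ketbra, hψ.1]
  · intro x hx y hy a b _ _ hab
    change (a • x + b • y).trace = 1
    rw [Matrix.trace_add, Matrix.trace_smul, Matrix.trace_smul, hx, hy, ← add_smul, hab, one_smul]

/-- The scale factor of an element of the cone is its trace. Positivity and normalisation can thus
be checked separately. -/
theorem mem_SP_of_mem_cone {n : ℕ} {ρ : Op n} (h : ρ ∈ cone n) (htr : ρ.trace = 1) : ρ ∈ SP n := by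
  obtain ⟨c, hc, σ, hσ, rfl⟩ := h
  rw [Matrix.trace_smul, trace_of_mem_SP hσ] at htr
  have : c = 1 := by simpa using htr
  rwa [this, one_smul]

theorem projPlus_eq {n : ℕ} (z x : Q n) :
    projPlus z x = (1 / 2 : ℂ) • (1 + (1 : ℂ) • pauli z x) := by rw [one_smul]; rfl

theorem projMinus_eq {n : ℕ} (z x : Q n) :
    projMinus z x = (1 / 2 : ℂ) • (1 + (-1 : ℂ) • pauli z x) := by
  rw [neg_one_smul, ← sub_eq_add_neg]; rfl

theorem conj_one_add_pauli_mem_cone {n : ℕ} {ε : ℂ} (hε : ε = 1 ∨ ε = -1) (z x : Q n) {ρ : Op n}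
    (hρ : ρ ∈ cone n) : conj ((1 / 2 : ℂ) • (1 + ε • pauli z x)) ρ ∈ cone n := by
  refine map_mem_cone _ (fun ψ hψ => ?_) hρ
  rw [conj_ketbra, Matrix.smul_mulVec]
  exact ((hψ.one_add_pauli hε z x).smul _).ketbra_mem_cone

theorem kron_one_add_pauli {n k : ℕ} (ε : ℂ) (z x : Q n) :
    kron ((1 / 2 : ℂ) • (1 + ε • pauli z x)) (1 : Op k) =
      (1 / 2 : ℂ) • (1 + ε • pauli (Fin.append z 0) (Fin.append x 0)) := by
  rw [kron_smul_left, kron_add_left, kron_smul_left, kron_one_one, pauli_append, pauli_zero]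

theorem tensorId_conj_projPlus_mem_cone {n k : ℕ} (z x : Q n) {ρ : Op (n + k)}
    (hρ : ρ ∈ cone (n + k)) : tensorId k (conj (projPlus z x)) ρ ∈ cone (n + k) := by
  rw [tensorId_conj, projPlus_eq, kron_one_add_pauli]
  exact conj_one_add_pauli_mem_cone (Or.inl rfl) _ _ hρ

theorem tensorId_conj_projMinus_mem_cone {n k : ℕ} (z x : Q n) {ρ : Op (n + k)}
    (hρ : ρ ∈ cone (n + k)) : tensorId k (conj (projMinus z x)) ρ ∈ cone (n + k) := by
  rw [tensorId_conj, projMinus_eq, kron_one_add_pauli]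
  exact conj_one_add_pauli_mem_cone (Or.inr rfl) _ _ hρ

theorem trace_kron_conj_proj {n k : ℕ} {ε : ℂ} (hε : ε = 1 ∨ ε = -1) (z x : Q n)
    (ρ : Op (n + k)) : (tensorId k (conj ((1 / 2 : ℂ) • (1 + ε • pauli z x))) ρ).trace =
      (1 / 2) * (ρ.trace + ε * (pauli (Fin.append z 0) (Fin.append x 0) * ρ).trace) := by
  rw [tensorId_conj, kron_one_add_pauli, trace_conj, Matrix.conjTranspose_smul,
    one_add_smul_pauli_conjTranspose hε, smul_mul_smul_comm, one_add_smul_pauli_mul_self hε,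
    smul_smul, Matrix.smul_mul, Matrix.trace_smul, add_mul, Matrix.trace_add, Matrix.smul_mul,
    Matrix.trace_smul, one_mul]
  simp

/-- Each kind of step sends a stabiliser vector, with `k` spectator qubits, to a sum of unnormalised
ones. Single measurement branches lower the trace, so an induction with the polytope in place of the
cone would not go through. -/
theorem IsStabilizerOp.tensorId_mem_cone {n m : ℕ} {O : Superop n m} (hO : IsStabilizerOp O)
    (k : ℕ) : ∀ ρ ∈ cone (n + k), tensorId k O ρ ∈ cone (m + k) := by
  induction hO with
  | id => intro ρ hρ; rwa [tensorId_id]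
  | @prepare n j m σ hσ O hO ih =>
    intro ρ hρ
    rw [tensorId_comp]
    apply ih
    obtain ⟨f, hf⟩ := tensorId_prepare n k j σ
    rw [hf]
    obtain ⟨φ, hφ, rfl⟩ := hσ
    refine map_mem_cone (rx f ∘ₗ QubitStab.prepare (ketbra φ)) (fun ψ hψ => ?_) hρ
    rw [LinearMap.comp_apply, prepare_apply, ← ketbra_tensVec, rx_ketbra]
    exact ((hψ.tens hφ.stabLike).relabel f).ketbra_mem_cone
  | clifford U hU O hO ih =>
    intro ρ hρ
    rw [tensorId_comp, tensorId_conj]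
    refine ih _ (map_mem_cone _ (fun ψ hψ => ?_) hρ)
    rw [conj_ketbra]
    exact (hψ.clifford (hU.kron_one k)).ketbra_mem_cone
  | measure z x O₁ O₂ h₁ h₂ ih₁ ih₂ =>
    intro ρ hρ
    rw [tensorId_add, tensorId_comp, tensorId_comp]
    exact add_mem_cone (ih₁ _ (tensorId_conj_projPlus_mem_cone z x hρ))
      (ih₂ _ (tensorId_conj_projMinus_mem_cone z x hρ))
  | @discard n j m O hO ih =>
    intro ρ hρ
    rw [tensorId_comp]
    apply ih
    obtain ⟨f, hf⟩ := tensorId_discard n k j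
    rw [hf]
    refine map_mem_cone (QubitStab.discard ∘ₗ rx f) (fun ψ hψ => ?_) hρ
    rw [LinearMap.comp_apply, rx_ketbra, discard_ketbra]
    exact sum_mem_cone _ fun u _ => ((hψ.relabel f).compress u).ketbra_mem_cone
  | random p hp₀ hp₁ O₁ O₂ h₁ h₂ ih₁ ih₂ =>
    intro ρ hρ
    rw [tensorId_add, tensorId_smul, tensorId_smul]
    exact add_mem_cone (smul_mem_cone hp₀ (ih₁ _ hρ))
      (smul_mem_cone (sub_nonneg.2 hp₁) (ih₂ _ hρ))

theorem IsStabilizerOp.trace_tensorId {n m : ℕ} {O : Superop n m} (hO : IsStabilizerOp O)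
    (k : ℕ) : ∀ ρ : Op (n + k), (tensorId k O ρ).trace = ρ.trace := by
  induction hO with
  | id => intro ρ; rw [tensorId_id]
  | @prepare n j m σ hσ O hO ih =>
    intro ρ
    obtain ⟨f, hf⟩ := tensorId_prepare n k j σ
    obtain ⟨φ, hφ, rfl⟩ := hσ
    rw [tensorId_comp, ih, hf, trace_rx, trace_kron, trace_ketbra, hφ.1, mul_one]
  | clifford U hU O hO ih =>
    intro ρ
    rw [tensorId_comp, tensorId_conj, ih, trace_conj, (isClifford_iff.1 (hU.kron_one k)).1, one_mul]
  | measure z x O₁ O₂ h₁ h₂ ih₁ ih₂ =>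
    intro ρ
    rw [tensorId_add, tensorId_comp, tensorId_comp, Matrix.trace_add, ih₁, ih₂, projPlus_eq,
      projMinus_eq, trace_kron_conj_proj (Or.inl rfl), trace_kron_conj_proj (Or.inr rfl)]
    ring
  | @discard n j m O hO ih =>
    intro ρ
    obtain ⟨f, hf⟩ := tensorId_discard n k j
    rw [tensorId_comp, ih, hf, trace_discard, trace_rx]
  | random p hp₀ hp₁ O₁ O₂ h₁ h₂ ih₁ ih₂ =>
    intro ρ
    rw [tensorId_add, tensorId_smul, tensorId_smul, Matrix.trace_add, Matrix.trace_smul,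
      Matrix.trace_smul, ih₁, ih₂, ← add_smul, add_sub_cancel, one_smul]

theorem SO_subset_CSP (n m : ℕ) : SO n m ⊆ CSP n m := by
  intro O hO k ρ hρ
  refine mem_SP_of_mem_cone (IsStabilizerOp.tensorId_mem_cone hO k ρ (SP_subset_cone hρ)) ?_
  rw [IsStabilizerOp.trace_tensorId hO, trace_of_mem_SP hρ]

/-! ### The channel `Λ`: its entries, its kernel, and its decomposition into Pauli projections. -/

theorem forall_Q2 {p : Q 2 → Prop} : (∀ x, p x) ↔ p ![0, 0] ∧ p ![0, 1] ∧ p ![1, 0] ∧ p ![1, 1] := by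
  constructor
  · intro h; exact ⟨h _, h _, h _, h _⟩
  · rintro ⟨h1, h2, h3, h4⟩ x
    have hx : x = ![x 0, x 1] := by ext i; fin_cases i <;> rfl
    have hb : ∀ b : ZMod 2, b = 0 ∨ b = 1 := by decide
    rw [hx]
    rcases hb (x 0) with h | h <;> rcases hb (x 1) with h' | h' <;> rw [h, h'] <;> assumption

theorem sum_Q2 {α : Type*} [AddCommMonoid α] (f : Q 2 → α) :
    ∑ x, f x = f ![0, 0] + f ![0, 1] + f ![1, 0] + f ![1, 1] := by
  have h : (Finset.univ : Finset (Q 2)) = {![0, 0], ![0, 1], ![1, 0], ![1, 1]} := by decide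
  rw [h, Finset.sum_insert (by decide), Finset.sum_insert (by decide),
    Finset.sum_insert (by decide), Finset.sum_singleton, add_assoc, add_assoc]

/-- The entries of `Λ(ρ)`. -/
theorem Lam_apply (ρ : Op 2) (x y : Q 2) : Lam ρ x y = ρ 0 0 * (1 / 4) +
    if x = 0 ∨ y = 0 then 0 else if x = y then ρ x y else (1 / 2) * ρ x y := by
  have hk : ∀ x y : Q 2, ketbra ketPlusPlus x y = 1 / 4 := by
    intro x y
    have hs : (Real.sqrt 2 : ℂ) * Real.sqrt 2 = 2 := by
      rw [← Complex.ofReal_mul, Real.mul_self_sqrt (by norm_num)]; norm_num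
    have hs0 : (Real.sqrt 2 : ℂ) ≠ 0 := by
      rw [Complex.ofReal_ne_zero]; positivity
    simp only [ketbra, Matrix.vecMulVec_apply, ketPlusPlus, ketPlus, Pi.star_apply, star_mul',
      star_div₀, star_one, RCLike.star_def, Complex.conj_ofReal]
    field_simp
    linear_combination (-(Real.sqrt 2 : ℂ) ^ 2 - 2) * hs
  change (ρ 0 0 • ketbra ketPlusPlus
    + ∑ x : Q 2 with x ≠ 0, ρ x x • Matrix.single x x (1 : ℂ)
    + (1 / 2 : ℂ) • ∑ x : Q 2 with x ≠ 0, ∑ y : Q 2 with y ≠ 0 ∧ x ≠ y,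
        ρ x y • Matrix.single x y (1 : ℂ)) x y = _
  simp only [Matrix.add_apply, Matrix.smul_apply, hk, Matrix.sum_apply, Matrix.single_apply,
    smul_eq_mul, mul_ite, mul_one, mul_zero]
  simp only [Finset.sum_filter]
  rw [add_assoc]
  congr 1
  have e1 : (∑ a : Q 2, if a ≠ 0 then (if a = x ∧ a = y then ρ a a else 0) else 0) =
      if x ≠ 0 ∧ x = y then ρ x y else 0 := by
    rw [Finset.sum_eq_single x]
    · by_cases h : x = y
      · subst h; simp
      · simp [h]
    · intro b _ hb; simp [hb]
    · simp
  have e2 : (∑ a : Q 2, if a ≠ 0 then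
      (∑ b : Q 2, if b ≠ 0 ∧ a ≠ b then (if a = x ∧ b = y then ρ a b else 0) else 0) else 0) =
      if x ≠ 0 ∧ y ≠ 0 ∧ x ≠ y then ρ x y else 0 := by
    rw [Finset.sum_eq_single x]
    · rw [Finset.sum_eq_single y]
      · simp only [and_self, if_true]
        split_ifs <;> simp_all
      · intro b _ hb; simp [hb]
      · simp
    · intro b _ hb; simp [hb]
    · simp
  rw [e1, e2]
  by_cases hx : x = 0 <;> by_cases hy : y = 0 <;> by_cases hxy : x = y <;> simp_all

/-- For `x = 0` the entry `ρ 0 0 = 1` reappears through `|++⟩⟨++|` at position `(00, 01)`. For `x ≠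
0` that term is absent, and some entry between two nonzero labels is merely halved. -/
theorem Lam_pauli_ne_zero (z x : Q 2) : Lam (pauli z x) ≠ 0 := by
  intro h
  by_cases hx : x = 0
  · subst hx
    have h1 := congrFun (congrFun h 0) ![0, 1]
    rw [Lam_apply, if_pos (Or.inl rfl), pauli_apply] at h1
    simp at h1
  · obtain ⟨y, hy, hyx⟩ : ∃ y : Q 2, y ≠ 0 ∧ y + x ≠ 0 := by
      clear h; revert x; decide
    have h1 := congrFun (congrFun h (y + x)) y
    have h2 : pauli z x 0 0 = 0 := by
      rw [pauli_apply, if_neg]; rwa [zero_add, eq_comm]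
    have h3 : y + x ≠ y := by simpa using hx
    rw [Lam_apply, h2, if_neg (by simp [hy, hyx]), if_neg h3, pauli_apply, if_pos rfl] at h1
    simp [phase_ne_zero, chi_ne_zero] at h1

theorem projPlus_mul_apply {n : ℕ} (z x : Q n) (M : Op n) (u y : Q n) :
    (projPlus z x * M) u y = (1 / 2) * (M u y + phase z x * chi z u * M (u + x) y) := by
  have h : (pauli z x * M) u y = (pauli z x *ᵥ fun v => M v y) u := rfl
  rw [projPlus, Matrix.smul_mul, Matrix.smul_apply, add_mul, Matrix.add_apply, one_mul, h,
    pauli_mulVec, smul_eq_mul]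

theorem conj_projMinus_apply {n : ℕ} (z : Q n) (M : Op n) (u y : Q n) :
    conj (projMinus z 0) M u y = (1 / 2) * (1 - chi z u) * M u y * ((1 / 2) * (1 - chi z y)) := by
  have h : projMinus z 0 = Matrix.diagonal fun y => (1 / 2) * (1 - chi z y) := by
    ext u y
    rw [projMinus, Matrix.smul_apply, Matrix.sub_apply, pauli_apply, Matrix.diagonal_apply,
      Matrix.one_apply, add_zero, phase_zero_right, one_mul]
    split_ifs <;> simp
  rw [h, conj_apply, Matrix.diagonal_conjTranspose, Matrix.mul_diagonal, Matrix.diagonal_mul]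
  simp

theorem chi_Q2 (a b c d : ZMod 2) :
    chi ![a, b] ![c, d] = (-1) ^ (a.val * c.val) * (-1) ^ (b.val * d.val) := by
  rw [chi_eq_prod, Fin.prod_univ_two]; rfl

theorem val_one_ZMod_two : (1 : ZMod 2).val = 1 := rfl

/-- The Pauli projections whose product is proportional to `|++⟩⟨00|`. -/
noncomputable def resetOp : Op 2 :=
  projPlus 0 ![0, 1] * (projPlus 0 ![1, 0] * (projPlus ![0, 1] 0 * (projPlus ![1, 0] 0 * 1)))

/-- The `Z` projections leave `|00⟩⟨00|`; each `X` projection then halves the amplitude and spreads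
it over a bit flip. -/
theorem resetOp_apply (u y : Q 2) : resetOp u y = if y = 0 then 1 / 4 else 0 := by
  have h1 : ∀ v : Q 2, (projPlus ![0, 1] 0 * (projPlus ![1, 0] 0 * 1) : Op 2) v y =
      if v = 0 ∧ y = 0 then 1 else 0 := by
    have e0 : (![0, 0] : Q 2) = 0 := by decide
    have e1 : (![0, 1] : Q 2) ≠ 0 := by decide
    have e2 : (![1, 0] : Q 2) ≠ 0 := by decide
    have e3 : (![1, 1] : Q 2) ≠ 0 := by decide
    simp only [projPlus_mul_apply, add_zero, phase_zero_right, one_mul, Matrix.one_apply]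
    rw [forall_Q2]
    simp only [chi_Q2, ZMod.val_zero, val_one_ZMod_two, e1, e2, e3, e0, false_and, if_false,
      true_and]
    refine ⟨?_, by ring, by ring, by ring⟩
    simp only [eq_comm (a := y), chi_zero_right]
    ring
  rw [resetOp]
  generalize (projPlus ![0, 1] 0 * (projPlus ![1, 0] 0 * 1) : Op 2) = D at h1
  simp only [projPlus_mul_apply, h1, phase_zero_left, chi_zero_left, one_mul]
  by_cases hy : y = 0
  · simp only [hy, and_true, if_true]
    revert u
    rw [forall_Q2]
    refine ⟨?_, ?_, ?_, ?_⟩ <;> simp +decide only [if_true, if_false] <;> norm_num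
  · simp only [hy, and_false, if_false]
    ring

/-- The first product is conjugation by half of `|++⟩⟨00|`, hence the factor 4. The three `Z`-type
projections keep the labels of odd parity, `{01, 11}`, `{10, 11}` and `{01, 10}`: each nonzero label
lies in two of these sets and each pair of nonzero labels in one. With weight `1/2` the diagonal is
kept and the coherences are halved. -/
theorem Lam_eq : Lam = (4 : ℝ) • (conj (projPlus 0 ![0, 1]) ∘ₗ conj (projPlus 0 ![1, 0]) ∘ₗ
      conj (projPlus ![0, 1] 0) ∘ₗ conj (projPlus ![1, 0] 0)) +
    (1 / 2 : ℝ) • (conj (projMinus ![0, 1] 0) + conj (projMinus ![1, 0] 0) +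
      conj (projMinus ![1, 1] 0)) := by
  have h : conj (projPlus 0 ![0, 1]) ∘ₗ conj (projPlus 0 ![1, 0]) ∘ₗ
      conj (projPlus ![0, 1] 0) ∘ₗ conj (projPlus ![1, 0] 0) = conj resetOp := by
    rw [conj_comp_conj, conj_comp_conj, conj_comp_conj, resetOp, mul_one]
  have hr : ∀ (ρ : Op 2) (x y : Q 2), conj resetOp ρ x y = ρ 0 0 * (1 / 16) := by
    intro ρ x y
    rw [conj_apply, Matrix.mul_apply, Finset.sum_eq_single 0, Matrix.mul_apply,
      Finset.sum_eq_single 0]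
    · rw [Matrix.conjTranspose_apply, resetOp_apply, resetOp_apply, if_pos rfl]
      norm_num; ring
    · intro b _ hb; rw [resetOp_apply, if_neg hb, zero_mul]
    · simp
    · intro b _ hb
      rw [Matrix.conjTranspose_apply, resetOp_apply, if_neg hb, star_zero, mul_zero]
    · simp
  rw [h]
  refine LinearMap.ext fun ρ => ?_
  ext x y
  simp only [LinearMap.add_apply, LinearMap.smul_apply, Matrix.add_apply, Matrix.smul_apply, hr,
    conj_projMinus_apply, Lam_apply, Complex.real_smul]
  have e0 : (![0, 0] : Q 2) = 0 := by decide
  revert x y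
  simp only [forall_Q2, chi_Q2, ZMod.val_zero, val_one_ZMod_two]
  have e1 : (![0, 1] : Q 2) ≠ 0 := by decide
  have e2 : (![1, 0] : Q 2) ≠ 0 := by decide
  have e3 : (![1, 1] : Q 2) ≠ 0 := by decide
  have e4 : (![0, 1] : Q 2) ≠ ![1, 0] := by decide
  have e5 : (![0, 1] : Q 2) ≠ ![1, 1] := by decide
  have e6 : (![1, 0] : Q 2) ≠ ![1, 1] := by decide
  simp only [e0, e1, e2, e3, e4, e5, e6, e4.symm, e5.symm, e6.symm, true_or, or_true, or_self,
    if_true, if_false]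
  push_cast
  refine ⟨⟨?_, ?_, ?_, ?_⟩, ⟨?_, ?_, ?_, ?_⟩, ⟨?_, ?_, ?_, ?_⟩, ⟨?_, ?_, ?_, ?_⟩⟩ <;> ring

theorem trace_Lam (ρ : Op 2) : (Lam ρ).trace = ρ.trace := by
  simp only [Matrix.trace, Matrix.diag, Lam_apply, or_self, if_true, sum_Q2]
  have e0 : (![0, 0] : Q 2) = 0 := by decide
  have e1 : (![0, 1] : Q 2) ≠ 0 := by decide
  have e2 : (![1, 0] : Q 2) ≠ 0 := by decide
  have e3 : (![1, 1] : Q 2) ≠ 0 := by decide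
  simp only [e0, e1, e2, e3, if_true, if_false]
  ring

theorem trace_tensorId {n m : ℕ} {E : Superop n m} (hE : ∀ ρ, (E ρ).trace = ρ.trace) (k : ℕ)
    (ρ : Op (n + k)) : (tensorId k E ρ).trace = ρ.trace := by
  simp only [Matrix.trace, Matrix.diag, sum_append]
  rw [Finset.sum_comm, Finset.sum_comm (γ := Q n)]
  refine Finset.sum_congr rfl fun u _ => ?_
  simp only [tensorId_append]
  exact hE (Matrix.of fun a b => ρ (Fin.append a u) (Fin.append b u))

/-- The weight 4 is not a probability, so the decomposition is no protocol; membership in the cone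
does not see this. -/
theorem Lam_mem_CSP : Lam ∈ CSP 2 2 := by
  intro k ρ hρ
  refine mem_SP_of_mem_cone ?_ (by rw [trace_tensorId trace_Lam, trace_of_mem_SP hρ])
  have hρ' := SP_subset_cone hρ
  rw [Lam_eq]
  simp only [tensorId_add, tensorId_smul, tensorId_comp]
  refine add_mem_cone (smul_mem_cone (by norm_num) ?_) (smul_mem_cone (by norm_num)
    (add_mem_cone (add_mem_cone ?_ ?_) ?_))
  · exact tensorId_conj_projPlus_mem_cone _ _ (tensorId_conj_projPlus_mem_cone _ _
      (tensorId_conj_projPlus_mem_cone _ _ (tensorId_conj_projPlus_mem_cone _ _ hρ')))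
  all_goals exact tensorId_conj_projMinus_mem_cone _ _ hρ'

/-! ### Exposed faces and supports of stabiliser vectors. -/

/-- When nonnegative values average to zero, every point with positive weight has value zero. -/
theorem mem_convexHull_zero_face {V : Type*} [AddCommGroup V] [Module ℝ V] {A : Set V}
    (f : V →ₗ[ℝ] ℝ) (hf : ∀ a ∈ A, 0 ≤ f a) {x : V} (hx : x ∈ convexHull ℝ A) :
    0 ≤ f x ∧ (f x = 0 → x ∈ convexHull ℝ {a ∈ A | f a = 0}) := by
  refine convexHull_min (t := {x | 0 ≤ f x ∧ (f x = 0 → x ∈ convexHull ℝ {a ∈ A | f a = 0})})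
    (fun a ha => ⟨hf a ha, fun h => subset_convexHull ℝ _ ⟨ha, h⟩⟩) ?_ hx
  rintro x ⟨hx, hx'⟩ y ⟨hy, hy'⟩ a b ha hb hab
  have e : f (a • x + b • y) = a * f x + b * f y := by simp
  refine ⟨by rw [e]; positivity, fun h => ?_⟩
  rw [e] at h
  have h1 : a * f x = 0 := by nlinarith [mul_nonneg ha hx, mul_nonneg hb hy]
  have h2 : b * f y = 0 := by linarith
  rcases mul_eq_zero.1 h1 with rfl | h1
  · rw [zero_add] at hab; subst hab
    simpa using hy' (by simpa using h2)
  · rcases mul_eq_zero.1 h2 with rfl | h2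
    · rw [add_zero] at hab; subst hab
      simpa using hx' (by simpa using h1)
    · exact convex_convexHull ℝ _ (hx' h1) (hy' h2) ha hb hab

/-- The support of a stabiliser vector is an affine subspace. -/
theorem StabLike.affine_support {n : ℕ} {ψ : Q n → ℂ} (h : StabLike ψ) {a b c : Q n}
    (ha : ψ a ≠ 0) (hb : ψ b ≠ 0) (hc : ψ c ≠ 0) : ψ (a + b + c) ≠ 0 := by
  -- If all expectations with shift `a + b` vanished, inverting the character sum over `z` at the
  -- label `a` would give `star (ψ a) * ψ b = 0`.
  obtain ⟨z, hz⟩ : ∃ z : Q n, expect ψ (pauli z (a + b)) ≠ 0 := by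
    by_contra! hcon
    have h1 : ∀ z : Q n, expect ψ (pauli z (a + b)) =
        phase z (a + b) * ∑ y, star (ψ y) * ψ (y + (a + b)) * chi z y := by
      intro z
      simp only [expect, dotProduct, pauli_mulVec, Finset.mul_sum, Pi.star_apply]
      exact Finset.sum_congr rfl fun _ _ => by ring
    have h2 : ∀ z : Q n, ∑ y, star (ψ y) * ψ (y + (a + b)) * chi z y = 0 := by
      intro z
      have := hcon z
      rw [h1] at this
      exact (mul_eq_zero.1 this).resolve_left (phase_ne_zero _ _)
    have h3 : ∑ z : Q n, (∑ y, star (ψ y) * ψ (y + (a + b)) * chi z y) * chi z a = 0 := by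
      simp only [h2, zero_mul, Finset.sum_const_zero]
    simp only [Finset.sum_mul, mul_assoc] at h3
    rw [Finset.sum_comm] at h3
    simp only [← Finset.mul_sum, ← chi_add_right, sum_chi] at h3
    rw [Finset.sum_eq_single a] at h3
    · rw [label_add_self, if_pos rfl, ← add_assoc, label_add_self, zero_add] at h3
      simp [ha, hb] at h3
    · intro y _ hy
      rw [if_neg, mul_zero, mul_zero]
      intro h; apply hy
      rw [← label_add_add_cancel y a, h, zero_add]
    · simp
  have hN : ∃ δ : ℂ, (δ = 1 ∨ δ = -1) ∧ expect ψ (pauli z (a + b)) = δ * (star ψ ⬝ᵥ ψ) := by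
    rcases (h z (a + b)).resolve_left hz with h | h
    · exact ⟨1, Or.inl rfl, by rw [h, one_mul]⟩
    · exact ⟨-1, Or.inr rfl, by rw [h, neg_one_mul]⟩
  obtain ⟨δ, hδ, hδ'⟩ := hN
  -- `ψ` is an eigenvector of a Pauli operator with shift `a + b`, so its amplitudes at `c` and `c +
  -- a + b` have the same modulus.
  have h1 := congrFun (eigen_of_expect hδ hδ') c
  rw [pauli_mulVec, Pi.smul_apply] at h1
  intro h0
  rw [add_comm c, h0, mul_zero] at h1
  rcases hδ with rfl | rfl <;> exact hc (by simpa using h1.symm)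

/-! ### Choi states of CSP maps. -/

/-- The maximally entangled state vector of two pairs of qubits. -/
noncomputable def bellVec : Q (2 + 2) → ℂ := fun x => if fstPart x = sndPart x then 1 / 2 else 0

theorem bellVec_append (x u : Q 2) : bellVec (Fin.append x u) = if x = u then 1 / 2 else 0 := by
  simp [bellVec]

theorem star_bellVec_dotProduct : star bellVec ⬝ᵥ bellVec = 1 := by
  simp only [dotProduct, sum_append, Pi.star_apply, bellVec_append]
  simp [ZMod.card]
  norm_num [map_ofNat]

/-- A Pauli operator has nonzero expectation only if its labels on the two pairs agree; the value is
then `phase * phase`, a sign. -/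
theorem stabLike_bellVec : StabLike bellVec := by
  intro z x
  obtain ⟨z, z', rfl⟩ := exists_append z
  obtain ⟨x, x', rfl⟩ := exists_append x
  rw [star_bellVec_dotProduct]
  have h1 : expect bellVec (pauli (Fin.append z z') (Fin.append x x')) =
      if x = x' then phase z x * phase z' x' * if z + z' = 0 then 1 else 0 else 0 := by
    simp only [expect, dotProduct, pauli_mulVec, sum_append, Pi.star_apply, append_add,
      bellVec_append, chi_append, phase_append]
    have h2 : ∀ a b : Q 2, star (if a = b then (1 / 2 : ℂ) else 0) *
        (phase z x * phase z' x' * (chi z a * chi z' b) * if a + x = b + x' then 1 / 2 else 0) =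
        if a = b then (phase z x * phase z' x') *
          (if x = x' then chi (z + z') a * (1 / 4) else 0) else 0 := by
      intro a b
      by_cases hab : a = b
      · subst hab
        simp only [if_true, add_right_inj, chi_add_left]
        split_ifs
        · simp only [star_div₀, star_one, star_ofNat]; ring
        · simp
      · simp [hab]
    simp only [h2, Finset.sum_ite_eq, Finset.mem_univ, if_true, ← Finset.mul_sum]
    split_ifs with hx hz
    · rw [← Finset.sum_mul]
      rw [Finset.sum_congr rfl fun a _ => chi_comm (z + z') a, sum_chi, if_pos hz]; norm_num
    · rw [← Finset.sum_mul, Finset.sum_congr rfl fun a _ => chi_comm (z + z') a, sum_chi, if_neg hz]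
      simp
    · simp
  rw [h1]
  split_ifs with hx hz
  · right
    have : z = z' := by rw [← label_add_add_cancel z z', hz, zero_add]
    rw [hx, this, phase_mul_self, mul_one]
    exact chi_eq_or z' x'
  · simp
  · simp

/-- The Choi-Jamiolkowski state of a two-qubit superoperator. -/
noncomputable def choi (E : Superop 2 2) : Op (2 + 2) := tensorId 2 E (ketbra bellVec)

theorem choi_append (E : Superop 2 2) (x y u v : Q 2) :
    choi E (Fin.append x u) (Fin.append y v) = (1 / 4) * E (Matrix.single u v 1) x y := by
  rw [choi, tensorId_append]
  have : (Matrix.of fun a b => ketbra bellVec (Fin.append a u) (Fin.append b v)) =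
      (1 / 4 : ℂ) • Matrix.single u v (1 : ℂ) := by
    ext a b
    simp only [Matrix.of_apply, ketbra, Matrix.vecMulVec_apply, Pi.star_apply, bellVec_append,
      Matrix.smul_apply, Matrix.single_apply]
    by_cases ha : a = u <;> by_cases hb : b = v <;> simp [ha, hb, eq_comm (a := u), eq_comm (a := v)]
    norm_num
  rw [this, map_smul, Matrix.smul_apply, smul_eq_mul]

theorem choi_mem_SP {E : Superop 2 2} (hE : E ∈ CSP 2 2) : choi E ∈ SP (2 + 2) :=
  hE 2 _ (subset_convexHull ℝ _
    ⟨_, stabLike_bellVec.isStabilizerVec star_bellVec_dotProduct, rfl⟩)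

theorem choi_injective : Function.Injective choi := by
  intro E F h
  refine LinearMap.ext fun ρ => ?_
  rw [Matrix.matrix_eq_sum_single ρ]
  simp only [map_sum]
  refine Finset.sum_congr rfl fun u _ => Finset.sum_congr rfl fun v _ => ?_
  have h1 : E (Matrix.single u v 1) = F (Matrix.single u v 1) := by
    ext x y
    have h2 := congrFun (congrFun h (Fin.append x u)) (Fin.append y v)
    rw [choi_append, choi_append] at h2
    simpa using h2
  have h3 : Matrix.single u v (ρ u v) = ρ u v • Matrix.single u v (1 : ℂ) := by simp
  rw [h3, map_smul, map_smul, h1]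

/-- Trace preservation is not part of the definition of `CSP`. It follows on basis states because
elements of the polytope have trace one; the input here is `|u⟩` with a reference in state `|00⟩`.
-/
theorem trace_single_of_mem_CSP {E : Superop 2 2} (hE : E ∈ CSP 2 2) (u : Q 2) :
    (E (Matrix.single u u 1)).trace = 1 := by
  have h := hE 2 (ketbra (Pi.single (Fin.append u 0 : Q (2 + 2)) 1)) (subset_convexHull ℝ _
    ⟨_, (stabLike_single _).isStabilizerVec (by simp), rfl⟩)
  have h1 := trace_of_mem_SP h
  refine Eq.trans ?_ h1
  simp only [Matrix.trace, Matrix.diag, sum_append, tensorId_append]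
  refine Finset.sum_congr rfl fun x _ => ?_
  rw [Finset.sum_eq_single 0]
  · have : (Matrix.of fun a b => ketbra (Pi.single (Fin.append u 0 : Q (2 + 2)) 1)
        (Fin.append a 0 : Q (2 + 2)) (Fin.append b 0)) = Matrix.single u u (1 : ℂ) := by
      ext a b
      simp only [Matrix.of_apply, ketbra, Matrix.vecMulVec_apply, Pi.star_apply, Pi.single_apply,
        append_inj, Matrix.single_apply, and_true]
      by_cases ha : a = u <;> by_cases hb : b = u <;>
        simp [ha, hb, eq_comm (a := u)]
    rw [this]
  · intro s _ hs
    have : (Matrix.of fun a b => ketbra (Pi.single (Fin.append u 0 : Q (2 + 2)) 1)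
        (Fin.append a s : Q (2 + 2)) (Fin.append b s)) = (0 : Op 2) := by
      ext a b
      have hne : ∀ c : Q 2, (Fin.append c s : Q (2 + 2)) ≠ Fin.append u 0 := fun c h =>
        hs (append_inj.1 h).2
      simp [ketbra, Matrix.vecMulVec_apply, hne]
    rw [this, map_zero]; rfl
  · simp

/-! ### The face of the Choi state of `Λ`, and extremality. -/

/-- A functional that vanishes on a stabiliser state iff its vector is in the support of the Choi
state of `Λ`. -/
noncomputable def supportFunctional : Op (2 + 2) →ₗ[ℝ] ℝ where
  toFun ρ := ∑ u : Q 2, ∑ x : Q 2, if u = 0 then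
      (ρ (Fin.append x 0) (Fin.append x 0) - ρ (Fin.append x 0) (Fin.append 0 0) -
        ρ (Fin.append 0 0) (Fin.append x 0) + ρ (Fin.append 0 0) (Fin.append 0 0)).re
    else if x = u then 0 else (ρ (Fin.append x u) (Fin.append x u)).re
  map_add' ρ σ := by
    simp only [← Finset.sum_add_distrib]
    refine Finset.sum_congr rfl fun u _ => Finset.sum_congr rfl fun x _ => ?_
    split_ifs <;> simp
    ring
  map_smul' c ρ := by
    simp only [Finset.mul_sum, RingHom.id_apply, smul_eq_mul]
    refine Finset.sum_congr rfl fun u _ => Finset.sum_congr rfl fun x _ => ?_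
    split_ifs <;> simp
    ring

/-- As a sum of squares, it vanishes only if the amplitudes are constant in the block `u = 0` and
confined to `x = u` in the other blocks. -/
theorem supportFunctional_ketbra (ψ : Q (2 + 2) → ℂ) : supportFunctional (ketbra ψ) =
    ∑ u : Q 2, ∑ x : Q 2, if u = 0 then
      Complex.normSq (ψ (Fin.append x 0) - ψ (Fin.append 0 0))
    else if x = u then 0 else Complex.normSq (ψ (Fin.append x u)) := by
  simp only [supportFunctional, LinearMap.coe_mk, AddHom.coe_mk]
  refine Finset.sum_congr rfl fun u _ => Finset.sum_congr rfl fun x _ => ?_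
  split_ifs
  · simp only [ketbra, Matrix.vecMulVec_apply, Pi.star_apply, RCLike.star_def, Complex.normSq_apply,
      Complex.add_re, Complex.sub_re, Complex.mul_re, Complex.conj_re, Complex.conj_im,
      Complex.sub_im]
    ring
  · rfl
  · simp only [ketbra, Matrix.vecMulVec_apply, Pi.star_apply, RCLike.star_def, Complex.normSq_apply,
      Complex.mul_re, Complex.conj_re, Complex.conj_im]
    ring

theorem supportFunctional_ketbra_nonneg (ψ : Q (2 + 2) → ℂ) :
    0 ≤ supportFunctional (ketbra ψ) := by
  rw [supportFunctional_ketbra]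
  refine Finset.sum_nonneg fun u _ => Finset.sum_nonneg fun x _ => ?_
  split_ifs <;> first | exact Complex.normSq_nonneg _ | exact le_rfl

theorem of_supportFunctional_eq_zero {ψ : Q (2 + 2) → ℂ} (h : supportFunctional (ketbra ψ) = 0) :
    (∀ x : Q 2, ψ (Fin.append x 0) = ψ (Fin.append 0 0)) ∧
      ∀ x u : Q 2, u ≠ 0 → x ≠ u → ψ (Fin.append x u) = 0 := by
  have hnn : ∀ u x : Q 2, 0 ≤ if u = 0 then
      Complex.normSq (ψ (Fin.append x 0) - ψ (Fin.append 0 0))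
    else if x = u then 0 else Complex.normSq (ψ (Fin.append x u)) := by
    intro u x
    split_ifs <;> first | exact Complex.normSq_nonneg _ | exact le_rfl
  rw [supportFunctional_ketbra, Finset.sum_eq_zero_iff_of_nonneg
    fun u _ => Finset.sum_nonneg fun x _ => hnn u x] at h
  have h1 : ∀ u x : Q 2, (if u = 0 then
      Complex.normSq (ψ (Fin.append x 0) - ψ (Fin.append 0 0))
    else if x = u then 0 else Complex.normSq (ψ (Fin.append x u))) = 0 := fun u x =>
    (Finset.sum_eq_zero_iff_of_nonneg fun x _ => hnn u x).1 (h u (Finset.mem_univ _)) x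
      (Finset.mem_univ _)
  refine ⟨fun x => ?_, fun x u hu hx => ?_⟩
  · have := h1 0 x
    rw [if_pos rfl] at this
    exact sub_eq_zero.1 (Complex.normSq_eq_zero.1 this)
  · have := h1 u x
    rw [if_neg hu, if_neg hx] at this
    exact Complex.normSq_eq_zero.1 this

/-- The functional that bounds the coherences between the three labels `01`, `10`, `11`. -/
noncomputable def coherenceFunctional : Op (2 + 2) →ₗ[ℝ] ℝ where
  toFun ρ := ∑ u : Q 2, ∑ v : Q 2, if u = 0 ∨ v = 0 then 0 else if u = v then
      (ρ (Fin.append u u) (Fin.append v v)).re else -(ρ (Fin.append u u) (Fin.append v v)).re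
  map_add' ρ σ := by
    simp only [← Finset.sum_add_distrib]
    refine Finset.sum_congr rfl fun u _ => Finset.sum_congr rfl fun x _ => ?_
    split_ifs <;> simp
    ring
  map_smul' c ρ := by
    simp only [Finset.mul_sum, RingHom.id_apply, smul_eq_mul]
    refine Finset.sum_congr rfl fun u _ => Finset.sum_congr rfl fun x _ => ?_
    split_ifs <;> simp

theorem coherenceFunctional_ketbra (ψ : Q (2 + 2) → ℂ) : coherenceFunctional (ketbra ψ) =
    Complex.normSq (ψ (Fin.append ![0, 1] ![0, 1])) +
    Complex.normSq (ψ (Fin.append ![1, 0] ![1, 0])) +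
    Complex.normSq (ψ (Fin.append ![1, 1] ![1, 1])) -
    2 * (ψ (Fin.append ![0, 1] ![0, 1]) * star (ψ (Fin.append ![1, 0] ![1, 0]))).re -
    2 * (ψ (Fin.append ![0, 1] ![0, 1]) * star (ψ (Fin.append ![1, 1] ![1, 1]))).re -
    2 * (ψ (Fin.append ![1, 0] ![1, 0]) * star (ψ (Fin.append ![1, 1] ![1, 1]))).re := by
  have e0 : (![0, 0] : Q 2) = 0 := by decide
  have e1 : (![0, 1] : Q 2) ≠ 0 := by decide
  have e2 : (![1, 0] : Q 2) ≠ 0 := by decide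
  have e3 : (![1, 1] : Q 2) ≠ 0 := by decide
  have e4 : (![0, 1] : Q 2) ≠ ![1, 0] := by decide
  have e5 : (![0, 1] : Q 2) ≠ ![1, 1] := by decide
  have e6 : (![1, 0] : Q 2) ≠ ![1, 1] := by decide
  simp only [coherenceFunctional, LinearMap.coe_mk, AddHom.coe_mk]
  rw [sum_Q2, sum_Q2, sum_Q2, sum_Q2, sum_Q2]
  simp only [e0, e1, e2, e3, e4, e5, e6, e4.symm, e5.symm, e6.symm, true_or, or_true, or_self,
    if_true, if_false]
  simp only [ketbra, Matrix.vecMulVec_apply, Pi.star_apply, RCLike.star_def, Complex.normSq_apply,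
    Complex.mul_re, Complex.conj_re, Complex.conj_im]
  ring

/-- A stabiliser vector in the support of the Choi state of `Λ` is a multiple of `|++,00⟩` or
orthogonal to it, and overlaps with at most two of the vectors `|x,x⟩`. -/
theorem StabLike.coherence_cases {ψ : Q (2 + 2) → ℂ} (h : StabLike ψ)
    (h0 : supportFunctional (ketbra ψ) = 0) :
    (ψ (Fin.append 0 0) = 0 ∨ ∀ u : Q 2, u ≠ 0 → ψ (Fin.append u u) = 0) ∧
    (ψ (Fin.append ![0, 1] ![0, 1]) = 0 ∨ ψ (Fin.append ![1, 0] ![1, 0]) = 0 ∨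
      ψ (Fin.append ![1, 1] ![1, 1]) = 0) := by
  obtain ⟨h1, h2⟩ := of_supportFunctional_eq_zero h0
  have hA : ψ (Fin.append 0 0) = 0 ∨ ∀ u : Q 2, u ≠ 0 → ψ (Fin.append u u) = 0 := by
    by_contra! hcon
    -- The labels `(u, 0)`, `(0, 0)` and `(u, u)` would lie in the support, hence also their sum
    -- `(0, u)`, which is excluded.
    obtain ⟨ha, u, hu, hb⟩ := hcon
    have hx : ψ (Fin.append u 0) ≠ 0 := by rwa [h1]
    have h3 := h.affine_support hx ha hb
    rw [append_add, append_add, add_zero, add_zero, zero_add, label_add_self] at h3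
    exact h3 (h2 _ _ hu hu.symm)
  refine ⟨hA, ?_⟩
  by_contra! hcon
  obtain ⟨hb1, hb2, hb3⟩ := hcon
  have h3 := h.affine_support hb1 hb2 hb3
  rw [append_add, append_add] at h3
  -- Three nonzero amplitudes would put `(00, 00)` into the support, against the first alternative.
  have e : (![0, 1] + ![1, 0] + ![1, 1] : Q 2) = 0 := by decide
  rw [e] at h3
  rcases hA with hA | hA
  · exact h3 hA
  · exact hb1 (hA _ (by decide))

/-- The quadratic form is indefinite in three amplitudes. One of them vanishes here, and the form
becomes `|a - b|²` in the other two. -/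
theorem StabLike.coherence_nonneg {ψ : Q (2 + 2) → ℂ} (h : StabLike ψ)
    (h0 : supportFunctional (ketbra ψ) = 0) : 0 ≤ coherenceFunctional (ketbra ψ) ∧
    (coherenceFunctional (ketbra ψ) = 0 →
      (ψ (Fin.append ![0, 1] ![0, 1]) = 0 ∧
        ψ (Fin.append ![1, 0] ![1, 0]) = ψ (Fin.append ![1, 1] ![1, 1])) ∨
      (ψ (Fin.append ![1, 0] ![1, 0]) = 0 ∧
        ψ (Fin.append ![0, 1] ![0, 1]) = ψ (Fin.append ![1, 1] ![1, 1])) ∨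
      (ψ (Fin.append ![1, 1] ![1, 1]) = 0 ∧
        ψ (Fin.append ![0, 1] ![0, 1]) = ψ (Fin.append ![1, 0] ![1, 0]))) := by
  rw [coherenceFunctional_ketbra]
  have key : ∀ a b : ℂ, Complex.normSq a + Complex.normSq b - 2 * (a * star b).re =
      Complex.normSq (a - b) := fun a b => by
    simp only [Complex.normSq_apply, RCLike.star_def, Complex.mul_re, Complex.conj_re,
      Complex.conj_im, Complex.sub_re, Complex.sub_im]
    ring
  rcases (h.coherence_cases h0).2 with hb | hb | hb
  · simp only [hb, map_zero, zero_mul, Complex.zero_re, mul_zero, sub_zero, zero_add]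
    rw [key]
    exact ⟨Complex.normSq_nonneg _, fun h => Or.inl ⟨trivial, sub_eq_zero.1 (Complex.normSq_eq_zero.1 h)⟩⟩
  · simp only [hb, map_zero, zero_mul, Complex.zero_re, mul_zero, sub_zero, add_zero, star_zero]
    rw [key]
    exact ⟨Complex.normSq_nonneg _,
      fun h => Or.inr (Or.inl ⟨trivial, sub_eq_zero.1 (Complex.normSq_eq_zero.1 h)⟩)⟩
  · simp only [hb, map_zero, Complex.zero_re, mul_zero, sub_zero, add_zero, star_zero]
    rw [key]
    exact ⟨Complex.normSq_nonneg _,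
      fun h => Or.inr (Or.inr ⟨trivial, sub_eq_zero.1 (Complex.normSq_eq_zero.1 h)⟩)⟩

/-- The marginal weight of the label `u` of the second pair of qubits. -/
def marginal (ρ : Op (2 + 2)) (u : Q 2) : ℂ := ∑ x : Q 2, ρ (Fin.append x u) (Fin.append x u)

/-- The entries of a state on the face of the Choi state of `Λ` in terms of its marginal. -/
noncomputable def faceEntry (D : Q 2 → ℂ) (x u y v : Q 2) : ℂ :=
  if u = 0 ∧ v = 0 then D 0 / 4 else if u = 0 ∨ v = 0 then 0 else if x ≠ u ∨ y ≠ v then 0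
  else if u = v then D u else (D u + D v - D (u + v)) / 2

/-- Among the three amplitudes one is zero and the other two are equal. So `(D u + D v - D (u + v))
/ 2` is their common squared modulus if `u`, `v` are the two equal ones, and zero otherwise. The
formula is linear in `D`, so it extends to mixtures. -/
theorem StabLike.eq_faceEntry {ψ : Q (2 + 2) → ℂ} (h : StabLike ψ)
    (h0 : supportFunctional (ketbra ψ) = 0) (h0' : coherenceFunctional (ketbra ψ) = 0)
    (x u y v : Q 2) : ketbra ψ (Fin.append x u) (Fin.append y v) =
      faceEntry (marginal (ketbra ψ)) x u y v := by
  obtain ⟨h1, h2⟩ := of_supportFunctional_eq_zero h0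
  have hk : ∀ a b, ketbra ψ a b = ψ a * star (ψ b) := fun a b => rfl
  have hD : ∀ u : Q 2, u ≠ 0 → marginal (ketbra ψ) u =
      ψ (Fin.append u u) * star (ψ (Fin.append u u)) := by
    intro u hu
    rw [marginal, Finset.sum_eq_single u]
    · rfl
    · intro x _ hx; rw [hk, h2 x u hu hx, zero_mul]
    · simp
  have hD0 : marginal (ketbra ψ) 0 = 4 * (ψ (Fin.append 0 0) * star (ψ (Fin.append 0 0))) := by
    rw [marginal]
    simp only [hk, h1, Finset.sum_const, nsmul_eq_mul]
    simp [ZMod.card]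
  have hne : ∀ u v : Q 2, u ≠ v → u + v ≠ 0 := fun u v huv h => huv (by
    rw [← label_add_add_cancel u v, h, zero_add])
  rw [hk, faceEntry]
  split_ifs with c1 c2 c3 c4
  · rw [c1.1, c1.2, h1 x, h1 y, hD0]; ring
  · have hA := (h.coherence_cases h0).1
    have aux : ∀ x v : Q 2, v ≠ 0 → ψ (Fin.append 0 0) = 0 ∨ ψ (Fin.append x v) = 0 := by
      intro x v hv
      by_cases hx : x = v
      · subst hx; exact hA.imp_right fun h => h _ hv
      · exact Or.inr (h2 x v hv hx)
    by_cases hu : u = 0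
    · have hv : v ≠ 0 := fun h => c1 ⟨hu, h⟩
      rw [hu, h1]
      rcases aux y v hv with h | h <;> simp [h]
    · have hv : v = 0 := c2.resolve_left hu
      rw [hv, h1]
      rcases aux x u hu with h | h <;> simp [h]
  · push Not at c2
    rcases c3 with c3 | c3
    · rw [h2 x u c2.1 c3, zero_mul]
    · rw [h2 y v c2.2 c3, star_zero, mul_zero]
  · push Not at c2 c3
    rw [hD u c2.1, c3.1, c3.2, c4]
  · push Not at c2 c3
    rw [hD u c2.1, hD v c2.2, hD (u + v) (hne u v c4), c3.1, c3.2]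
    have hc := (h.coherence_nonneg h0).2 h0'
    obtain ⟨hu, hv⟩ := c2
    clear c3 c1 hD hD0 hk h1 h2 h0 h0'
    have t1 : (![0, 1] + ![1, 0] : Q 2) = ![1, 1] := by decide
    have t2 : (![0, 1] + ![1, 1] : Q 2) = ![1, 0] := by decide
    have t3 : (![1, 0] + ![1, 1] : Q 2) = ![0, 1] := by decide
    have e0 : (![0, 0] : Q 2) = 0 := by decide
    revert u v
    rw [forall_Q2]
    refine ⟨?_, ?_, ?_, ?_⟩ <;> rw [forall_Q2] <;> refine ⟨?_, ?_, ?_, ?_⟩ <;> intro huv hu hv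
    all_goals first | exact absurd rfl huv | exact absurd e0 hu | exact absurd e0 hv | skip
    all_goals
      simp only [t1, t2, t3, add_comm (![1, 0] : Q 2) ![0, 1], add_comm (![1, 1] : Q 2) ![0, 1],
        add_comm (![1, 1] : Q 2) ![1, 0]]
      rcases hc with ⟨h1, h2⟩ | ⟨h1, h2⟩ | ⟨h1, h2⟩ <;> rw [h1, h2] <;> simp

/-- The face of the stabiliser polytope that contains the Choi state of `Λ`. -/
theorem eq_faceEntry_of_mem_SP {ρ : Op (2 + 2)} (hρ : ρ ∈ SP (2 + 2))
    (h0 : supportFunctional ρ = 0) (h0' : coherenceFunctional ρ = 0) (x u y v : Q 2) :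
    ρ (Fin.append x u) (Fin.append y v) = faceEntry (marginal ρ) x u y v := by
  have h1 := (mem_convexHull_zero_face supportFunctional (fun a ha => by
    obtain ⟨ψ, -, rfl⟩ := ha; exact supportFunctional_ketbra_nonneg ψ) hρ).2 h0
  have h2 := (mem_convexHull_zero_face coherenceFunctional (fun a ha => by
    obtain ⟨⟨ψ, hψ, rfl⟩, ha⟩ := ha; exact (hψ.stabLike.coherence_nonneg ha).1) h1).2 h0'
  refine convexHull_min (t := {ρ : Op (2 + 2) | ρ (Fin.append x u) (Fin.append y v) =
    faceEntry (marginal ρ) x u y v}) ?_ ?_ h2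
  · rintro _ ⟨⟨⟨ψ, hψ, rfl⟩, ha⟩, ha'⟩
    exact hψ.stabLike.eq_faceEntry ha ha' x u y v
  · intro ρ hρ σ hσ a b _ _ _
    have hm : ∀ w, marginal (a • ρ + b • σ) w = a * marginal ρ w + b * marginal σ w := by
      intro w
      simp only [marginal, Matrix.add_apply, Matrix.smul_apply, Finset.sum_add_distrib,
        Finset.mul_sum, Complex.real_smul]
    change (a • ρ + b • σ) (Fin.append x u) (Fin.append y v) =
      faceEntry (marginal (a • ρ + b • σ)) x u y v
    rw [Matrix.add_apply, Matrix.smul_apply, Matrix.smul_apply, hρ, hσ, Complex.real_smul,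
      Complex.real_smul]
    simp only [faceEntry, hm]
    split_ifs <;> ring

theorem marginal_choi {E : Superop 2 2} (hE : E ∈ CSP 2 2) (u : Q 2) :
    marginal (choi E) u = 1 / 4 := by
  simp only [marginal, choi_append, ← Finset.mul_sum]
  have := trace_single_of_mem_CSP hE u
  rw [Matrix.trace] at this
  simp only [Matrix.diag] at this
  rw [this, mul_one]

theorem supportFunctional_choi_Lam : supportFunctional (choi Lam) = 0 := by
  have h0 : ∀ x y : Q 2, Lam (Matrix.single 0 0 1) x y = 1 / 4 := by
    intro x y
    rw [Lam_apply]
    split_ifs with h1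
    · simp
    · push Not at h1; simp [h1.1.symm]
    · push Not at h1; simp [h1.1.symm]
  have h1 : ∀ u x : Q 2, u ≠ 0 → x ≠ u → Lam (Matrix.single u u 1) x x = 0 := by
    intro u x hu hx
    rw [Lam_apply]
    simp [hu, hx.symm]
  simp only [supportFunctional, LinearMap.coe_mk, AddHom.coe_mk, choi_append, h0]
  refine Finset.sum_eq_zero fun u _ => Finset.sum_eq_zero fun x _ => ?_
  split_ifs with hu hx
  · simp
  · rfl
  · rw [h1 u x hu hx]; simp

/-- The balance is `3 · 1/4 - 6 · 1/8 = 0`. -/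
theorem coherenceFunctional_choi_Lam : coherenceFunctional (choi Lam) = 0 := by
  have h : ∀ u v : Q 2, (if u = 0 ∨ v = 0 then 0 else if u = v then
      (choi Lam (Fin.append u u) (Fin.append v v)).re
      else -(choi Lam (Fin.append u u) (Fin.append v v)).re) =
      if u = 0 ∨ v = 0 then 0 else if u = v then (1 / 4 : ℝ) else -(1 / 8) := by
    intro u v
    split_ifs with c1 c2
    · rfl
    · rw [choi_append, Lam_apply, if_neg c1, if_pos c2, c2]
      push Not at c1
      simp [c1.2]
    · rw [choi_append, Lam_apply, if_neg c1, if_neg c2]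
      push Not at c1
      simp [c1.1, c1.2]
      norm_num
  simp only [coherenceFunctional, LinearMap.coe_mk, AddHom.coe_mk, h]
  rw [sum_Q2, sum_Q2, sum_Q2, sum_Q2, sum_Q2]
  simp +decide only [if_true, if_false]
  norm_num

theorem choi_combination (a b : ℝ) (E F : Superop 2 2) :
    choi (a • E + b • F) = a • choi E + b • choi F := by
  rw [choi, tensorId_add, tensorId_smul, tensorId_smul]; rfl

theorem supportFunctional_nonneg {ρ : Op (2 + 2)} (hρ : ρ ∈ SP (2 + 2)) :
    0 ≤ supportFunctional ρ :=
  (mem_convexHull_zero_face supportFunctional (fun a ha => by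
    obtain ⟨ψ, -, rfl⟩ := ha; exact supportFunctional_ketbra_nonneg ψ) hρ).1

theorem coherenceFunctional_nonneg {ρ : Op (2 + 2)} (hρ : ρ ∈ SP (2 + 2))
    (h0 : supportFunctional ρ = 0) : 0 ≤ coherenceFunctional ρ :=
  (mem_convexHull_zero_face coherenceFunctional (fun a ha => by
    obtain ⟨⟨ψ, hψ, rfl⟩, ha⟩ := ha; exact (hψ.stabLike.coherence_nonneg ha).1)
    ((mem_convexHull_zero_face supportFunctional (fun a ha => by
    obtain ⟨ψ, -, rfl⟩ := ha; exact supportFunctional_ketbra_nonneg ψ) hρ).2 h0)).1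

theorem Lam_mem_extremePoints : Lam ∈ Set.extremePoints ℝ (CSP 2 2) := by
  -- On this face the Choi state is a function of its marginal, which is `1/4` at every label for
  -- every CSP map.
  have uniq : ∀ E ∈ CSP 2 2, supportFunctional (choi E) = 0 → coherenceFunctional (choi E) = 0 →
      E = Lam := by
    intro E hE h0 h0'
    apply choi_injective
    ext a b
    obtain ⟨x, u, rfl⟩ := exists_append a
    obtain ⟨y, v, rfl⟩ := exists_append b
    rw [eq_faceEntry_of_mem_SP (choi_mem_SP hE) h0 h0',
      eq_faceEntry_of_mem_SP (choi_mem_SP Lam_mem_CSP) supportFunctional_choi_Lam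
        coherenceFunctional_choi_Lam]
    congr 1
    ext w
    rw [marginal_choi hE, marginal_choi Lam_mem_CSP]
  rw [mem_extremePoints]
  refine ⟨Lam_mem_CSP, fun E hE F hF hL => ?_⟩
  obtain ⟨a, b, ha, hb, -, hab⟩ := hL
  have hs := supportFunctional_choi_Lam
  have hc := coherenceFunctional_choi_Lam
  rw [← hab, choi_combination, map_add, map_smul, map_smul, smul_eq_mul, smul_eq_mul] at hs hc
  have hE0 := supportFunctional_nonneg (choi_mem_SP hE)
  have hF0 := supportFunctional_nonneg (choi_mem_SP hF)
  have split : ∀ p q : ℝ, 0 ≤ p → 0 ≤ q → a * p + b * q = 0 → p = 0 ∧ q = 0 := by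
    intro p q hp hq h
    have h1 : a * p = 0 := by nlinarith [mul_nonneg ha.le hp, mul_nonneg hb.le hq]
    have h2 : b * q = 0 := by linarith
    exact ⟨(mul_eq_zero.1 h1).resolve_left ha.ne', (mul_eq_zero.1 h2).resolve_left hb.ne'⟩
  obtain ⟨hE1, hF1⟩ := split _ _ hE0 hF0 hs
  -- The order matters: the coherence functional is known to be nonnegative only where the support
  -- functional vanishes.
  obtain ⟨hE2, hF2⟩ := split _ _ (coherenceFunctional_nonneg (choi_mem_SP hE) hE1)
    (coherenceFunctional_nonneg (choi_mem_SP hF) hF1) hc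
  exact ⟨uniq E hE hE1 hE2, uniq F hF hF1 hF2⟩

/-! ### `Λ` has no Clifford dilation. -/

theorem trace_mul_discard {n k : ℕ} (A : Op n) (M : Op (n + k)) :
    (A * (discard M : Op n)).trace = (kron A 1 * M).trace := by
  simp only [Matrix.trace, Matrix.diag, sum_append, kron_one_mul_apply]
  simp only [Matrix.mul_apply, discard_apply, Finset.mul_sum]
  exact Finset.sum_congr rfl fun _ _ => Finset.sum_comm

theorem pauli_apply_self {n : ℕ} (z x y : Q n) : pauli z x y y = chi z y * pauli z x 0 0 := by
  have e : ∀ y : Q n, y = y + x ↔ x = 0 := fun y => by rw [left_eq_add]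
  rw [pauli_apply, pauli_apply]
  simp only [e]
  split_ifs
  · rw [chi_zero_right]; ring
  · simp

/-- Pull the observable `Z` on the first qubit back through the dilation. It becomes a scalar times
a Pauli operator, so its expectations after the inputs `|00⟩` and `|01⟩` agree up to the sign `chi`.
For `Λ` they are 0 and 1. -/
theorem Lam_not_hasCliffordDilation : ¬ HasCliffordDilation Lam := by
  rintro ⟨k, σ, U, -, hU, hE⟩
  obtain ⟨c, z, x, -, hc⟩ := mem_pauliGroup_iff.1 ((isClifford_iff.1 hU).2.2 _
    (kron_mem_pauliGroup (pauli_mem (![1, 0] : Q 2) 0) (one_mem_pauliGroup (n := k))))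
  have h1 : ∀ y : Q 2, (pauli ![1, 0] 0 * Lam (Matrix.single y y 1)).trace =
      chi (fstPart z) y * (c * pauli (fstPart z) (fstPart x) 0 0 *
        (pauli (sndPart z) (sndPart x) * σ).trace) := by
    intro y
    rw [hE, trace_mul_discard, conj_apply, ← Matrix.mul_assoc, Matrix.trace_mul_comm,
      ← Matrix.mul_assoc, ← Matrix.mul_assoc, hc, Matrix.smul_mul, Matrix.trace_smul,
      pauli_eq_kron, prepare_apply, kron_mul, trace_kron]
    have : (pauli (fstPart z) (fstPart x) * Matrix.single y y 1).trace =
        pauli (fstPart z) (fstPart x) y y := by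
      rw [Matrix.trace_mul_comm, Matrix.trace_single_mul, smul_eq_mul, one_mul]
    rw [this, pauli_apply_self, smul_eq_mul]
    ring
  have h2 : ∀ y : Q 2, (pauli ![1, 0] 0 * Lam (Matrix.single y y 1)).trace =
      ∑ u : Q 2, chi ![1, 0] u * Lam (Matrix.single y y 1) u u := by
    intro y
    refine Finset.sum_congr rfl fun u _ => ?_
    have h : (pauli ![1, 0] 0 * Lam (Matrix.single y y 1)) u u =
      (pauli ![1, 0] 0 *ᵥ fun v => Lam (Matrix.single y y 1) v u) u := rfl
    rw [Matrix.diag, h, pauli_mulVec, add_zero, phase_zero_right, one_mul]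
  have h3 := h1 0
  have h4 := h1 ![0, 1]
  have e0 : (![0, 0] : Q 2) = 0 := by decide
  have e1 : (![0, 1] : Q 2) ≠ 0 := by decide
  have e2 : (![1, 0] : Q 2) ≠ 0 := by decide
  have e3 : (![1, 1] : Q 2) ≠ 0 := by decide
  have e4 : (![0, 1] : Q 2) ≠ ![1, 0] := by decide
  have e5 : (![0, 1] : Q 2) ≠ ![1, 1] := by decide
  rw [h2, sum_Q2, chi_zero_right, one_mul] at h3
  rw [h2, sum_Q2] at h4
  simp only [Lam_apply, Matrix.single_apply, e0, e1, e2, e3, e4, e5, e1.symm, e2.symm, e3.symm,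
    chi_Q2, ZMod.val_zero, val_one_ZMod_two, or_self, and_self, if_true, if_false,
    chi_zero_right] at h3 h4
  norm_num at h3 h4
  rcases h3 with (h3 | h3) | h3 <;> simp [h3] at h4

/-! ### The normal form of measurement-free operations. -/

/-- Measurement-free stabiliser operations, in a normal form: prepare an ancilla, apply a Clifford
unitary, relabel the qubits and discard some of them. -/
def IsDilated {n m : ℕ} (E : Superop n m) : Prop :=
  ∃ (k j : ℕ) (e : Fin (n + k) ≃ Fin (m + j)) (φ : Q k → ℂ) (U : Op (n + k)),
    IsStabilizerVec φ ∧ IsClifford U ∧ E = discard ∘ₗ rx e ∘ₗ conj U ∘ₗ prepare (ketbra φ)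

theorem isDilated_id {n : ℕ} : IsDilated (LinearMap.id : Superop n n) := by
  refine ⟨0, 0, Equiv.refl _, Pi.single 0 1, 1, (stabLike_single 0).isStabilizerVec (by simp),
    isClifford_one, ?_⟩
  rw [conj_one, rx_refl, LinearMap.id_comp, LinearMap.id_comp]
  refine LinearMap.ext fun ρ => ?_
  ext x y
  rw [LinearMap.comp_apply, discard_apply, Fintype.sum_unique]
  have h : ∀ a b : Q 0, ketbra (Pi.single (0 : Q 0) (1 : ℂ)) a b = 1 := by
    intro a b
    rw [Subsingleton.elim a 0, Subsingleton.elim b 0, ketbra, Matrix.vecMulVec_apply, Pi.star_apply,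
      Pi.single_eq_same, star_one, mul_one]
  rw [prepare_apply, kron_apply, fstPart_append, fstPart_append, sndPart_append, sndPart_append, h,
    mul_one]
  rfl

theorem IsDilated.conj_comp {n m : ℕ} {E : Superop n m} (h : IsDilated E) {V : Op m}
    (hV : IsClifford V) : IsDilated (conj V ∘ₗ E) := by
  obtain ⟨k, j, e, φ, U, hφ, hU, rfl⟩ := h
  refine ⟨k, j, e, φ, rx e.symm (kron V 1) * U, hφ, ((hV.kron_one j).rx e.symm).mul hU, ?_⟩
  rw [← LinearMap.comp_assoc, conj_comp_discard, LinearMap.comp_assoc,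
    ← LinearMap.comp_assoc _ _ (conj (kron V 1)), conj_comp_rx, LinearMap.comp_assoc,
    ← LinearMap.comp_assoc _ _ (conj (rx e.symm (kron V 1))), conj_comp_conj]

theorem IsDilated.prepare_comp {n m l : ℕ} {E : Superop n m} (h : IsDilated E) {τ : Op l}
    (hτ : τ ∈ STAB l) : IsDilated (prepare τ ∘ₗ E) := by
  obtain ⟨k, j, e, φ, U, hφ, hU, rfl⟩ := h
  obtain ⟨χ, hχ, rfl⟩ := hτ
  -- The new ancilla is moved to the start of the protocol: past the discarded qubits, past the
  -- relabelling and, after passing `U`, into one register with the old ancilla.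
  obtain ⟨f, hf⟩ := prepare_comp_discard m j l (ketbra χ)
  obtain ⟨g, hg⟩ := prepare_comp_rx e (ketbra χ)
  obtain ⟨s, hs⟩ := prepare_comp_prepare n (ketbra φ) (ketbra χ)
  refine ⟨k + l, j, s.trans (g.trans f), tensVec φ χ, rx s.symm (kron U 1),
    (hφ.stabLike.tens hχ.stabLike).isStabilizerVec ?_, (hU.kron_one l).rx s.symm, ?_⟩
  · rw [star_tensVec_dotProduct, hφ.1, hχ.1, one_mul]
  · have h1 : prepare (ketbra χ) ∘ₗ rx e ∘ₗ conj U ∘ₗ prepare (ketbra φ) =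
        rx (s.trans g) ∘ₗ conj (rx s.symm (kron U 1)) ∘ₗ prepare (ketbra (tensVec φ χ)) := by
      rw [← LinearMap.comp_assoc, hg, LinearMap.comp_assoc, ← LinearMap.comp_assoc _ _ (prepare _),
        prepare_comp_conj, LinearMap.comp_assoc, hs, ← LinearMap.comp_assoc _ _ (conj _), conj_comp_rx,
        ketbra_tensVec]
      rfl
    rw [← LinearMap.comp_assoc, hf, LinearMap.comp_assoc, LinearMap.comp_assoc, h1]
    rfl

theorem IsDilated.discard_comp {n m l : ℕ} {E : Superop n (m + l)} (h : IsDilated E) :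
    IsDilated ((discard : Superop (m + l) m) ∘ₗ E) := by
  obtain ⟨k, j, e, φ, U, hφ, hU, rfl⟩ := h
  obtain ⟨f, hf⟩ := discard_comp_discard m l j
  refine ⟨k, l + j, e.trans f, φ, U, hφ, hU, ?_⟩
  rw [← LinearMap.comp_assoc, hf]
  rfl

/-- The permutation matrix of the labels does it. Hence the relabelling in `IsDilated` can be
absorbed into the Clifford unitary. -/
theorem exists_clifford_rx {n : ℕ} (e : Fin n ≃ Fin n) :
    ∃ P : Op n, IsClifford P ∧ rx e = conj P := by
  let P : Op n := Matrix.of fun x y => if x ∘ e = y then 1 else 0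
  have h : ∀ ρ : Op n, P * ρ * Pᴴ = rx e ρ := by
    intro ρ
    ext x y
    rw [rx_apply, Matrix.mul_apply]
    simp only [Matrix.mul_apply, Matrix.conjTranspose_apply, P, Matrix.of_apply]
    simp
  have h1 : P * Pᴴ = 1 := by simpa [rx_one] using h 1
  have h2 : Pᴴ * P = 1 := mul_eq_one_comm.1 h1
  refine ⟨P, isClifford_iff.2 ⟨h2, fun M hM => ?_, fun M hM => ?_⟩, LinearMap.ext fun ρ => (h ρ).symm⟩
  · rw [h]; exact rx_mem_pauliGroup e hM
  · have h3 : Pᴴ * M * P = rx e.symm M := by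
      conv_lhs => rw [← rx_symm_apply e M, ← h]
      rw [show Pᴴ * (P * rx e.symm M * Pᴴ) * P = (Pᴴ * P) * rx e.symm M * (Pᴴ * P) by
        simp only [Matrix.mul_assoc], h2, one_mul, mul_one]
    rw [h3]; exact rx_mem_pauliGroup e.symm hM

theorem IsStabilizerOp.comp {n m l : ℕ} {E : Superop n m} (hE : IsStabilizerOp E)
    {O : Superop m l} (hO : IsStabilizerOp O) : IsStabilizerOp (O ∘ₗ E) := by
  induction hE with
  | id => exact hO
  | prepare σ hσ E hE ih => exact .prepare σ hσ _ (ih hO)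
  | clifford U hU E hE ih => exact .clifford U hU _ (ih hO)
  | measure z x E₁ E₂ h₁ h₂ ih₁ ih₂ =>
    rw [LinearMap.comp_add]
    exact .measure z x _ _ (ih₁ hO) (ih₂ hO)
  | discard E hE ih => exact .discard _ (ih hO)
  | random p hp₀ hp₁ E₁ E₂ h₁ h₂ ih₁ ih₂ =>
    rw [LinearMap.comp_add, LinearMap.comp_smul, LinearMap.comp_smul]
    exact .random p hp₀ hp₁ _ _ (ih₁ hO) (ih₂ hO)

theorem isStabilizerOp_rx {n m : ℕ} (e : Fin n ≃ Fin m) : IsStabilizerOp (rx e) := by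
  obtain rfl : n = m := by simpa using Fintype.card_congr e
  obtain ⟨P, hP, h⟩ := exists_clifford_rx e
  rw [h]
  exact .clifford P hP _ .id

theorem IsDilated.isStabilizerOp {n m : ℕ} {E : Superop n m} (h : IsDilated E) :
    IsStabilizerOp E := by
  obtain ⟨k, j, e, φ, U, hφ, hU, rfl⟩ := h
  exact .prepare _ ⟨φ, hφ, rfl⟩ _ (.clifford U hU _ ((isStabilizerOp_rx e).comp (.discard _ .id)))

theorem IsDilated.hasCliffordDilation {n : ℕ} {E : Superop n n} (h : IsDilated E) :
    HasCliffordDilation E := by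
  obtain ⟨k, j, e, φ, U, hφ, hU, rfl⟩ := h
  -- Input and output have equally many qubits, so as many are discarded as were prepared.
  obtain rfl : k = j := by simpa using Fintype.card_congr e
  obtain ⟨P, hP, h⟩ := exists_clifford_rx e
  refine ⟨k, ketbra φ, P * U, ⟨φ, hφ, rfl⟩, hP.mul hU, fun ρ => ?_⟩
  rw [h, ← conj_comp_conj]
  rfl

theorem convex_SO (n m : ℕ) : Convex ℝ (SO n m) := by
  intro E hE F hF a b ha hb hab
  obtain rfl : b = 1 - a := by linarith
  exact IsStabilizerOp.random a ha (by linarith) E F hE hF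

/-! ### Pauli measurements after a measurement-free operation. -/

theorem ketbra_conjTranspose {n : ℕ} (φ : Q n → ℂ) : (ketbra φ)ᴴ = ketbra φ := by
  ext x y
  simp [ketbra, Matrix.vecMulVec_apply, mul_comm]

theorem ketbra_mul_self {n : ℕ} {φ : Q n → ℂ} (h : star φ ⬝ᵥ φ = 1) :
    ketbra φ * ketbra φ = ketbra φ := by
  rw [ketbra, Matrix.vecMulVec_mul_vecMulVec, h, one_smul]

theorem mul_ketbra_of_eigen {n : ℕ} {φ : Q n → ℂ} {A : Op n} {c : ℂ} (h : A *ᵥ φ = c • φ) :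
    A * ketbra φ = c • ketbra φ := by
  rw [ketbra, Matrix.mul_vecMulVec, h, Matrix.smul_vecMulVec]

/-- After the preparation of an ancilla, operators that act in the same way on the ancilla state
are equivalent. -/
theorem conj_comp_prepare_congr {n k : ℕ} {φ : Q k → ℂ} (hφ : star φ ⬝ᵥ φ = 1) {A B : Op (n + k)}
    (h : A * kron 1 (ketbra φ) = B * kron 1 (ketbra φ)) :
    conj A ∘ₗ (prepare (ketbra φ) : Superop n (n + k)) = conj B ∘ₗ prepare (ketbra φ) := by
  have aux : ∀ (C : Op (n + k)) (ρ : Op n), conj C (prepare (ketbra φ) ρ) =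
      (C * kron 1 (ketbra φ)) * kron ρ 1 * (C * kron 1 (ketbra φ))ᴴ := by
    intro C ρ
    have h1 : kron ρ (ketbra φ) = kron 1 (ketbra φ) * kron ρ 1 * kron 1 (ketbra φ) := by
      rw [kron_mul, kron_mul, one_mul, mul_one, mul_one, ketbra_mul_self hφ]
    rw [Matrix.conjTranspose_mul, kron_conjTranspose, ketbra_conjTranspose,
      Matrix.conjTranspose_one, conj_apply, prepare_apply, h1]
    simp only [Matrix.mul_assoc]
  refine LinearMap.ext fun ρ => ?_
  rw [LinearMap.comp_apply, LinearMap.comp_apply, aux, aux, h]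

/-- The quarter rotation generated by an anti-Hermitian Pauli group element. -/
theorem isClifford_rotation {n : ℕ} {T : Op n} (hT : T ∈ pauliGroup n) (hT' : Tᴴ = -T) :
    IsClifford ((1 / (Real.sqrt 2 : ℂ)) • (1 + T)) := by
  have hs : (1 / (Real.sqrt 2 : ℂ)) * star (1 / (Real.sqrt 2 : ℂ)) = 1 / 2 := by
    rw [star_div₀, star_one, RCLike.star_def, Complex.conj_ofReal, div_mul_div_comm,
      ← Complex.ofReal_mul, Real.mul_self_sqrt (by norm_num)]
    norm_num
  have hT2 : T * T = -1 := by
    have := mul_conjTranspose_of_mem_pauliGroup hT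
    rw [hT', mul_neg] at this
    rw [← this, neg_neg]
  -- A commuting `M` is fixed, and an anticommuting `M` is sent to `T * M`; both stay in the Pauli
  -- group.
  have key : ∀ T : Op n, T ∈ pauliGroup n → T * T = -1 → ∀ M ∈ pauliGroup n,
      (1 / 2 : ℂ) • ((1 + T) * M * (1 - T)) ∈ pauliGroup n := by
    intro T hT hT2 M hM
    have hcomm : T * M = M * T ∨ T * M = -(M * T) := by
      obtain ⟨c, z, x, -, rfl⟩ := mem_pauliGroup_iff.1 hT
      obtain ⟨d, z', x', -, rfl⟩ := mem_pauliGroup_iff.1 hM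
      rw [smul_mul_smul_comm, smul_mul_smul_comm, pauli_mul_comm, mul_comm d c]
      rcases omega_eq_or z x z' x' with h | h <;> rw [h] <;> simp
    rcases hcomm with h | h
    · have : (1 + T) * M * (1 - T) = (2 : ℂ) • M := by
        rw [add_mul, one_mul, h, mul_sub, mul_one, add_mul, Matrix.mul_assoc M T T, hT2, mul_neg,
          mul_one, two_smul]
        abel
      rw [this, smul_smul]
      norm_num
      exact hM
    · have : (1 + T) * M * (1 - T) = (2 : ℂ) • (T * M) := by
        have h2 : M * T = -(T * M) := by rw [h, neg_neg]
        rw [add_mul, one_mul, mul_sub, mul_one, add_mul, h2, Matrix.mul_assoc T M T, h2, mul_neg,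
          ← Matrix.mul_assoc, hT2, neg_mul, one_mul, two_smul]
        abel
      rw [this, smul_smul]
      norm_num
      exact mul_mem_pauliGroup hT hM
  have e1 : ((1 / (Real.sqrt 2 : ℂ)) • (1 + T))ᴴ = star (1 / (Real.sqrt 2 : ℂ)) • (1 - T) := by
    rw [Matrix.conjTranspose_smul, Matrix.conjTranspose_add, Matrix.conjTranspose_one, hT',
      sub_eq_add_neg]
  refine isClifford_iff.2 ⟨?_, fun M hM => ?_, fun M hM => ?_⟩
  · rw [e1, smul_mul_smul_comm, mul_comm (star _), hs]
    have : (1 - T) * (1 + T) = (2 : ℂ) • 1 := by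
      rw [sub_mul, one_mul, mul_add, mul_one, hT2, two_smul]; abel
    rw [this, smul_smul]; norm_num
  · rw [e1, smul_mul_assoc, smul_mul_smul_comm, hs]
    exact key T hT hT2 M hM
  · rw [e1, smul_mul_assoc, smul_mul_smul_comm, mul_comm (star _), hs]
    have := key (-T) (by simpa using smul_mem_pauliGroup (c := -1) (by norm_num) hT)
      (by rw [neg_mul_neg, hT2]) M hM
    rwa [← sub_eq_add_neg, sub_neg_eq_add] at this

/-- Let `P = pauli z x`. If it commuted with everything that stabilises `φ` up to sign, `Pφ` and `φ`
would have the same Pauli expectations. Then `sum_expect_pauli` would give `|⟨φ|P|φ⟩| = 1`, while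
this expectation is zero. -/
theorem exists_anticommuting_of_expect_eq_zero {n : ℕ} {φ : Q n → ℂ} (hφ : IsStabilizerVec φ)
    {z x : Q n} (h : expect φ (pauli z x) = 0) : ∃ (z' x' : Q n) (θ : ℂ), (θ = 1 ∨ θ = -1) ∧
      pauli z' x' *ᵥ φ = θ • φ ∧ omega z x z' x' = -1 := by
  by_contra! hcon
  have hS := hφ.stabLike
  have h1 : ∀ p : Q n × Q n, expect (pauli z x *ᵥ φ) (pauli p.1 p.2) =
      expect φ (pauli p.1 p.2) := by
    rintro ⟨z', x'⟩
    have hw : expect (pauli z x *ᵥ φ) (pauli z' x') =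
        omega z x z' x' * expect φ (pauli z' x') := by
      rw [expect_mulVec, pauli_conjTranspose, pauli_mul_comm, smul_mul_assoc, Matrix.mul_assoc,
        pauli_mul_self, mul_one, expect_smul]
    rw [hw]
    by_cases h0 : expect φ (pauli z' x') = 0
    · simp [h0]
    · obtain ⟨θ, hθ, hθ'⟩ : ∃ θ : ℂ, (θ = 1 ∨ θ = -1) ∧
          expect φ (pauli z' x') = θ * (star φ ⬝ᵥ φ) := by
        rcases (hS z' x').resolve_left h0 with h | h
        · exact ⟨1, Or.inl rfl, by rw [h, one_mul]⟩
        · exact ⟨-1, Or.inr rfl, by rw [h, neg_one_mul]⟩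
      have h2 := hcon z' x' θ hθ (eigen_of_expect hθ hθ')
      rw [(omega_eq_or z x z' x').resolve_right h2, one_mul]
  have h2 := sum_expect_pauli φ (pauli z x *ᵥ φ)
  have h3 := sum_expect_pauli φ φ
  simp only [h1] at h2
  rw [h3, star_mulVec_dotProduct, pauli_conjTranspose, hφ.1] at h2
  change (2 : ℂ) ^ n * (1 * star 1) = 2 ^ n * (expect φ (pauli z x) * _) at h2
  rw [h] at h2
  simp at h2

/-- A Pauli measurement after the preparation of a stabiliser ancilla either has a random outcome
and acts as one of two Clifford unitaries, or amounts to a Pauli measurement of the input. -/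
theorem measure_comp_prepare {n k : ℕ} {φ : Q k → ℂ} (hφ : IsStabilizerVec φ) (z x : Q (n + k)) :
    (∀ η : ℂ, (η = 1 ∨ η = -1) → ∃ C : Op (n + k), IsClifford C ∧
      conj ((1 / 2 : ℂ) • (1 + η • pauli z x)) ∘ₗ (prepare (ketbra φ) : Superop n (n + k)) =
        (1 / 2 : ℝ) • (conj C ∘ₗ prepare (ketbra φ))) ∨
    ∃ γ : ℂ, (γ = 1 ∨ γ = -1) ∧ ∀ η : ℂ,
      conj ((1 / 2 : ℂ) • (1 + η • pauli z x)) ∘ₗ (prepare (ketbra φ) : Superop n (n + k)) =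
        prepare (ketbra φ) ∘ₗ
          conj ((1 / 2 : ℂ) • (1 + (η * γ) • pauli (fstPart z) (fstPart x))) := by
  by_cases h : expect φ (pauli (sndPart z) (sndPart x)) = 0
  · left
    intro η hη
    obtain ⟨z', x', θ, hθ, hv, ho⟩ := exists_anticommuting_of_expect_eq_zero hφ h
    have hηθ : (η * θ) = 1 ∨ (η * θ) = -1 := by
      rcases hη with rfl | rfl <;> rcases hθ with rfl | rfl <;> simp
    have hθ2 : θ * θ = 1 := by rcases hθ with rfl | rfl <;> simp
    have hW : pauli (Fin.append 0 z' : Q (n + k)) (Fin.append 0 x') = kron 1 (pauli z' x') := by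
      rw [pauli_append, pauli_zero]
    have hanti : pauli z x * pauli (Fin.append 0 z' : Q (n + k)) (Fin.append 0 x') =
        -(pauli (Fin.append 0 z') (Fin.append 0 x') * pauli z x) := by
      rw [pauli_mul_comm, omega]
      obtain ⟨a, b, rfl⟩ := exists_append z
      obtain ⟨c, d, rfl⟩ := exists_append x
      rw [sndPart_append, sndPart_append, omega] at ho
      rw [chi_append, chi_append, chi_zero_left, chi_zero_right, one_mul, one_mul, ho, neg_one_smul]
    set W : Op (n + k) := pauli (Fin.append 0 z') (Fin.append 0 x') with hWdef
    -- `W` acts on the prepared ancilla as the sign `θ`, so `η • pauli z x` may be replaced by `T`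
    -- there. As `W` anticommutes with `pauli z x`, the operator `T` is anti-Hermitian, and half of
    -- `1 + T` is a Clifford rotation divided by `√2`.
    set T : Op (n + k) := (η * θ) • (pauli z x * W) with hT
    have hTmem : T ∈ pauliGroup (n + k) :=
      smul_mem_pauliGroup (by rcases hηθ with h | h <;> rw [h] <;> norm_num)
        (mul_mem_pauliGroup (pauli_mem _ _) (pauli_mem _ _))
    have hTH : Tᴴ = -T := by
      rw [hT, Matrix.conjTranspose_smul, Matrix.conjTranspose_mul, pauli_conjTranspose, hWdef,
        pauli_conjTranspose, ← hWdef, hanti, smul_neg, neg_neg]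
      rcases hηθ with h | h <;> rw [h] <;> simp
    refine ⟨_, isClifford_rotation hTmem hTH, ?_⟩
    have hs : (1 / (Real.sqrt 2 : ℂ)) * star (1 / (Real.sqrt 2 : ℂ)) = 1 / 2 := by
      rw [star_div₀, star_one, RCLike.star_def, Complex.conj_ofReal, div_mul_div_comm,
        ← Complex.ofReal_mul, Real.mul_self_sqrt (by norm_num)]
      norm_num
    have hK : pauli z x * kron 1 (ketbra φ) =
        θ • (pauli z x * W * kron 1 (ketbra φ)) := by
      rw [Matrix.mul_assoc, hW, kron_mul, one_mul, mul_ketbra_of_eigen hv, kron_smul_right,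
        mul_smul_comm, smul_smul, hθ2, one_smul]
    rw [conj_comp_prepare_congr hφ.1 (B := (1 / 2 : ℂ) • (1 + T)), conj_smul, conj_smul, hs,
      LinearMap.smul_comp, LinearMap.smul_comp]
    · refine LinearMap.ext fun ρ => ?_
      ext x y
      simp only [LinearMap.smul_apply, Matrix.smul_apply, smul_eq_mul, Complex.real_smul,
        RCLike.star_def, map_div₀, map_one, map_ofNat]
      push_cast
      ring
    · rw [smul_mul_assoc, smul_mul_assoc, add_mul, add_mul, smul_mul_assoc, hK, smul_smul, hT,
        smul_mul_assoc]
  · right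
    obtain ⟨γ, hγ, hγ'⟩ : ∃ γ : ℂ, (γ = 1 ∨ γ = -1) ∧
        expect φ (pauli (sndPart z) (sndPart x)) = γ * (star φ ⬝ᵥ φ) := by
      rcases (hφ.stabLike _ _).resolve_left h with h | h
      · exact ⟨1, Or.inl rfl, by rw [h, one_mul]⟩
      · exact ⟨-1, Or.inr rfl, by rw [h, neg_one_mul]⟩
    have hv := eigen_of_expect hγ hγ'
    refine ⟨γ, hγ, fun η => ?_⟩
    rw [prepare_comp_conj]
    refine conj_comp_prepare_congr hφ.1 ?_
    rw [kron_smul_left, smul_mul_assoc, smul_mul_assoc, kron_add_left, kron_one_one, add_mul,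
      add_mul, kron_smul_left, smul_mul_assoc, smul_mul_assoc, pauli_eq_kron z x, kron_mul,
      kron_mul, mul_ketbra_of_eigen hv, kron_smul_right, smul_smul, mul_one, one_mul, one_mul]

/-- The effect of a Pauli measurement after a measurement-free stabiliser operation. -/
theorem IsDilated.measure {n m : ℕ} {E : Superop n m} (hE : IsDilated E) (z x : Q m) :
    (∀ ε : ℂ, (ε = 1 ∨ ε = -1) → ∃ F : Superop n m, IsDilated F ∧
      conj ((1 / 2 : ℂ) • (1 + ε • pauli z x)) ∘ₗ E = (1 / 2 : ℝ) • F) ∨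
    ∃ (κ : ℂ) (a b : Q n), (κ = 1 ∨ κ = -1) ∧ ∀ ε : ℂ,
      conj ((1 / 2 : ℂ) • (1 + ε • pauli z x)) ∘ₗ E =
        E ∘ₗ conj ((1 / 2 : ℂ) • (1 + (ε * κ) • pauli a b)) := by
  obtain ⟨k, j, e, φ, U, hφ, hU, rfl⟩ := hE
  obtain ⟨hU1, -, hU3⟩ := isClifford_iff.1 hU
  set w : Op (n + k) := rx e.symm (kron (pauli z x) 1) with hw
  have hwmem : w ∈ pauliGroup (n + k) :=
    rx_mem_pauliGroup _ (kron_mem_pauliGroup (pauli_mem z x) one_mem_pauliGroup)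
  obtain ⟨z', x', hw'⟩ := eq_or_neg_of_hermitian (hU3 w hwmem) (by
    rw [Matrix.conjTranspose_mul, Matrix.conjTranspose_mul, Matrix.conjTranspose_conjTranspose, hw,
      rx_conjTranspose, kron_conjTranspose, pauli_conjTranspose, Matrix.conjTranspose_one,
      Matrix.mul_assoc])
  obtain ⟨δ, hδ, hw'⟩ : ∃ δ : ℂ, (δ = 1 ∨ δ = -1) ∧ Uᴴ * w * U = δ • pauli z' x' := by
    rcases hw' with h | h
    · exact ⟨1, Or.inl rfl, by rw [h, one_smul]⟩
    · exact ⟨-1, Or.inr rfl, by rw [h, neg_one_smul]⟩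
  have hUU : U * Uᴴ = 1 := mul_eq_one_comm.1 hU1
  -- Heisenberg picture: the output projection is moved past discarding, relabelling and `U`, where
  -- it becomes a Pauli projection on input and ancilla with sign `δ`.
  have hpull : ∀ ε : ℂ, conj ((1 / 2 : ℂ) • (1 + ε • pauli z x)) ∘ₗ
      discard ∘ₗ rx e ∘ₗ conj U ∘ₗ (prepare (ketbra φ) : Superop n (n + k)) =
      discard ∘ₗ rx e ∘ₗ conj U ∘ₗ conj ((1 / 2 : ℂ) • (1 + (ε * δ) • pauli z' x')) ∘ₗ
        prepare (ketbra φ) := by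
    intro ε
    have hwU : w * U = δ • (U * pauli z' x') := by
      rw [← mul_smul_comm, ← hw', ← Matrix.mul_assoc, ← Matrix.mul_assoc, hUU, one_mul]
    have h1 : rx e.symm (kron ((1 / 2 : ℂ) • (1 + ε • pauli z x)) (1 : Op j)) * U =
        U * ((1 / 2 : ℂ) • (1 + (ε * δ) • pauli z' x')) := by
      rw [kron_smul_left, kron_add_left, kron_smul_left, kron_one_one, map_smul, map_add, map_smul,
        rx_one, ← hw]
      simp only [smul_mul_assoc, mul_smul_comm, add_mul, mul_add, one_mul, mul_one, hwU, smul_smul]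
    rw [← LinearMap.comp_assoc, conj_comp_discard, LinearMap.comp_assoc,
      ← LinearMap.comp_assoc _ _ (conj (kron _ _)), conj_comp_rx, LinearMap.comp_assoc,
      ← LinearMap.comp_assoc _ _ (conj (rx e.symm (kron _ _))), conj_comp_conj, h1,
      ← conj_comp_conj, LinearMap.comp_assoc]
  rcases measure_comp_prepare (n := n) hφ z' x' with h | ⟨γ, hγ, h⟩
  · left
    intro ε hε
    obtain ⟨C, hC, hC'⟩ := h (ε * δ) (by
      rcases hε with rfl | rfl <;> rcases hδ with rfl | rfl <;> simp)
    refine ⟨_, ⟨k, j, e, φ, U * C, hφ, hU.mul hC, rfl⟩, ?_⟩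
    rw [hpull, hC', ← conj_comp_conj]
    simp only [LinearMap.comp_assoc, LinearMap.comp_smul]
  · right
    refine ⟨δ * γ, fstPart z', fstPart x', ?_, fun ε => ?_⟩
    · rcases hγ with rfl | rfl <;> rcases hδ with rfl | rfl <;> simp
    · rw [hpull, h, mul_assoc]
      simp only [LinearMap.comp_assoc]

/-- Nondegeneracy of the symplectic form: a nonzero label has a nontrivial character by `sum_chi`.
-/
theorem exists_anticommuting {n : ℕ} {z x : Q n} (h : ¬(z = 0 ∧ x = 0)) :
    ∃ z' x' : Q n, omega z x z' x' = -1 := by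
  have aux : ∀ y : Q n, y ≠ 0 → ∃ u, chi u y = -1 := by
    intro y hy
    by_contra! hcon
    have h1 := sum_chi y
    rw [if_neg hy, Finset.sum_congr rfl fun u _ => (chi_eq_or u y).resolve_right (hcon u)] at h1
    simp [ZMod.card] at h1
  by_cases hx : x = 0
  · obtain ⟨u, hu⟩ := aux z fun hz => h ⟨hz, hx⟩
    exact ⟨0, u, by rw [omega, chi_zero_left, chi_comm z, hu, one_mul]⟩
  · obtain ⟨u, hu⟩ := aux x hx
    exact ⟨u, 0, by rw [omega, chi_zero_right, hu, mul_one]⟩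

/-- With `P` measured and `Q` anticommuting, `(1 + κP) Q (1 + κP) = Q (1 - κP)(1 + κP) = 0`. -/
theorem conj_one_add_pauli_eq_zero {n : ℕ} {z x z' x' : Q n} (h : omega z x z' x' = -1) {κ : ℂ}
    (hκ : κ = 1 ∨ κ = -1) : conj ((1 / 2 : ℂ) • (1 + κ • pauli z x)) (pauli z' x') = 0 := by
  have hcomm := pauli_mul_comm z x z' x'
  rw [h, neg_one_smul] at hcomm
  have hκ2 : κ * κ = 1 := by rcases hκ with rfl | rfl <;> simp
  rw [conj_smul, LinearMap.smul_apply, conj_apply, one_add_smul_pauli_conjTranspose hκ, add_mul,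
    one_mul, smul_mul_assoc, hcomm, mul_add, mul_one, add_mul, mul_smul_comm,
    smul_mul_assoc, smul_neg, neg_mul, mul_smul_comm, smul_neg, smul_smul, hκ2, one_smul,
    Matrix.mul_assoc, pauli_mul_self, Matrix.mul_one]
  simp

/-! ### Extreme points of `SO`. -/

/-- The maps that generate the stabiliser operations under mixing. -/
def generators (n m : ℕ) : Set (Superop n m) :=
  {F | IsDilated F} ∪ {F | IsStabilizerOp F ∧ ∃ z x : Q n, F (pauli z x) = 0}

theorem generators_subset_SO (n m : ℕ) : generators n m ⊆ SO n m := by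
  rintro F (hF | hF)
  · exact IsDilated.isStabilizerOp hF
  · exact hF.1

/-- The prefix `E` collects the steps made so far and stays measurement-free along the induction.
Only a nontrivial measurement of the input stops it; the rest of the protocol is then irrelevant,
since a Pauli operator is already lost. -/
theorem IsStabilizerOp.comp_mem_convexHull {n m : ℕ} {O : Superop n m} (hO : IsStabilizerOp O) :
    ∀ {a : ℕ} {E : Superop a n}, IsDilated E → O ∘ₗ E ∈ convexHull ℝ (generators a m) := by
  induction hO with
  | id => exact fun hE => subset_convexHull ℝ _ (Or.inl hE)
  | prepare σ hσ O hO ih =>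
    intro a E hE
    rw [LinearMap.comp_assoc]
    exact ih (hE.prepare_comp hσ)
  | clifford U hU O hO ih =>
    intro a E hE
    rw [LinearMap.comp_assoc]
    exact ih (hE.conj_comp hU)
  | measure z x O₁ O₂ h₁ h₂ ih₁ ih₂ =>
    intro a E hE
    have hSO := hE.isStabilizerOp.comp (IsStabilizerOp.measure z x O₁ O₂ h₁ h₂)
    rw [LinearMap.add_comp, LinearMap.comp_assoc, LinearMap.comp_assoc, projPlus_eq,
      projMinus_eq] at hSO ⊢
    rcases hE.measure z x with h | ⟨κ, b, c, hκ, h⟩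
    · obtain ⟨F, hF, hF'⟩ := h 1 (Or.inl rfl)
      obtain ⟨G, hG, hG'⟩ := h (-1) (Or.inr rfl)
      rw [hF', hG', LinearMap.comp_smul, LinearMap.comp_smul]
      exact convex_convexHull ℝ _ (ih₁ hF) (ih₂ hG) (by norm_num) (by norm_num) (by norm_num)
    -- Measuring the identity has a certain outcome, chosen by `κ`, so only one branch remains.
    · by_cases hbc : b = 0 ∧ c = 0
      · obtain ⟨rfl, rfl⟩ := hbc
        have hone : conj ((1 / 2 : ℂ) • (1 + (1 : ℂ) • pauli (0 : Q a) 0)) = LinearMap.id := by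
          rw [pauli_zero, one_smul, ← two_smul ℂ, smul_smul]
          norm_num
          exact conj_one
        have hzero : conj ((1 / 2 : ℂ) • (1 + (-1 : ℂ) • pauli (0 : Q a) 0)) = 0 := by
          rw [pauli_zero, neg_one_smul, add_neg_cancel, smul_zero]
          refine LinearMap.ext fun ρ => ?_
          rw [conj_apply, zero_mul, zero_mul]; rfl
        rw [h, h]
        rcases hκ with rfl | rfl
        · rw [mul_one, mul_one, hone, hzero, LinearMap.comp_zero, LinearMap.comp_zero, add_zero,
            LinearMap.comp_id]
          exact ih₁ hE
        · rw [one_mul, neg_one_mul, neg_neg, hone, hzero, LinearMap.comp_zero, LinearMap.comp_zero,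
            zero_add, LinearMap.comp_id]
          exact ih₂ hE
      -- Both outcome projections annihilate the same anticommuting Pauli operator.
      · obtain ⟨z', x', ho⟩ := exists_anticommuting hbc
        refine subset_convexHull ℝ _ (Or.inr ⟨hSO, z', x', ?_⟩)
        rw [h, h]
        have hκ' : -1 * κ = 1 ∨ -1 * κ = -1 := by rcases hκ with rfl | rfl <;> simp
        simp only [LinearMap.add_apply, LinearMap.comp_apply]
        rw [one_mul, conj_one_add_pauli_eq_zero ho hκ, conj_one_add_pauli_eq_zero ho hκ']
        simp
  | discard O hO ih =>
    intro a E hE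
    rw [LinearMap.comp_assoc]
    exact ih hE.discard_comp
  | random p hp₀ hp₁ O₁ O₂ h₁ h₂ ih₁ ih₂ =>
    intro a E hE
    rw [LinearMap.add_comp, LinearMap.smul_comp, LinearMap.smul_comp]
    exact convex_convexHull ℝ _ (ih₁ hE) (ih₂ hE) hp₀ (sub_nonneg.2 hp₁) (by ring)

/-- `SO` is the convex hull of `generators`, and an extreme point of a convex hull belongs to the
generating set. -/
theorem mem_generators_of_mem_extremePoints {n m : ℕ} {O : Superop n m}
    (hO : O ∈ Set.extremePoints ℝ (SO n m)) : O ∈ generators n m := by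
  have h1 : O ∈ convexHull ℝ (generators n m) := by
    have := IsStabilizerOp.comp_mem_convexHull (show IsStabilizerOp O from hO.1) isDilated_id
    rwa [LinearMap.comp_id] at this
  have h2 : convexHull ℝ (generators n m) ⊆ SO n m :=
    convexHull_min (generators_subset_SO n m) (convex_SO n m)
  exact extremePoints_convexHull_subset
    (inter_extremePoints_subset_extremePoints_of_subset h2 ⟨h1, hO⟩)

theorem exists_pauli_in_kernel {O : Superop 2 2} (hO : O ∈ Set.extremePoints ℝ (SO 2 2))
    (hD : ¬ HasCliffordDilation O) : ∃ z x : Q 2, O (pauli z x) = 0 := by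
  rcases mem_generators_of_mem_extremePoints hO with h | h
  · exact absurd (IsDilated.hasCliffordDilation h) hD
  · exact h.2

/-- Extremality in `CSP` passes to any subset that contains the point. In `SO` it would force a
Clifford dilation or a Pauli operator in the kernel. -/
theorem Lam_notMem_SO : Lam ∉ SO 2 2 := by
  intro h
  obtain ⟨z, x, hzx⟩ := exists_pauli_in_kernel
    (inter_extremePoints_subset_extremePoints_of_subset (SO_subset_CSP 2 2)
      ⟨h, Lam_mem_extremePoints⟩) Lam_not_hasCliffordDilation
  exact Lam_pauli_ne_zero z x hzx

end QubitStab

theorem theorem1 :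
    -- every two-qubit stabiliser operation is CSP, and the inclusion is strict
    QubitStab.SO 2 2 ⊂ QubitStab.CSP 2 2 ∧
    -- the channel `Λ` is a witness
    QubitStab.Lam ∈ QubitStab.CSP 2 2 ∧ QubitStab.Lam ∉ QubitStab.SO 2 2 ∧
    -- `Λ` is a vertex of `CSP_2`
    QubitStab.Lam ∈ Set.extremePoints ℝ (QubitStab.CSP 2 2) ∧
    -- `Λ` has no Clifford dilation
    ¬ QubitStab.HasCliffordDilation QubitStab.Lam ∧
    -- the kernel of `Λ` contains no Pauli operator
    (∀ z x : QubitStab.Q 2, QubitStab.Lam (QubitStab.pauli z x) ≠ 0) ∧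
    -- extremal stabiliser operations without Clifford dilation have a Pauli operator in the kernel
    (∀ O ∈ Set.extremePoints ℝ (QubitStab.SO 2 2), ¬ QubitStab.HasCliffordDilation O →
      ∃ z x : QubitStab.Q 2, O (QubitStab.pauli z x) = 0) :=
  ⟨⟨QubitStab.SO_subset_CSP 2 2, fun h => QubitStab.Lam_notMem_SO (h QubitStab.Lam_mem_CSP)⟩,
    QubitStab.Lam_mem_CSP, QubitStab.Lam_notMem_SO, QubitStab.Lam_mem_extremePoints,
    QubitStab.Lam_not_hasCliffordDilation, QubitStab.Lam_pauli_ne_zero,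
    fun _ hO hD => QubitStab.exists_pauli_in_kernel hO hD⟩
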